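/- **Setting.** Let $p$ be a prime, $K$ a field of characteristic $p$, and let $T\subset D=\mathbb G_m^n$ be a subtorus, given by its saturated cocharacter lattice $\mathfrak t\subset\mathbb Z^n$. Put $G=D/T$, $\mathfrak g_K=K\otimes(\mathbb Z^n/\mathfrak t)$, $S=\operatorname{Sym}_K(\mathfrak g_K)$, let $s_i\in S$ be the image of the $i$-th coordinate vector, and let $\widehat S$ be the completion of $S$ at the ideal $(s_1,\dots,s_n)$. Let $W_n=K\langle z_i,\partial_i\rangle$ be the Weyl algebra, $h_i=z_i\partial_i$, and let $A$ be the algebra of $T$-invariants in $W_n$. For $\lambda\in\operatorname{Hom}(\mathfrak t,\mathbb Z)$ let $A^\lambda$ be the quotient of $A$ by the two-sided ideal generated by the elements $\sum_i\chi_ih_i-\lambda(\chi)$, $\chi\in\mathfrak t$; it inherits a $D$-grading. Let $\mathfrak g^{*,\lambda}$ be the set of $a\in\mathbb Z^n$ with $\sum_i\chi_ia_i=\lambda(\chi)$ for all $\chi\in\mathfrak t$. For $a\in\mathfrak g^{*,\lambda}$ let $$Q_a=\varprojlim_N A^\lambda\Big/\sum_iA^\lambda(h_i-a_i)^N ,$$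 with the inverse limit topology and the $D$-action for which $1_a$, the image of $1$, has weight $a$. The ring $\widehat S$ acts on $Q_a$ so that $s_i$ acts on vectors of $D$-weight $c$ by $h_i-c_i$. Morphisms between these modules are the continuous $A^\lambda$-linear maps compatible with $D$. For $x\in\mathbb Z^n$ let $\Delta_x=\{a\in\mathfrak g^{*,\lambda}: px_i\le a_i<px_i+p \text{ for all } i\}$. Let $\Lambda=\{x:\Delta_x\ne\emptyset\}$; these $x$ index the chambers of the periodic arrangement of the hyperplanes $a_i=kp-\tfrac12$ ($k\in\mathbb Z$) in $\mathfrak g^{*,\lambda}$. For each $x\in\Lambda$ choose any $b_x\in\Delta_x$ and put $P_x=Q_{b_x}$. By $\operatorname{End}(\bigoplus_xP_x)$ we mean $\bigoplus_{x,y\in\Lambda}\operatorname{Hom}(P_y,P_x)$, that is, the endomorphisms with finitely many non-zero matrix entries. Let $1_x$ be the projection to $P_x$. For $x,y\in\Lambda$ let $c_{x,y}\colon P_y\to P_x$ be the morphism with $$c_{x,y}(1_{b_y})=\Big(\prod_{i=1}^n\ \prod_{1\le j\le \beta_i}q(s_i,b_{x,i}+j)\Big)\prod_{\beta_i>0}z_i^{\beta_i}\prod_{\beta_i<0}\partial_i^{-\beta_i}\cdot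 1_{b_x},\qquad \beta=b_y-b_x,$$ where $q(s_i,k)=1$ if $p\mid k$ and $q(s_i,k)=(s_i+k)^{-1}\in\widehat S$ otherwise. Finally put $\eta_i(x,y,u)=\tfrac12\big(|x_i-y_i|+|y_i-u_i|-|x_i-u_i|\big)$. **Theorem.** (1) $\operatorname{End}(\bigoplus_xP_x)$ is the $\widehat S$-algebra generated by the orthogonal idempotents $1_x$ and the elements $c_{x,y}=1_xc_{x,y}1_y$ ($x,y\in\Lambda$), with $c_{x,x}=1_x$, modulo the relations $$c_{x,y}c_{y,u}=\prod_is_i^{\eta_i(x,y,u)}\,c_{x,u}\qquad(x,y,u\in\Lambda).$$ (2) Suppose that $\lambda$ is smooth: there is a neighbourhood $U$ of $\lambda$ in $\operatorname{Hom}(\mathfrak t,\mathbb R)$ such that for every $\lambda'\in U$ the set $\Lambda$ equals the set of all $x\in\mathbb Z^n$ for which there is $a\in\mathbb R^n$ with $\sum_i\chi_ia_i=\lambda'(\chi)$ for all $\chi\in\mathfrak t$ and $px_i\le a_i<px_i+p$ for all $i$. Let $\epsilon_i$ be the $i$-th unit vector and $c_x^{\pm i}=c_{x\pm\epsilon_i,x}$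 for $x,x\pm\epsilon_i\in\Lambda$. Then $\operatorname{End}(\bigoplus_xP_x)$ is the $A$-algebra of the periodic arrangement with coefficients in $\widehat S$. That is, it is the quotient of the path algebra over $\widehat S$ of the quiver with vertices $x\in\Lambda$ (with idempotents $1_x$) and arrows $c_x^{\pm i}$ from $x$ to $x\pm\epsilon_i$, by the following relations, which are quadratic (homogeneous of degree $2$ when $\deg c_x^{\pm i}=1$ and $\deg s_i=2$): * if $x,x+\epsilon_i\in\Lambda$, then $c_{x+\epsilon_i}^{-i}c_x^{+i}=s_i1_x$ and $c_x^{+i}c_{x+\epsilon_i}^{-i}=s_i1_{x+\epsilon_i}$; * if $i\ne j$ and $x,x+\epsilon_i,x+\epsilon_j,x+\epsilon_i+\epsilon_j\in\Lambda$, then $$c_{x+\epsilon_i}^{+j}c_x^{+i}=c_{x+\epsilon_j}^{+i}c_x^{+j},\qquad c_{x+\epsilon_j}^{-j}c_{x+\epsilon_i+\epsilon_j}^{-i}=c_{x+\epsilon_i}^{-i}c_{x+\epsilon_i+\epsilon_j}^{-j},$$ $$c_{x+\epsilon_i+\epsilon_j}^{-j}c_{x+\epsilon_j}^{+i}=c_x^{+i}c_{x+\epsilon_j}^{-j},\qquad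 c_{x+\epsilon_i+\epsilon_j}^{-i}c_{x+\epsilon_i}^{+j}=c_x^{+j}c_{x+\epsilon_i}^{-i}.$$ -/

import Mathlib

noncomputable section

namespace Hypertoric

/-! ### The Weyl algebra and its torus actions -/

section Weyl

variable (R : Type*) [CommRing R] (n : ℕ)

/-- The defining relations of the Weyl algebra; `Sum.inl i` stands for `z_i`,
`Sum.inr i` for `∂_i`. -/
inductive WeylRel :
    FreeAlgebra R (Fin n ⊕ Fin n) → FreeAlgebra R (Fin n ⊕ Fin n) → Prop
  | zz (i j : Fin n) :
      WeylRel (FreeAlgebra.ι R (Sum.inl i) * FreeAlgebra.ι R (Sum.inl j))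
        (FreeAlgebra.ι R (Sum.inl j) * FreeAlgebra.ι R (Sum.inl i))
  | dd (i j : Fin n) :
      WeylRel (FreeAlgebra.ι R (Sum.inr i) * FreeAlgebra.ι R (Sum.inr j))
        (FreeAlgebra.ι R (Sum.inr j) * FreeAlgebra.ι R (Sum.inr i))
  | dz (i j : Fin n) :
      WeylRel (FreeAlgebra.ι R (Sum.inr i) * FreeAlgebra.ι R (Sum.inl j))
        (FreeAlgebra.ι R (Sum.inl j) * FreeAlgebra.ι R (Sum.inr i) + if i = j then 1 else 0)

/-- The Weyl algebra `W_n` over `R`. -/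
def Weyl : Type _ := RingQuot (WeylRel R n)

instance : Ring (Weyl R n) := inferInstanceAs (Ring (RingQuot (WeylRel R n)))

instance : Algebra R (Weyl R n) := inferInstanceAs (Algebra R (RingQuot (WeylRel R n)))

/-- The quotient map from the free algebra. -/
def toWeyl : FreeAlgebra R (Fin n ⊕ Fin n) →ₐ[R] Weyl R n := RingQuot.mkAlgHom R (WeylRel R n)

variable {n}

/-- The generator `z_i`. -/
def z (i : Fin n) : Weyl R n := toWeyl R n (FreeAlgebra.ι R (Sum.inl i))

/-- The generator `∂_i`. -/
def d (i : Fin n) : Weyl R n := toWeyl R n (FreeAlgebra.ι R (Sum.inr i))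

theorem z_comm (i j : Fin n) : z R i * z R j = z R j * z R i := by
  simp only [z, ← map_mul]
  exact RingQuot.mkAlgHom_rel R (WeylRel.zz i j)

theorem d_comm (i j : Fin n) : d R i * d R j = d R j * d R i := by
  simp only [d, ← map_mul]
  exact RingQuot.mkAlgHom_rel R (WeylRel.dd i j)

theorem d_z (i j : Fin n) : d R i * z R j = z R j * d R i + if i = j then 1 else 0 := by
  have h : toWeyl R n _ = toWeyl R n _ := RingQuot.mkAlgHom_rel R (WeylRel.dz (R := R) i j)
  rw [map_mul, map_add, map_mul] at h
  rw [z, d, h]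
  split_ifs <;> simp

/-- The (co)action on the Weyl algebra of the diagonalizable group with character group `M`, which
acts on `z_i` through the character `ε i` and on `∂_i` through `-ε i`: an element `w` has weight `c`
if and only if it is sent to `w ⊗ e^c`. -/
def coact {M : Type*} [AddCommGroup M] (ε : Fin n → M) :
    Weyl R n →ₐ[R] AddMonoidAlgebra (Weyl R n) M :=
  RingQuot.liftAlgHom R ⟨FreeAlgebra.lift R
    (Sum.elim (fun i => AddMonoidAlgebra.single (ε i) (z R i))
      (fun i => AddMonoidAlgebra.single (-ε i) (d R i))), by
    intro x y h
    cases h with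
    | zz i j =>
      simp [AddMonoidAlgebra.single_mul_single, z_comm R i j, add_comm (ε i)]
    | dd i j =>
      simp [AddMonoidAlgebra.single_mul_single, d_comm R i j, add_comm (-ε i)]
    | dz i j =>
      by_cases hij : i = j
      · subst hij
        simp [AddMonoidAlgebra.single_mul_single, d_z, AddMonoidAlgebra.one_def]
      · simp [AddMonoidAlgebra.single_mul_single, d_z, hij, add_comm (ε j)]⟩

theorem coact_z {M : Type*} [AddCommGroup M] (ε : Fin n → M) (i : Fin n) :
    coact R ε (z R i) = AddMonoidAlgebra.single (ε i) (z R i) := by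
  unfold coact z toWeyl
  erw [RingQuot.liftAlgHom_mkAlgHom_apply]
  simp

theorem coact_d {M : Type*} [AddCommGroup M] (ε : Fin n → M) (i : Fin n) :
    coact R ε (d R i) = AddMonoidAlgebra.single (-ε i) (d R i) := by
  unfold coact d toWeyl
  erw [RingQuot.liftAlgHom_mkAlgHom_apply]
  simp

/-- The minimal monomial `∏_{c_i > 0} z_i ^ c_i * ∏_{c_i < 0} ∂_i ^ (-c_i)` of weight `c`. -/
def mono (c : Fin n → ℤ) : Weyl R n :=
  (List.ofFn fun i => z R i ^ (c i).toNat).prod * (List.ofFn fun i => d R i ^ (-c i).toNat).prod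

theorem coact_prod {M : Type*} [AddCommGroup M] (ε : Fin n → M) {m : ℕ} (f : Fin m → Weyl R n)
    (g : Fin m → M) (h : ∀ i, coact R ε (f i) = AddMonoidAlgebra.single (g i) (f i)) :
    coact R ε (List.ofFn f).prod =
      AddMonoidAlgebra.single (∑ i, g i) (List.ofFn f).prod := by
  induction m with
  | zero => simp [AddMonoidAlgebra.one_def]
  | succ m ih =>
    rw [List.ofFn_succ, List.prod_cons, map_mul, h, ih _ (fun i => g i.succ) (fun i => h _),
      AddMonoidAlgebra.single_mul_single, Fin.sum_univ_succ]

theorem coact_mono {M : Type*} [AddCommGroup M] (ε : Fin n → M) (c : Fin n → ℤ) :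
    coact R ε (mono R c) = AddMonoidAlgebra.single (∑ i, c i • ε i) (mono R c) := by
  rw [mono, map_mul, coact_prod R ε _ (fun i => (c i).toNat • ε i),
    coact_prod R ε _ (fun i => (-c i).toNat • -ε i), AddMonoidAlgebra.single_mul_single,
    ← Finset.sum_add_distrib]
  · congr 1
    refine Finset.sum_congr rfl fun i _ => ?_
    rw [← natCast_zsmul, ← natCast_zsmul, smul_neg, ← sub_eq_add_neg, ← sub_smul]
    congr 1
    omega
  · intro i
    rw [map_pow, coact_d, AddMonoidAlgebra.single_pow]
  · intro i
    rw [map_pow, coact_z, AddMonoidAlgebra.single_pow]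

end Weyl

/-! ### The hypertoric enveloping algebra

The subtorus `T ⊆ D` is given by its lattice of cocharacters `t ⊆ ℤⁿ`. -/

section HEA

variable {n : ℕ} (R : Type*) [CommRing R] (t : Submodule ℤ (Fin n → ℤ))

/-- The restriction to `T` of the `i`-th coordinate character of `D`. -/
def charT (i : Fin n) : t →ₗ[ℤ] ℤ := (LinearMap.proj i).comp t.subtype

/-- The algebra of `T`-invariants `A = W_n^T` over `R`. -/
def HEA : Subalgebra R (Weyl R n) :=
  AlgHom.equalizer (coact R (charT t)) AddMonoidAlgebra.singleZeroAlgHom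

theorem mem_HEA {w : Weyl R n} :
    w ∈ HEA R t ↔ coact R (charT t) w = AddMonoidAlgebra.single 0 w := Iff.rfl

/-- The element `h_i⁺ = z_i ∂_i` of `A`. -/
def hA (i : Fin n) : HEA R t :=
  ⟨z R i * d R i, by
    rw [mem_HEA, map_mul, coact_z, coact_d, AddMonoidAlgebra.single_mul_single, add_neg_cancel]⟩

/-- The non-commutative moment map `χ ↦ ∑ ⟨ε_i, χ⟩ h_i⁺`. -/
def moment (χ : t) : HEA R t := ∑ i, (χ : Fin n → ℤ) i • hA R t i

variable (lam : t →ₗ[ℤ] ℤ)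

/-- The relations `μ_q(χ) = λ(χ)`. -/
inductive HEARel : HEA R t → HEA R t → Prop
  | mk (χ : t) : HEARel (moment R t χ) ((lam χ : ℤ) : HEA R t)

/-- The quotient `A^λ` of `A` by the two-sided ideal generated by the `μ_q(χ) - λ(χ)`. -/
def HEAq : Type _ := RingQuot (HEARel R t lam)

instance : Ring (HEAq R t lam) := inferInstanceAs (Ring (RingQuot (HEARel R t lam)))

instance : Algebra R (HEAq R t lam) := inferInstanceAs (Algebra R (RingQuot (HEARel R t lam)))

/-- The quotient map `A → A^λ`. -/
def toHEAq : HEA R t →ₐ[R] HEAq R t lam := RingQuot.mkAlgHom R (HEARel R t lam)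

/-- The image of `h_i⁺` in `A^λ`. -/
def h (i : Fin n) : HEAq R t lam := toHEAq R t lam (hA R t i)

/-- The subspace `A^λ[c]` of elements of `D`-weight `c`. -/
def wtA (c : Fin n → ℤ) : Set (HEAq R t lam) :=
  toHEAq R t lam '' {w | coact R (fun i => (Pi.single i 1 : Fin n → ℤ)) (w : Weyl R n) =
    AddMonoidAlgebra.single c (w : Weyl R n)}

theorem h_comm (i j : Fin n) : h R t lam i * h R t lam j = h R t lam j * h R t lam i := by
  rw [h, h, ← map_mul, ← map_mul]
  congr 1
  ext
  change z R i * d R i * (z R j * d R j) = z R j * d R j * (z R i * d R i)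
  by_cases hij : i = j
  · rw [hij]
  · have h1 : d R i * z R j = z R j * d R i := by simpa [hij] using d_z R i j
    have h2 : d R j * z R i = z R i * d R j := by simpa [Ne.symm hij] using d_z R j i
    calc z R i * d R i * (z R j * d R j) = z R i * (d R i * z R j) * d R j := by noncomm_ring
      _ = (z R i * z R j) * (d R i * d R j) := by rw [h1]; noncomm_ring
      _ = (z R j * z R i) * (d R j * d R i) := by rw [z_comm, d_comm]
      _ = z R j * (z R i * d R j) * d R i := by noncomm_ring
      _ = z R j * d R j * (z R i * d R i) := by rw [← h2]; noncomm_ring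

theorem sum_h (χ : t) :
    ∑ i, (χ : Fin n → ℤ) i • h R t lam i = ((lam χ : ℤ) : HEAq R t lam) := by
  have := RingQuot.mkAlgHom_rel R (HEARel.mk (R := R) (lam := lam) χ)
  change toHEAq R t lam _ = toHEAq R t lam _ at this
  simpa [moment, h] using this

/-- The coset of characters of `D` whose restriction to `T` is `λ`. -/
abbrev Wt : Type := {a : Fin n → ℤ // ∀ χ : t, ∑ i, (χ : Fin n → ℤ) i * a i = lam χ}

/-- The difference `a - a'` of two elements of the coset lies in the annihilator of `t`, so that
the minimal monomial `m(a - a')` is an element of `A^λ`. -/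
def m (a a' : Wt t lam) : HEAq R t lam :=
  toHEAq R t lam ⟨mono R (a.1 - a'.1), by
    rw [mem_HEA, coact_mono]
    congr 1
    ext χ
    have h1 := a.2 χ
    have h2 := a'.2 χ
    simp only [LinearMap.coe_sum, Finset.sum_apply, LinearMap.smul_apply, charT,
      LinearMap.comp_apply, Submodule.subtype_apply, LinearMap.proj_apply, smul_eq_mul,
      LinearMap.zero_apply, Pi.sub_apply, sub_mul, Finset.sum_sub_distrib]
    simp only [mul_comm (a.1 _), mul_comm (a'.1 _), h1, h2, sub_self]⟩

end HEA

/-! ### The ring `Ŝ` -/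

section S

variable {n : ℕ} (K : Type*) [Field K] (t : Submodule ℤ (Fin n → ℤ))

/-- The ring `S = U(𝔤_K)`, where `𝔤_K = K ⊗ (ℤⁿ / t)` is the (abelian) Lie algebra of `G = D / T`:
the symmetric algebra of `𝔤_K`. -/
abbrev S : Type _ := SymmetricAlgebra K (TensorProduct ℤ K ((Fin n → ℤ) ⧸ t))

/-- The element `s_i` of `S` given by the image in `𝔤` of the `i`-th coordinate cocharacter. -/
def sS (i : Fin n) : S K t :=
  SymmetricAlgebra.ι K _ (TensorProduct.tmul ℤ 1 (Submodule.Quotient.mk (Pi.single i 1)))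

/-- The ideal of the origin, generated by the `s_i` (which span `𝔤_K`). -/
def S0 : Ideal (S K t) := Ideal.span (Set.range (sS K t))

/-- The completion `Ŝ` of `S` at zero. -/
abbrev Shat : Type _ := AdicCompletion (S0 K t) (S K t)

/-- The element `s_i` of `Ŝ`. -/
def s (i : Fin n) : Shat K t := algebraMap (S K t) (Shat K t) (sS K t i)

open Classical in
/-- The element `q(s_i, k)` of `Ŝ` for an integer `k`: it is `1` if `k = 0` in `K`, and otherwise
`1 / (s_i + k)`, where `s_i + k` is a unit of the complete local ring `Ŝ`. -/
def q (i : Fin n) (k : ℤ) : Shat K t := if (k : K) = 0 then 1 else Ring.inverse (s K t i + k)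

end S

/-! ### The pro-projective modules `Q_a` -/

section Q

variable {n : ℕ} (K : Type*) [Field K] (t : Submodule ℤ (Fin n → ℤ)) (lam : t →ₗ[ℤ] ℤ)

/-- The commutative subalgebra of `A^λ` generated by the `h_i⁺`. -/
abbrev hAlg : Subalgebra K (HEAq K t lam) := Algebra.adjoin K (Set.range (h K t lam))

instance : IsMulCommutative (hAlg K t lam) :=
  Algebra.isMulCommutative_adjoin K (by
    rintro _ ⟨i, rfl⟩ _ ⟨j, rfl⟩
    exact h_comm K t lam i j)

variable {t lam} (a : Wt t lam)

section Phi

open scoped IsMulCommutative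

/-- The element `h_i⁺ - a_i`. -/
def hsub (i : Fin n) : hAlg K t lam :=
  ⟨h K t lam i, Algebra.subset_adjoin ⟨i, rfl⟩⟩ - (a.1 i : hAlg K t lam)

/-- The linear map `𝔤_K → A^λ` sending the class of the `i`-th coordinate cocharacter to
`h_i⁺ - a_i`. -/
def phiLin : TensorProduct ℤ K ((Fin n → ℤ) ⧸ t) →ₗ[K] hAlg K t lam :=
  LinearMap.liftBaseChange K (t.liftQ (Fintype.linearCombination ℤ (hsub K a)) (by
    intro χ hχ
    rw [LinearMap.mem_ker, Fintype.linearCombination_apply]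
    apply Subtype.ext
    have h1 := sum_h K t lam ⟨χ, hχ⟩
    have h2 : ((∑ i, χ i * a.1 i : ℤ) : HEAq K t lam) = ((lam ⟨χ, hχ⟩ : ℤ) : HEAq K t lam) :=
      congrArg _ (a.2 ⟨χ, hχ⟩)
    rw [AddSubmonoidClass.coe_finsetSum]
    have h3 : ∀ i, ((χ i • hsub K a i : hAlg K t lam) : HEAq K t lam) =
        χ i • h K t lam i - ((χ i * a.1 i : ℤ) : HEAq K t lam) := by
      intro i
      simp [hsub, mul_sub]
    simp only [h3, Finset.sum_sub_distrib]
    rw [← Int.cast_sum, h2, h1]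
    simp))

/-- The algebra homomorphism `S → A^λ` sending `s_i` to `h_i⁺ - a_i`. -/
def phi : S K t →ₐ[K] HEAq K t lam :=
  (hAlg K t lam).val.comp (SymmetricAlgebra.lift (phiLin K a))

theorem phi_sS (i : Fin n) : phi K a (sS K t i) = h K t lam i - (a.1 i : HEAq K t lam) := by
  have h1 : phiLin K a (TensorProduct.tmul ℤ 1 (Submodule.Quotient.mk (Pi.single i 1))) =
      hsub K a i := by
    rw [phiLin, LinearMap.liftBaseChange_tmul, Submodule.liftQ_apply, one_smul,
      Fintype.linearCombination_apply_single, one_smul]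
  rw [phi, sS, AlgHom.comp_apply, SymmetricAlgebra.lift_ι_apply, h1]
  simp [hsub]

end Phi

/-- The left ideal `∑ A^λ (h_i⁺ - a_i)^N`. -/
def J (N : ℕ) : Submodule (HEAq K t lam) (HEAq K t lam) :=
  Submodule.span _ (Set.range fun i => (h K t lam i - (a.1 i : HEAq K t lam)) ^ N)

theorem J_le (x : S K t) (N : ℕ) :
    J K a N ≤ (J K a N).comap (LinearMap.toSpanSingleton _ _ (phi K a x)) := by
  rw [J, Submodule.span_le]
  rintro _ ⟨i, rfl⟩
  change _ * phi K a x ∈ J K a N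
  have h1 : (h K t lam i - (a.1 i : HEAq K t lam)) ^ N * phi K a x =
      phi K a x * (h K t lam i - (a.1 i : HEAq K t lam)) ^ N := by
    rw [← phi_sS, ← map_pow, ← map_mul, mul_comm, map_mul]
  refine (congrArg (· ∈ J K a N) h1).mpr ?_
  exact Submodule.smul_mem _ _ (Submodule.subset_span ⟨i, rfl⟩)

theorem J_anti {N N' : ℕ} (hN : N ≤ N') : J K a N' ≤ J K a N := by
  conv_lhs => rw [J]
  rw [Submodule.span_le]
  rintro _ ⟨i, rfl⟩
  dsimp only
  rw [← Nat.sub_add_cancel hN, pow_add]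
  exact Submodule.smul_mem _ _ (Submodule.subset_span ⟨i, rfl⟩)

/-- The action of `S` on `A^λ / ∑ A^λ (h_i⁺ - a_i)^N` in which `s_i` acts by right multiplication by
`h_i⁺ - a_i`. On the elements of `D`-weight `c` this is `v ↦ h_i⁺ v - c_i v`. -/
def actS (N : ℕ) : S K t →+* Module.End (HEAq K t lam) (HEAq K t lam ⧸ J K a N) where
  toFun x := (J K a N).mapQ (J K a N) (LinearMap.toSpanSingleton _ _ (phi K a x)) (J_le K a x N)
  map_one' := by
    apply Submodule.linearMap_qext
    ext
    simp
  map_zero' := by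
    apply Submodule.linearMap_qext
    ext
    simp
  map_add' x y := by
    apply Submodule.linearMap_qext
    ext
    simp
  map_mul' x y := by
    apply Submodule.linearMap_qext
    ext
    simp [mul_comm x y]

theorem actS_mk (N : ℕ) (x : S K t) (w : HEAq K t lam) :
    actS K a N x (Submodule.Quotient.mk w) = Submodule.Quotient.mk (w * phi K a x) := rfl

theorem exists_pow_le (N : ℕ) :
    ∃ M : ℕ, S0 K t ^ M ≤ Ideal.span (Set.range fun i => sS K t i ^ N) := by
  apply Ideal.exists_pow_le_of_le_radical_of_fg
  · rw [S0, Ideal.span_le]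
    rintro _ ⟨i, rfl⟩
    exact ⟨N, Ideal.subset_span ⟨i, rfl⟩⟩
  · exact Submodule.fg_span (Set.finite_range _)

theorem actS_eq_zero (N : ℕ) {x : S K t}
    (hx : x ∈ Ideal.span (Set.range fun i => sS K t i ^ N)) : actS K a N x = 0 := by
  have : Ideal.span (Set.range fun i => sS K t i ^ N) ≤ RingHom.ker (actS K a N) := by
    rw [Ideal.span_le]
    rintro _ ⟨i, rfl⟩
    apply Submodule.linearMap_qext
    apply LinearMap.ext_ring
    change actS K a N (sS K t i ^ N) (Submodule.Quotient.mk 1) = 0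
    rw [actS_mk, one_mul, map_pow, phi_sS]
    exact (Submodule.Quotient.mk_eq_zero _).2 (Submodule.subset_span ⟨i, rfl⟩)
  exact this hx

/-- A power of the ideal of the origin that acts by zero on `A^λ / ∑ A^λ (h_i⁺ - a_i)^N`. -/
def bd (t : Submodule ℤ (Fin n → ℤ)) (N : ℕ) : ℕ := (exists_pow_le K (t := t) N).choose

theorem actS_bd (N : ℕ) (x : S K t) (hx : x ∈ S0 K t ^ bd K t N) : actS K a N x = 0 :=
  actS_eq_zero K a N ((exists_pow_le K N).choose_spec hx)

/-- The induced action of `Ŝ` on `A^λ / ∑ A^λ (h_i⁺ - a_i)^N`. -/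
def actN (N : ℕ) : Shat K t →+* Module.End (HEAq K t lam) (HEAq K t lam ⧸ J K a N) :=
  (Ideal.Quotient.lift (S0 K t ^ bd K t N) (actS K a N) (actS_bd K a N)).comp
    (AdicCompletion.evalₐ (S0 K t) (bd K t N)).toRingHom

theorem actN_eq {N M : ℕ} (hM : bd K t N ≤ M) (x : Shat K t) (y : S K t)
    (hy : AdicCompletion.evalₐ (S0 K t) M x = Ideal.Quotient.mk _ y) :
    actN K a N x = actS K a N y := by
  have : AdicCompletion.evalₐ (S0 K t) (bd K t N) x = Ideal.Quotient.mk _ y := by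
    induction x using AdicCompletion.induction_on with
    | _ x =>
      rw [AdicCompletion.evalₐ_mk, Ideal.Quotient.eq] at hy ⊢
      have h1 := x.2 hM
      rw [SModEq.sub_mem, smul_eq_mul, Ideal.mul_top] at h1
      have h2 := add_mem h1 (Ideal.pow_le_pow_right hM hy)
      rwa [sub_add_sub_cancel] at h2
  simp [actN, this]

/-- The module `Q_a`, the inverse limit of the `A^λ / ∑ A^λ (h_i⁺ - a_i)^N`. -/
def Q : Submodule (HEAq K t lam) (∀ N, HEAq K t lam ⧸ J K a N) where
  carrier := {v | ∀ N N' (hN : N ≤ N'), Submodule.factor (J_anti K a hN) (v N') = v N}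
  zero_mem' _ _ _ := map_zero _
  add_mem' hv hw N N' hN := by simp [hv N N' hN, hw N N' hN]
  smul_mem' r v hv N N' hN := by simp [hv N N' hN]

theorem actN_factor {N N' : ℕ} (hN : N ≤ N') (x : Shat K t) (v : HEAq K t lam ⧸ J K a N') :
    Submodule.factor (J_anti K a hN) (actN K a N' x v) =
      actN K a N x (Submodule.factor (J_anti K a hN) v) := by
  obtain ⟨y, hy⟩ := Ideal.Quotient.mk_surjective
    (AdicCompletion.evalₐ (S0 K t) (max (bd K t N) (bd K t N')) x)
  rw [actN_eq K a (le_max_left _ _) x y hy.symm, actN_eq K a (le_max_right _ _) x y hy.symm]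
  obtain ⟨w, rfl⟩ := Submodule.Quotient.mk_surjective _ v
  have e : ∀ u, Submodule.factor (J_anti K a hN) (Submodule.Quotient.mk u) =
      Submodule.Quotient.mk u := fun u => Submodule.factor_mk _ u
  rw [actS_mk, e, e, actS_mk]

/-- The action of `Ŝ` on `Q_a`. -/
def act : Shat K t →+* Module.End (HEAq K t lam) (Q K a) where
  toFun x := LinearMap.restrict (LinearMap.pi fun N => (actN K a N x).comp (LinearMap.proj N))
    (by
      intro v hv N N' hN
      simp only [LinearMap.pi_apply, LinearMap.comp_apply, LinearMap.proj_apply]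
      rw [actN_factor K a hN, hv N N' hN])
  map_one' := by
    refine LinearMap.ext fun v => Subtype.ext (funext fun N => ?_)
    change actN K a N 1 (v.1 N) = v.1 N
    rw [map_one, Module.End.one_apply]
  map_zero' := by
    refine LinearMap.ext fun v => Subtype.ext (funext fun N => ?_)
    change actN K a N 0 (v.1 N) = 0
    rw [map_zero, LinearMap.zero_apply]
  map_add' x y := by
    refine LinearMap.ext fun v => Subtype.ext (funext fun N => ?_)
    change actN K a N (x + y) (v.1 N) = actN K a N x (v.1 N) + actN K a N y (v.1 N)
    rw [map_add, LinearMap.add_apply]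
  map_mul' x y := by
    refine LinearMap.ext fun v => Subtype.ext (funext fun N => ?_)
    change actN K a N (x * y) (v.1 N) = actN K a N x (actN K a N y (v.1 N))
    rw [map_mul, Module.End.mul_apply]

/-- `Q_a` as an `Ŝ`-module: on the vectors of `D`-weight `c`, `s_i` acts by `h_i⁺ - c_i`. -/
instance : Module (Shat K t) (Q K a) := Module.compHom _ (act K a)

instance : SMulCommClass (HEAq K t lam) (Shat K t) (Q K a) :=
  ⟨fun r x v => ((act K a x).map_smul r v).symm⟩

/-- The inverse limit topology, the quotients `A^λ / ∑ A^λ (h_i⁺ - a_i)^N` being discrete. -/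
instance : TopologicalSpace (Q K a) :=
  ⨅ N, TopologicalSpace.induced (fun v : Q K a => v.1 N) ⊥

/-- The canonical generator `1_a`, of `D`-weight `a`. -/
def one : Q K a := ⟨fun _ => Submodule.Quotient.mk 1, fun _ _ _ => rfl⟩

/-- The weight functor `W_c`, applied to `Q_a`: the vectors of `D`-weight `c` in `Q_a`, where `1_a`
has `D`-weight `a`. -/
def W (c : Fin n → ℤ) : Set (Q K a) :=
  {v | ∀ N, v.1 N ∈ Submodule.Quotient.mk '' wtA K t lam (c - a.1)}

variable {K a} in
/-- The morphisms `Q_a → Q_{a'}`: the `A^λ`-linear maps that are continuous and compatible with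
`D`. -/
def IsHom {a' : Wt t lam} (f : Q K a →ₗ[HEAq K t lam] Q K a') : Prop :=
  Continuous f ∧ ∀ c : Fin n → ℤ, ∀ v ∈ W K a c, f v ∈ W K a' c

/-- The vector `m(b) ∏_i ∏_{1 ≤ j ≤ b_i} q(s_i, a_i + j) · 1_a` of `Q_a`, where `b = a' - a`. It has
`D`-weight `a'`, and thus gives a morphism `Q_{a'} → Q_a`. -/
def cvec (a a' : Wt t lam) : Q K a :=
  (∏ i, ∏ j ∈ Finset.Icc 1 (a'.1 i - a.1 i), q K t i (a.1 i + j)) • m K t lam a' a • one K a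

end Q

/-! ### Chambers -/

section Chambers

variable {n : ℕ} {t : Submodule ℤ (Fin n → ℤ)}

/-- The set `Δ_x` of characters in the coset with `p x_i ≤ a_i < p x_i + p`. -/
def Δ (p : ℕ) (lam : t →ₗ[ℤ] ℤ) (x : Fin n → ℤ) : Set (Wt t lam) :=
  {a | ∀ i, p * x i ≤ a.1 i ∧ a.1 i < p * x i + p}

/-- The set `Λ(λ)` of chambers of the periodic arrangement. -/
def Λ (p : ℕ) (lam : t →ₗ[ℤ] ℤ) : Set (Fin n → ℤ) := {x | (Δ p lam x).Nonempty}

/-- The set `Λ^ℝ(λ')` for a real parameter `λ'`: all `x` such that some real point `a` restricting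
to `λ'` on `t` satisfies `p x_i ≤ a_i < p x_i + p`. -/
def ΛR (p : ℕ) (lam' : t →ₗ[ℤ] ℝ) : Set (Fin n → ℤ) :=
  {x | ∃ a : Fin n → ℝ, (∀ χ : t, ∑ i, ((χ : Fin n → ℤ) i : ℝ) * a i = lam' χ) ∧
    ∀ i, p * x i ≤ a i ∧ a i < p * x i + p}

/-- `λ` is smooth if `Λ^ℝ(λ') = Λ(λ)` for all `λ'` in a neighbourhood of `λ` in
`t^*_ℝ = Hom(t, ℝ)` (whose usual topology is that of pointwise convergence). -/
def Smooth (p : ℕ) (lam : t →ₗ[ℤ] ℤ) : Prop :=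
  ∃ U ∈ nhds (fun χ : t => (lam χ : ℝ)), ∀ lam' : t →ₗ[ℤ] ℝ, ⇑lam' ∈ U → Λ p lam = ΛR p lam'

end Chambers

/-! ### Algebras given by generators and relations -/

section Presentations

/-- The generator `x` of the algebra with relations `r`. -/
def gen (R : Type*) [CommRing R] {X : Type*} (r : FreeAlgebra R X → FreeAlgebra R X → Prop)
    (x : X) : RingQuot r := RingQuot.mkAlgHom R r (FreeAlgebra.ι R x)

/-- The `R`-algebra, not necessarily with a unit, given by a set `X` of generators and relations `r`
without constant terms: the span of the words of positive length in the unital algebra with this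
presentation. -/
abbrev Presented (R : Type*) [CommRing R] {X : Type*}
    (r : FreeAlgebra R X → FreeAlgebra R X → Prop) : NonUnitalSubalgebra R (RingQuot r) :=
  NonUnitalAlgebra.adjoin R (Set.range (gen R r))

/-- A generator as an element of the algebra it generates. -/
def pgen (R : Type*) [CommRing R] {X : Type*} (r : FreeAlgebra R X → FreeAlgebra R X → Prop)
    (x : X) : Presented R r := ⟨gen R r x, NonUnitalAlgebra.subset_adjoin R ⟨x, rfl⟩⟩

variable {n : ℕ} (R : Type*) [CommRing R] (s : Fin n → R) (V : Set (Fin n → ℤ))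

/-- The exponent `η_i(x, y, u) = (|x_i - y_i| + |y_i - u_i| - |x_i - u_i|) / 2`; the number in
brackets is non-negative and even. -/
def η (x y u : Fin n → ℤ) (i : Fin n) : ℕ :=
  ((x i - y i).natAbs + (y i - u i).natAbs - (x i - u i).natAbs) / 2

/-- Generators: the idempotents `1_x` and the elements `c_{x,y}`. -/
inductive GenH
  | e (x : V)
  | c (x y : V)

open Classical in
/-- The relations `c_{x,y} c_{y,u} = ∏ s_i^{η_i(x,y,u)} c_{x,u}`, with the `1_x` orthogonal
idempotents, `c_{x,y}` an element from `y` to `x`, and `c_{x,x} = 1_x`. -/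
inductive RelH : FreeAlgebra R (GenH V) → FreeAlgebra R (GenH V) → Prop
  | idem (x y : V) : RelH (FreeAlgebra.ι R (.e x) * FreeAlgebra.ι R (.e y))
      (if x = y then FreeAlgebra.ι R (.e x) else 0)
  | left (x y : V) : RelH (FreeAlgebra.ι R (.e x) * FreeAlgebra.ι R (.c x y))
      (FreeAlgebra.ι R (.c x y))
  | right (x y : V) : RelH (FreeAlgebra.ι R (.c x y) * FreeAlgebra.ι R (.e y))
      (FreeAlgebra.ι R (.c x y))
  | diag (x : V) : RelH (FreeAlgebra.ι R (.c x x)) (FreeAlgebra.ι R (.e x))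
  | mul (x y u : V) : RelH (FreeAlgebra.ι R (.c x y) * FreeAlgebra.ι R (.c y u))
      ((∏ i, s i ^ η x.1 y.1 u.1 i) • FreeAlgebra.ι R (.c x u))

/-- Generators: the idempotents `1_x` and, for `x, y ∈ V` with `y = x + ε_i`, the elements
`up = c_x^{+i}` from `x` to `y` and `down = c_y^{-i}` from `y` to `x`. -/
inductive GenA
  | e (x : V)
  | up (i : Fin n) (x y : V) (h : y.1 = x.1 + Pi.single i 1)
  | down (i : Fin n) (x y : V) (h : y.1 = x.1 + Pi.single i 1)

open Classical in
/-- The relations of the path algebra of the quiver with set of vertices `V` and a pair of opposite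
arrows for any two vertices at distance one, together with the quadratic relations of the
`A`-algebra: a path that crosses a wall `i` and returns is equal to `s_i`, and the two ways of
going between opposite chambers around a codimension two stratum are equal. -/
inductive RelA : FreeAlgebra R (GenA V) → FreeAlgebra R (GenA V) → Prop
  | idem (x y : V) : RelA (FreeAlgebra.ι R (.e x) * FreeAlgebra.ι R (.e y))
      (if x = y then FreeAlgebra.ι R (.e x) else 0)
  | up_left (i : Fin n) (x y : V) (h) :
      RelA (FreeAlgebra.ι R (.e y) * FreeAlgebra.ι R (.up i x y h)) (FreeAlgebra.ι R (.up i x y h))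
  | up_right (i : Fin n) (x y : V) (h) :
      RelA (FreeAlgebra.ι R (.up i x y h) * FreeAlgebra.ι R (.e x)) (FreeAlgebra.ι R (.up i x y h))
  | down_left (i : Fin n) (x y : V) (h) :
      RelA (FreeAlgebra.ι R (.e x) * FreeAlgebra.ι R (.down i x y h))
        (FreeAlgebra.ι R (.down i x y h))
  | down_right (i : Fin n) (x y : V) (h) :
      RelA (FreeAlgebra.ι R (.down i x y h) * FreeAlgebra.ι R (.e y))
        (FreeAlgebra.ι R (.down i x y h))
  | down_up (i : Fin n) (x y : V) (h) :
      RelA (FreeAlgebra.ι R (.down i x y h) * FreeAlgebra.ι R (.up i x y h))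
        (s i • FreeAlgebra.ι R (.e x))
  | up_down (i : Fin n) (x y : V) (h) :
      RelA (FreeAlgebra.ι R (.up i x y h) * FreeAlgebra.ι R (.down i x y h))
        (s i • FreeAlgebra.ι R (.e y))
  | up_up (i j : Fin n) (hij : i ≠ j) (x xi xj xij : V) (h₁ h₂ h₃ h₄) :
      RelA (FreeAlgebra.ι R (.up j xi xij h₁) * FreeAlgebra.ι R (.up i x xi h₂))
        (FreeAlgebra.ι R (.up i xj xij h₃) * FreeAlgebra.ι R (.up j x xj h₄))
  | down_down (i j : Fin n) (hij : i ≠ j) (x xi xj xij : V) (h₁ h₂ h₃ h₄) :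
      RelA (FreeAlgebra.ι R (.down j x xj h₁) * FreeAlgebra.ι R (.down i xj xij h₂))
        (FreeAlgebra.ι R (.down i x xi h₃) * FreeAlgebra.ι R (.down j xi xij h₄))
  | down_up_swap (i j : Fin n) (hij : i ≠ j) (x xi xj xij : V) (h₁ h₂ h₃ h₄) :
      RelA (FreeAlgebra.ι R (.down j xi xij h₁) * FreeAlgebra.ι R (.up i xj xij h₂))
        (FreeAlgebra.ι R (.up i x xi h₃) * FreeAlgebra.ι R (.down j x xj h₄))

/-- The algebra generated by the `1_x` and the `c_{x,y}`. -/
abbrev AlgH : NonUnitalSubalgebra R (RingQuot (RelH R s V)) := Presented R (RelH R s V)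

/-- The `A`-algebra, with coefficients in `R`, of an arrangement with set of chambers `V`. -/
abbrev AlgA : NonUnitalSubalgebra R (RingQuot (RelA R s V)) := Presented R (RelA R s V)

end Presentations

/-! ### The endomorphism algebra -/

section End

variable {n : ℕ} (K : Type*) [Field K] {t : Submodule ℤ (Fin n → ℤ)} {lam : t →ₗ[ℤ] ℤ}
  {V : Type*} [DecidableEq V] (b : V → Wt t lam)

/-- The direct sum of the modules `P_x = Q_{b x}`. -/
abbrev P : Type _ := DirectSum V fun x => Q K (b x)

variable {K b} in
/-- The matrix entry `P_y → P_x` of an `A^λ`-linear endomorphism of `⨁ P_x`. -/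
def entry (f : Module.End (HEAq K t lam) (P K b)) (x y : V) :
    Q K (b y) →ₗ[HEAq K t lam] Q K (b x) :=
  (DirectSum.component (HEAq K t lam) V (fun x => Q K (b x)) x).comp
    (f.comp (DirectSum.lof (HEAq K t lam) V (fun x => Q K (b x)) y))

/-- The algebra `⨁_{x,y} Hom(P_y, P_x)` of endomorphisms of `⨁ P_x`: those with finitely many
nonzero matrix entries, all of them continuous and compatible with `D`. -/
def EndP : Set (Module.End (HEAq K t lam) (P K b)) :=
  {f | (∀ x y, IsHom (entry f x y)) ∧ {xy : V × V | entry f xy.1 xy.2 ≠ 0}.Finite}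

/-- The inclusion `P_x → ⨁ P_x`. -/
abbrev inc (x : V) : Q K (b x) →ₗ[HEAq K t lam] P K b :=
  DirectSum.lof (HEAq K t lam) V (fun x => Q K (b x)) x

/-- The idempotent `1_x`: the projection of `⨁ P_y` to the summand `P_x`. -/
def proj (x : V) : Module.End (HEAq K t lam) (P K b) :=
  (inc K b x).comp (DirectSum.component (HEAq K t lam) V (fun x => Q K (b x)) x)

/-- `IsC K b x y f` says that `f` is the morphism `c_{x,y} : P_y → P_x`, extended by zero to the other
summands: the morphism which corresponds to the vector `cvec K (b x) (b y)` of `D`-weight `b y` in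
`P_x = Q_{b x}`, that is, sends `1_{b y}` to this vector. -/
def IsC (x y : V) (f : Module.End (HEAq K t lam) (P K b)) : Prop :=
  ∀ u, f (inc K b u (one K (b u))) = if u = y then inc K b x (cvec K (b x) (b y)) else 0

end End

end Hypertoric

/-!
The proof has two halves: an explicit basis of the endomorphism algebra with its multiplication
table, and, for the second presentation, the geometry of shortest paths of chambers.

*The basis.* The weight spaces of the Weyl algebra are generated by the minimal monomials over the
polynomials in the `z_i ∂_i` (`monoSum_surjective`, `eq_monoSum_filter`), so `A^λ[c - a]` is
`m(c - a)` times the image of `S` (`mem_wtA_iff`). That this module is free is seen in the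
representation `cosetRep θ a` of `A^λ` on the free module with basis `e_c`, `c` in the coset of `λ`,
in which `z_i ∂_i` acts on `e_c` by `θ(s_i) + c_i` and the path from `a` to any `c` has
coefficient `1`. With `θ` the identity of `S` the representation computes products of the
`m(c - a)` (`phi_mul_m`, `m_mul_m`); with `θ` the quotient map modulo the powers `s_i ^ N` it
determines the intersection of the left ideal `J_N` with a weight space
(`mem_span_of_m_mul_phi_mem_J`). Passing to the limit, the vectors of weight `c` in `Q_a` form the
free `Ŝ`-module generated by `m(c - a) 1_a`. A morphism `Q_c → Q_a` is determined by the image of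
`1_c`, and `cvec` differs from `m(c - a) 1_a` by a unit of `Ŝ`, hence `Hom(P_y, P_x)` is free over
`Ŝ` with basis `c_{x,y}` (`linComb_injective`, `range_linComb`).

*The multiplication.* In `m(c' - c) m(c - a)` every edge `j` of the lattice path that is traversed
in both directions contributes a factor `s_i + j`. The normalization by `q(s_i, j)` turns it into
`1`, except when `p ∣ j`, where the path crosses a wall twice and the factor is `s_i`. Counting
these walls gives the exponents `η_i` (`qprod_mul_backtrack`, `cB_mul`). Both presentations follow
once the abstract algebra is shown to be spanned by elements that are sent to the basis `c_{x,y}`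
(`presentedHom_bijective`). In the first presentation this is immediate.

*Shortest paths.* In the `A`-algebra the spanning elements are the classes of paths that cross each
wall at most once. If `λ` is smooth, then a cube whose closure meets the coset is a chamber
(`Smooth.mem_Λ_of_closed`). A segment between interior points of two chambers therefore yields a
first step of a shortest path
(`Smooth.exists_step`). Moving the starting point of the segment from one wall of the first chamber
to another one, the wall through which it leaves changes only at points where it leaves through several
walls at once, and then the chambers around the codimension two stratum form a square
(`Smooth.steps_connected`). By induction on the number of walls, all shortest paths between two
chambers are equal (`TautConnected.isTaut_unique`), and an arrow and a shortest path compose to a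
shortest path, up to a factor `s_i` (`arr_mul_taut`).
-/

namespace Hypertoric

/-! ### Weight representations of the Weyl algebra -/

section WeightRep

variable {n : ℕ} {A : Type*} [CommRing A]

/-- The operator `e_c ↦ U_i(c_i + 1) e_{c + ε_i}` on the free module with basis `ℤⁿ`: the factor
`U_i(j)` belongs to the edge from `j - 1` to `j`. -/
def raiseOp (U : Fin n → ℤ → A) (i : Fin n) : Module.End A ((Fin n → ℤ) →₀ A) :=
  Finsupp.linearCombination A fun c => Finsupp.single (c + Pi.single i 1) (U i (c i + 1))

/-- The operator `e_c ↦ D_i(c_i) e_{c - ε_i}` on the free module with basis `ℤⁿ`: the factor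
`D_i(j)` belongs to the edge from `j` to `j - 1`. -/
def lowerOp (D : Fin n → ℤ → A) (i : Fin n) : Module.End A ((Fin n → ℤ) →₀ A) :=
  Finsupp.linearCombination A fun c => Finsupp.single (c - Pi.single i 1) (D i (c i))

theorem raiseOp_single (U : Fin n → ℤ → A) (i : Fin n) (c : Fin n → ℤ) (r : A) :
    raiseOp U i (Finsupp.single c r) =
      Finsupp.single (c + Pi.single i 1) (U i (c i + 1) * r) := by
  simp [raiseOp, mul_comm]

theorem lowerOp_single (D : Fin n → ℤ → A) (i : Fin n) (c : Fin n → ℤ) (r : A) :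
    lowerOp D i (Finsupp.single c r) = Finsupp.single (c - Pi.single i 1) (D i (c i) * r) := by
  simp [lowerOp, mul_comm]

variable (R : Type*) [CommRing R] [Algebra R A] {U D : Fin n → ℤ → A}

/-- The representation of the Weyl algebra in which `z_i` and `∂_i` shift the basis vectors
`e_c`, `c ∈ ℤⁿ`, with edge factors `U` and `D`; the hypothesis is the relation
`∂_i z_i = z_i ∂_i + 1`. -/
def weightRep (hUD : ∀ i j, U i (j + 1) * D i (j + 1) = U i j * D i j + 1) :
    Weyl R n →ₐ[R] Module.End A ((Fin n → ℤ) →₀ A) :=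
  RingQuot.liftAlgHom R ⟨FreeAlgebra.lift R (Sum.elim (raiseOp U) (lowerOp D)), by
    intro x y h
    have e (i j : Fin n) (hij : i ≠ j) : (Pi.single i 1 : Fin n → ℤ) j = 0 :=
      Pi.single_eq_of_ne hij.symm 1
    cases h with
    | zz i j =>
      simp only [map_mul, FreeAlgebra.lift_ι_apply, Sum.elim_inl]
      refine Finsupp.lhom_ext fun c r => ?_
      simp only [Module.End.mul_apply, raiseOp_single]
      by_cases hij : i = j
      · rw [hij]
      · simp only [Pi.add_apply, e i j hij, e j i (Ne.symm hij), add_zero]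
        rw [add_right_comm, mul_left_comm]
    | dd i j =>
      simp only [map_mul, FreeAlgebra.lift_ι_apply, Sum.elim_inr]
      refine Finsupp.lhom_ext fun c r => ?_
      simp only [Module.End.mul_apply, lowerOp_single]
      by_cases hij : i = j
      · rw [hij]
      · simp only [Pi.sub_apply, e i j hij, e j i (Ne.symm hij), sub_zero]
        rw [sub_right_comm, mul_left_comm]
    | dz i j =>
      simp only [map_mul, map_add, FreeAlgebra.lift_ι_apply, Sum.elim_inl, Sum.elim_inr]
      refine Finsupp.lhom_ext fun c r => ?_
      simp only [Module.End.mul_apply, LinearMap.add_apply, lowerOp_single, raiseOp_single]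
      by_cases hij : i = j
      · subst hij
        have := hUD i (c i)
        simp only [Pi.add_apply, Pi.sub_apply, Pi.single_eq_same, if_true, map_one,
          Module.End.one_apply, add_sub_cancel_right, sub_add_cancel, ← Finsupp.single_add]
        congr 1
        linear_combination r * this
      · simp only [Pi.add_apply, Pi.sub_apply, e i j hij, e j i (Ne.symm hij), add_zero, sub_zero,
          if_neg hij, map_zero, LinearMap.zero_apply]
        rw [add_sub_right_comm, mul_left_comm]⟩

variable (hUD : ∀ i j, U i (j + 1) * D i (j + 1) = U i j * D i j + 1)

theorem weightRep_z (i : Fin n) : weightRep R hUD (z R i) = raiseOp U i := by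
  unfold weightRep z toWeyl
  erw [RingQuot.liftAlgHom_mkAlgHom_apply]
  simp

theorem weightRep_d (i : Fin n) : weightRep R hUD (d R i) = lowerOp D i := by
  unfold weightRep d toWeyl
  erw [RingQuot.liftAlgHom_mkAlgHom_apply]
  simp

theorem weightRep_zd (i : Fin n) (c : Fin n → ℤ) (r : A) :
    weightRep R hUD (z R i * d R i) (Finsupp.single c r) =
      Finsupp.single c (U i (c i) * D i (c i) * r) := by
  rw [map_mul, weightRep_z, weightRep_d, Module.End.mul_apply, lowerOp_single, raiseOp_single]
  simp [mul_assoc]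

theorem raiseOp_pow_single (i : Fin n) (k : ℕ) (c : Fin n → ℤ) (r : A) :
    (raiseOp U i ^ k) (Finsupp.single c r) =
      Finsupp.single (c + Pi.single i (k : ℤ)) ((∏ j ∈ Finset.Ioc (c i) (c i + k), U i j) * r) := by
  induction k with
  | zero => simp
  | succ k ih =>
    rw [pow_succ', Module.End.mul_apply, ih, raiseOp_single, add_assoc, ← Pi.single_add,
      ← mul_assoc]
    congr 2
    have : Finset.Ioc (c i) (c i + (k + 1 : ℕ)) =
        insert (c i + k + 1) (Finset.Ioc (c i) (c i + k)) := by
      ext j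
      simp only [Finset.mem_insert, Finset.mem_Ioc]
      omega
    rw [this, Finset.prod_insert (by simp)]
    simp

theorem lowerOp_pow_single (i : Fin n) (k : ℕ) (c : Fin n → ℤ) (r : A) :
    (lowerOp D i ^ k) (Finsupp.single c r) =
      Finsupp.single (c - Pi.single i (k : ℤ)) ((∏ j ∈ Finset.Ioc (c i - k) (c i), D i j) * r) := by
  induction k with
  | zero => simp
  | succ k ih =>
    rw [pow_succ', Module.End.mul_apply, ih, lowerOp_single, sub_sub, ← Pi.single_add,
      ← mul_assoc]
    congr 2
    have : Finset.Ioc (c i - (k + 1 : ℕ)) (c i) =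
        insert (c i - k) (Finset.Ioc (c i - k) (c i)) := by
      ext j
      simp only [Finset.mem_insert, Finset.mem_Ioc]
      omega
    rw [this, Finset.prod_insert (by simp)]
    simp

/-- A product over distinct coordinates of operators each of which shifts its own coordinate. -/
theorem list_prod_shift_single {f : Fin n → Module.End A ((Fin n → ℤ) →₀ A)} {u : Fin n → ℤ}
    {F : Fin n → ℤ → A}
    (hf : ∀ i c r, f i (Finsupp.single c r) =
      Finsupp.single (c + Pi.single i (u i)) (F i (c i) * r))
    (l : List (Fin n)) (hl : l.Nodup) (c : Fin n → ℤ) (r : A) :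
    (l.map f).prod (Finsupp.single c r) =
      Finsupp.single (c + ∑ i ∈ l.toFinset, Pi.single i (u i))
        ((∏ i ∈ l.toFinset, F i (c i)) * r) := by
  induction l with
  | nil => simp
  | cons i l ih =>
    rw [List.nodup_cons] at hl
    have hi : i ∉ l.toFinset := by simpa using hl.1
    rw [List.map_cons, List.prod_cons, Module.End.mul_apply, ih hl.2, hf, List.toFinset_cons,
      Finset.sum_insert hi, Finset.prod_insert hi, ← mul_assoc]
    have h0 : (∑ k ∈ l.toFinset, (Pi.single k (u k) : Fin n → ℤ)) i = 0 := by
      rw [Finset.sum_apply]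
      refine Finset.sum_eq_zero fun k hk => Pi.single_eq_of_ne ?_ _
      rintro rfl
      exact hi hk
    rw [Pi.add_apply, h0, add_zero, add_assoc, add_comm (Finset.sum _ _)]

theorem ofFn_prod_shift_single {f : Fin n → Module.End A ((Fin n → ℤ) →₀ A)} {u : Fin n → ℤ}
    {F : Fin n → ℤ → A}
    (hf : ∀ i c r, f i (Finsupp.single c r) =
      Finsupp.single (c + Pi.single i (u i)) (F i (c i) * r)) (c : Fin n → ℤ) (r : A) :
    (List.ofFn f).prod (Finsupp.single c r) =
      Finsupp.single (c + u) ((∏ i, F i (c i)) * r) := by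
  have h : (List.finRange n).toFinset = Finset.univ := by ext; simp
  rw [List.ofFn_eq_map, list_prod_shift_single hf _ (List.nodup_finRange n), h,
    Finset.univ_sum_single]

/-- The minimal monomial of weight `b` sends `e_c` to the multiple of `e_{c + b}` given by the
factors of the edges on the monotone path from `c` to `c + b`. -/
theorem weightRep_mono (b c : Fin n → ℤ) (r : A) :
    weightRep R hUD (mono R b) (Finsupp.single c r) = Finsupp.single (c + b)
      ((∏ i, ((∏ j ∈ Finset.Ioc (c i) (c i + b i), U i j) *
        ∏ j ∈ Finset.Ioc (c i + b i) (c i), D i j)) * r) := by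
  rw [mono, map_mul, map_list_prod, map_list_prod, List.map_ofFn, List.map_ofFn,
    Module.End.mul_apply]
  rw [ofFn_prod_shift_single (u := fun i => -((-b i).toNat : ℤ))
    (F := fun i k => ∏ j ∈ Finset.Ioc (k - (-b i).toNat) k, D i j),
    ofFn_prod_shift_single (u := fun i => ((b i).toNat : ℤ))
    (F := fun i k => ∏ j ∈ Finset.Ioc k (k + (b i).toNat), U i j), ← mul_assoc,
    ← Finset.prod_mul_distrib]
  · congr 1
    · funext i
      simp only [Pi.add_apply]
      omega
    · congr 1
      refine Finset.prod_congr rfl fun i _ => ?_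
      simp only [Pi.add_apply]
      rcases le_total 0 (b i) with hb | hb
      · have h1 : (-b i).toNat = 0 := by omega
        have h2 : ((b i).toNat : ℤ) = b i := by omega
        rw [h1, h2]
        simp [hb]
      · have h1 : (b i).toNat = 0 := by omega
        have h2 : ((-b i).toNat : ℤ) = -b i := by omega
        rw [h1, h2]
        simp [hb]
  · intro i c r
    simp only [Function.comp_apply, map_pow, weightRep_z]
    exact raiseOp_pow_single i _ c r
  · intro i c r
    simp only [Function.comp_apply, map_pow, weightRep_d]
    rw [lowerOp_pow_single, Pi.single_neg, ← sub_eq_add_neg]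

end WeightRep

/-! ### The weight spaces of the Weyl algebra -/

section Spanning

variable (R : Type*) [CommRing R] {n : ℕ}

/-- The minimal monomial of weight `k` in the `i`-th pair of variables. -/
def mono₁ (i : Fin n) (k : ℤ) : Weyl R n := z R i ^ k.toNat * d R i ^ (-k).toNat

variable {R}

theorem commute_z_z (i j : Fin n) : Commute (z R i) (z R j) := z_comm R i j

theorem commute_d_d (i j : Fin n) : Commute (d R i) (d R j) := d_comm R i j

theorem commute_d_z {i j : Fin n} (hij : i ≠ j) : Commute (d R i) (z R j) := by
  show _ = _
  simpa [hij] using d_z R i j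

theorem commute_z_mono₁ {i j : Fin n} (hij : i ≠ j) (k : ℤ) :
    Commute (z R i) (mono₁ R j k) :=
  ((commute_z_z i j).pow_right _).mul_right ((commute_d_z hij.symm).symm.pow_right _)

theorem commute_d_mono₁ {i j : Fin n} (hij : i ≠ j) (k : ℤ) :
    Commute (d R i) (mono₁ R j k) :=
  ((commute_d_z hij).pow_right _).mul_right ((commute_d_d i j).pow_right _)

theorem commute_mono₁ {i j : Fin n} (hij : i ≠ j) (k l : ℤ) :
    Commute (mono₁ R i k) (mono₁ R j l) :=
  ((commute_z_mono₁ hij l).pow_left _).mul_left ((commute_d_mono₁ hij l).pow_left _)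

theorem pairwise_commute_mono₁ (s : Set (Fin n)) (b : Fin n → ℤ) :
    s.Pairwise (Function.onFun Commute fun i => mono₁ R i (b i)) :=
  fun _ _ _ _ hij => commute_mono₁ hij _ _

theorem ofFn_prod_eq_noncommProd (f : Fin n → Weyl R n)
    (hf : ((Finset.univ : Finset (Fin n)) : Set (Fin n)).Pairwise (Function.onFun Commute f)) :
    (List.ofFn f).prod = Finset.univ.noncommProd f hf := by
  have h : (List.finRange n).toFinset = Finset.univ := by ext; simp
  rw [List.ofFn_eq_map, ← Finset.noncommProd_toFinset (List.finRange n) f (by rwa [h])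
    (List.nodup_finRange n)]
  congr 1

theorem mono_eq_noncommProd (b : Fin n → ℤ) :
    mono R b = Finset.univ.noncommProd (fun i => mono₁ R i (b i))
      (pairwise_commute_mono₁ _ b) := by
  have h1 : ((Finset.univ : Finset (Fin n)) : Set (Fin n)).Pairwise
      (Function.onFun Commute fun i => z R i ^ (b i).toNat) :=
    fun i _ j _ _ => (commute_z_z i j).pow_pow _ _
  have h2 : ((Finset.univ : Finset (Fin n)) : Set (Fin n)).Pairwise
      (Function.onFun Commute fun i => d R i ^ (-b i).toNat) :=
    fun i _ j _ _ => (commute_d_d i j).pow_pow _ _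
  rw [mono, ofFn_prod_eq_noncommProd _ h1, ofFn_prod_eq_noncommProd _ h2,
    ← Finset.noncommProd_mul_distrib _ _ h1 h2 fun i _ j _ hij =>
      (commute_d_z hij).pow_pow _ _]
  rfl

theorem mono_eq_mono₁_mul (i : Fin n) (b : Fin n → ℤ) :
    mono R b = mono₁ R i (b i) * (Finset.univ.erase i).noncommProd (fun j => mono₁ R j (b j))
      (pairwise_commute_mono₁ _ b) := by
  rw [mono_eq_noncommProd]
  exact (Finset.mul_noncommProd_erase _ (Finset.mem_univ i) (fun i => mono₁ R i (b i)) _ _).symm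

theorem mono_zero : mono R (0 : Fin n → ℤ) = 1 := by
  simp [mono]

theorem d_mul_z_pow_succ (i : Fin n) (m : ℕ) :
    d R i * z R i ^ (m + 1) = z R i ^ m * (z R i * d R i + ((m + 1 : ℕ) : Weyl R n)) := by
  have hd : d R i * z R i = z R i * d R i + 1 := by simpa using d_z R i i
  induction m with
  | zero => simpa using hd
  | succ m ih =>
    rw [pow_succ, ← mul_assoc, ih, mul_assoc, add_mul, mul_assoc, hd, pow_succ, mul_assoc,
      mul_add, (Nat.cast_commute _ _).eq]
    push_cast
    noncomm_ring

theorem z_mul_d_pow_succ (i : Fin n) (m : ℕ) :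
    z R i * d R i ^ (m + 1) = d R i ^ m * (z R i * d R i - (m : Weyl R n)) := by
  have hd : d R i * z R i = z R i * d R i + 1 := by simpa using d_z R i i
  induction m with
  | zero => simp
  | succ m ih =>
    have : z R i * d R i = d R i * z R i - 1 := by rw [hd]; simp
    rw [pow_succ, ← mul_assoc, ih, mul_assoc, sub_mul, this, sub_mul, mul_assoc, pow_succ,
      mul_assoc, ← this, (Nat.cast_commute _ _).eq]
    push_cast
    noncomm_ring

variable (R n) in
/-- The commutative subalgebra of the Weyl algebra generated by the `z_i ∂_i`. -/
def cartan : Subalgebra R (Weyl R n) := Algebra.adjoin R (Set.range fun i => z R i * d R i)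

theorem zd_mem_cartan (i : Fin n) : z R i * d R i ∈ cartan R n :=
  Algebra.subset_adjoin ⟨i, rfl⟩

/-- If left multiplication by `w` acts on the `i`-th factor of a minimal monomial as a shift of the
weight followed by right multiplication with an element of `cartan`, then it does so on the
monomial. -/
theorem mul_mono_eq {i : Fin n} {w y : Weyl R n} {b : Fin n → ℤ} {k : ℤ}
    (hy : ∀ j ≠ i, ∀ l, Commute y (mono₁ R j l))
    (h : w * mono₁ R i (b i) = mono₁ R i (b i + k) * y) :
    w * mono R b = mono R (b + Pi.single i k) * y := by
  have h1 : Commute y ((Finset.univ.erase i).noncommProd (fun j => mono₁ R j (b j))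
      (pairwise_commute_mono₁ _ b)) :=
    Finset.noncommProd_commute _ _ _ _ fun j hj => hy j (Finset.ne_of_mem_erase hj) _
  rw [mono_eq_mono₁_mul i b, mono_eq_mono₁_mul i (b + _), ← mul_assoc, h, mul_assoc, h1.eq,
    ← mul_assoc, Pi.add_apply, Pi.single_eq_same]
  congr 2
  refine Finset.noncommProd_congr rfl (fun j hj => ?_) _
  rw [Pi.add_apply, Pi.single_eq_of_ne (Finset.ne_of_mem_erase hj), add_zero]

theorem z_mul_mono (i : Fin n) (b : Fin n → ℤ) :
    ∃ y ∈ cartan R n, z R i * mono R b = mono R (b + Pi.single i 1) * y := by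
  rcases le_or_gt 0 (b i) with hb | hb
  · refine ⟨1, one_mem _, mul_mono_eq (fun _ _ _ => Commute.one_left _) ?_⟩
    have h1 : (-b i).toNat = 0 := by omega
    have h2 : (-(b i + 1)).toNat = 0 := by omega
    have h3 : (b i + 1).toNat = (b i).toNat + 1 := by omega
    rw [mono₁, mono₁, h1, h2, h3, pow_succ']
    simp
  · obtain ⟨m, hm⟩ : ∃ m : ℕ, b i = -(m + 1 : ℕ) := ⟨(-b i).toNat - 1, by omega⟩
    refine ⟨z R i * d R i - m, sub_mem (zd_mem_cartan i) (natCast_mem _ m),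
      mul_mono_eq (fun j hj l => ?_) ?_⟩
    · exact ((commute_z_mono₁ hj.symm l).mul_left (commute_d_mono₁ hj.symm l)).sub_left
        (Nat.cast_commute _ _)
    · have h1 : (b i).toNat = 0 := by omega
      have h2 : (b i + 1).toNat = 0 := by omega
      have h3 : (-b i).toNat = m + 1 := by omega
      have h4 : (-(b i + 1)).toNat = m := by omega
      rw [mono₁, mono₁, h1, h2, h3, h4, pow_zero, one_mul, one_mul, z_mul_d_pow_succ]

theorem d_mul_mono (i : Fin n) (b : Fin n → ℤ) :
    ∃ y ∈ cartan R n, d R i * mono R b = mono R (b + Pi.single i (-1)) * y := by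
  rcases le_or_gt (b i) 0 with hb | hb
  · refine ⟨1, one_mem _, mul_mono_eq (fun _ _ _ => Commute.one_left _) ?_⟩
    have h1 : (b i).toNat = 0 := by omega
    have h2 : (b i + -1).toNat = 0 := by omega
    have h3 : (-(b i + -1)).toNat = (-b i).toNat + 1 := by omega
    rw [mono₁, mono₁, h1, h2, h3, pow_succ']
    simp
  · obtain ⟨m, hm⟩ : ∃ m : ℕ, b i = (m + 1 : ℕ) := ⟨(b i).toNat - 1, by omega⟩
    refine ⟨z R i * d R i + (m + 1 : ℕ), add_mem (zd_mem_cartan i) (natCast_mem _ _),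
      mul_mono_eq (fun j hj l => ?_) ?_⟩
    · exact ((commute_z_mono₁ hj.symm l).mul_left (commute_d_mono₁ hj.symm l)).add_left
        (Nat.cast_commute _ _)
    · have h1 : (-b i).toNat = 0 := by omega
      have h2 : (-(b i + -1)).toNat = 0 := by omega
      have h3 : (b i).toNat = m + 1 := by omega
      have h4 : (b i + -1).toNat = m := by omega
      rw [mono₁, mono₁, h1, h2, h3, h4, pow_zero, mul_one, mul_one, d_mul_z_pow_succ]

/-- A family of elements of `cartan`, with finite support, gives the sum of the products
`mono b * x b`. -/
def monoSum : ((Fin n → ℤ) →₀ cartan R n) →ₗ[R] Weyl R n :=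
  Finsupp.lsum R fun b => (LinearMap.mulLeft R (mono R b)).comp (cartan R n).val.toLinearMap

theorem monoSum_single (b : Fin n → ℤ) (x : cartan R n) :
    monoSum (Finsupp.single b x) = mono R b * x := by
  simp [monoSum]

theorem monoSum_apply (x : (Fin n → ℤ) →₀ cartan R n) :
    monoSum x = x.sum fun b y => mono R b * y := by
  simp [monoSum, Finsupp.sum]

/-- The Weyl algebra is generated by the minimal monomials as a right module over `cartan`. -/
theorem monoSum_surjective : Function.Surjective (monoSum (R := R) (n := n)) := by
  have key (g : Weyl R n) (k : Fin n → ℤ)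
      (hg : ∀ b, ∃ y ∈ cartan R n, g * mono R b = mono R (b + k) * y)
      (v : Weyl R n) (hv : v ∈ LinearMap.range (monoSum (R := R) (n := n))) :
      g * v ∈ LinearMap.range (monoSum (R := R) (n := n)) := by
    obtain ⟨x, rfl⟩ := hv
    induction x using Finsupp.induction_linear with
    | zero => simp
    | add x y hx hy =>
      rw [map_add, mul_add]
      exact add_mem hx hy
    | single b x =>
      obtain ⟨y, hy, h⟩ := hg b
      refine ⟨Finsupp.single (b + k) (⟨y, hy⟩ * x), ?_⟩
      rw [monoSum_single, monoSum_single, ← mul_assoc, h, mul_assoc]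
      rfl
  intro w
  suffices h : ∀ v ∈ LinearMap.range (monoSum (R := R) (n := n)),
      w * v ∈ LinearMap.range (monoSum (R := R) (n := n)) by
    have h1 : (1 : Weyl R n) ∈ LinearMap.range (monoSum (R := R) (n := n)) :=
      ⟨Finsupp.single 0 1, by rw [monoSum_single, mono_zero]; exact mul_one _⟩
    simpa using h 1 h1
  obtain ⟨f, rfl⟩ : ∃ f, toWeyl R n f = w := RingQuot.mkAlgHom_surjective R _ w
  induction f using FreeAlgebra.induction with
  | grade0 r =>
    intro v hv
    rw [AlgHom.commutes, ← Algebra.smul_def]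
    exact Submodule.smul_mem _ _ hv
  | grade1 i =>
    rcases i with i | i
    · exact key (z R i) _ (z_mul_mono i)
    · exact key (d R i) _ (d_mul_mono i)
  | mul f g hf hg =>
    intro v hv
    rw [map_mul, mul_assoc]
    exact hf _ (hg _ hv)
  | add f g hf hg =>
    intro v hv
    rw [map_add, add_mul]
    exact add_mem (hf _ hv) (hg _ hv)

theorem coact_cartan {M : Type*} [AddCommGroup M] (ε : Fin n → M) {x : Weyl R n}
    (hx : x ∈ cartan R n) : coact R ε x = AddMonoidAlgebra.single 0 x := by
  have : cartan R n ≤ AlgHom.equalizer (coact R ε) AddMonoidAlgebra.singleZeroAlgHom := by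
    rw [cartan, Algebra.adjoin_le_iff]
    rintro _ ⟨i, rfl⟩
    change coact R ε (z R i * d R i) = AddMonoidAlgebra.single 0 _
    rw [map_mul, coact_z, coact_d, AddMonoidAlgebra.single_mul_single, add_neg_cancel]
  exact this hx

theorem coact_monoSum {M : Type*} [AddCommGroup M] (ε : Fin n → M)
    (x : (Fin n → ℤ) →₀ cartan R n) :
    coact R ε (monoSum x) =
      x.sum fun b y => AddMonoidAlgebra.single (∑ i, b i • ε i) (mono R b * y) := by
  rw [monoSum_apply, Finsupp.sum, map_sum]
  refine Finset.sum_congr rfl fun b _ => ?_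
  rw [map_mul, coact_mono, coact_cartan ε (x b).2, AddMonoidAlgebra.single_mul_single, add_zero]

/-- An element of weight `c` is the sum of the minimal monomials of weight `c` in its expansion. -/
theorem eq_monoSum_filter {M : Type*} [AddCommGroup M] (ε : Fin n → M) (c : M)
    [DecidablePred fun b : Fin n → ℤ => ∑ i, b i • ε i = c] (x : (Fin n → ℤ) →₀ cartan R n)
    (hx : coact R ε (monoSum x) = AddMonoidAlgebra.single c (monoSum x)) :
    monoSum x = monoSum (x.filter fun b => ∑ i, b i • ε i = c) := by
  rw [coact_monoSum] at hx
  have h := DFunLike.congr_fun (congrArg AddMonoidAlgebra.coeff hx) c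
  rw [AddMonoidAlgebra.coeff_single, Finsupp.single_eq_same, Finsupp.sum,
    AddMonoidAlgebra.coeff_sum, Finsupp.finsetSum_apply] at h
  rw [← h, monoSum_apply, Finsupp.sum, Finsupp.support_filter, Finset.sum_filter]
  refine Finset.sum_congr rfl fun b _ => ?_
  rw [AddMonoidAlgebra.coeff_single, Finsupp.single_apply]
  split_ifs with hb
  · rw [Finsupp.filter_apply_pos (fun b : Fin n → ℤ => ∑ i, b i • ε i = c) x hb]
  · rfl

end Spanning

/-! ### The weight spaces of the hypertoric enveloping algebra -/

section SymmetricAlgebra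

variable {n : ℕ} (K : Type*) [Field K] (t : Submodule ℤ (Fin n → ℤ))

theorem sum_smul_tmul_mk (χ : Fin n → ℤ) :
    ∑ i, χ i • sS K t i =
      SymmetricAlgebra.ι K _ (TensorProduct.tmul ℤ (1 : K) (Submodule.Quotient.mk (p := t) χ)) := by
  have h : χ = ∑ i, χ i • (Pi.single i 1 : Fin n → ℤ) := by
    ext j
    simp [Finset.sum_apply, Pi.single_apply]
  conv_rhs => rw [h]
  rw [← Submodule.mkQ_apply, map_sum, TensorProduct.tmul_sum, map_sum]
  refine Finset.sum_congr rfl fun i _ => ?_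
  rw [map_zsmul, TensorProduct.tmul_smul, map_zsmul]
  rfl

theorem sum_smul_sS (χ : t) : ∑ i, (χ : Fin n → ℤ) i • sS K t i = 0 := by
  rw [sum_smul_tmul_mk, (Submodule.Quotient.mk_eq_zero t).2 χ.2, TensorProduct.tmul_zero, map_zero]

theorem adjoin_sS : Algebra.adjoin K (Set.range (sS K t)) = ⊤ := by
  rw [eq_top_iff]
  rintro x -
  induction x using SymmetricAlgebra.induction with
  | algebraMap r => exact Subalgebra.algebraMap_mem _ r
  | mul x y hx hy => exact mul_mem hx hy
  | add x y hx hy => exact add_mem hx hy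
  | ι v =>
    induction v using TensorProduct.induction_on with
    | zero => simp
    | add v w hv hw =>
      rw [map_add]
      exact add_mem hv hw
    | tmul r χ =>
      obtain ⟨χ, rfl⟩ := Submodule.Quotient.mk_surjective _ χ
      have h : TensorProduct.tmul ℤ r (Submodule.Quotient.mk (p := t) χ) =
          r • TensorProduct.tmul ℤ (1 : K) (Submodule.Quotient.mk (p := t) χ) := by
        rw [TensorProduct.smul_tmul', smul_eq_mul, mul_one]
      rw [h, map_smul, ← sum_smul_tmul_mk]
      refine Subalgebra.smul_mem _ (sum_mem fun i _ => zsmul_mem ?_ _) r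
      exact Algebra.subset_adjoin ⟨i, rfl⟩

/-- Induction principle for `S`, which is generated by the `s_i`. -/
theorem S_induction {motive : S K t → Prop} (C : ∀ r, motive (algebraMap K _ r))
    (X : ∀ i, motive (sS K t i)) (add : ∀ x y, motive x → motive y → motive (x + y))
    (mul : ∀ x y, motive x → motive y → motive (x * y)) (x : S K t) : motive x := by
  have hx : x ∈ Algebra.adjoin K (Set.range (sS K t)) := by
    rw [adjoin_sS]
    trivial
  induction hx using Algebra.adjoin_induction with
  | mem x hx =>
    obtain ⟨i, rfl⟩ := hx
    exact X i
  | algebraMap r => exact C r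
  | add x y _ _ hx hy => exact add x y hx hy
  | mul x y _ _ hx hy => exact mul x y hx hy

end SymmetricAlgebra

section CosetRep

variable {n : ℕ} {K : Type*} [Field K] {t : Submodule ℤ (Fin n → ℤ)} {lam : t →ₗ[ℤ] ℤ}
  {A : Type*} [CommRing A] [Algebra K A] (θ : S K t →ₐ[K] A)

/-- The factor of the edge from `j - 1` to `j` in the representation with base point `a`: an edge
traversed towards `a` has factor `θ(s_i) + j`, an edge traversed away from `a` has factor `1`. -/
def upFactor (a : Wt t lam) (i : Fin n) (j : ℤ) : A := if j ≤ a.1 i then θ (sS K t i) + j else 1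

/-- The factor of the edge from `j` to `j - 1` in the representation with base point `a`. -/
def downFactor (a : Wt t lam) (i : Fin n) (j : ℤ) : A :=
  if j ≤ a.1 i then 1 else θ (sS K t i) + j

theorem upFactor_mul_downFactor (a : Wt t lam) (i : Fin n) (j : ℤ) :
    (upFactor θ a i j * downFactor θ a i j : A) = θ (sS K t i) + j := by
  unfold upFactor downFactor
  split_ifs <;> simp

/-- The representation of the Weyl algebra that is cyclic with generator `e_a`, where
`z_i ∂_i` acts on `e_c` by `θ(s_i) + c_i`, and `mono (c - a)` sends `e_a` to `e_c`. -/
def baseRep (a : Wt t lam) : Weyl K n →ₐ[K] Module.End A ((Fin n → ℤ) →₀ A) :=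
  weightRep K (U := upFactor θ a) (D := downFactor θ a) fun i j => by
    rw [upFactor_mul_downFactor, upFactor_mul_downFactor]
    push_cast
    ring

theorem baseRep_zd (a : Wt t lam) (i : Fin n) (c : Fin n → ℤ) (r : A) :
    baseRep θ a (z K i * d K i) (Finsupp.single c r) =
      Finsupp.single c ((θ (sS K t i) + c i) * r) := by
  rw [baseRep, weightRep_zd, upFactor_mul_downFactor]

theorem baseRep_cartan (a : Wt t lam) {x : Weyl K n} (hx : x ∈ cartan K n) (c : Fin n → ℤ) :
    ∃ g : A, ∀ r, baseRep θ a x (Finsupp.single c r) = Finsupp.single c (g * r) := by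
  induction hx using Algebra.adjoin_induction with
  | mem x hx =>
    obtain ⟨i, rfl⟩ := hx
    exact ⟨_, baseRep_zd θ a i c⟩
  | algebraMap k =>
    refine ⟨algebraMap K _ k, fun r => ?_⟩
    rw [AlgHom.commutes, Module.algebraMap_end_apply, Finsupp.smul_single, Algebra.smul_def]
  | add x y _ _ hx hy =>
    obtain ⟨g, hg⟩ := hx
    obtain ⟨g', hg'⟩ := hy
    refine ⟨g + g', fun r => ?_⟩
    rw [map_add, LinearMap.add_apply, hg, hg', add_mul, Finsupp.single_add]
  | mul x y _ _ hx hy =>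
    obtain ⟨g, hg⟩ := hx
    obtain ⟨g', hg'⟩ := hy
    refine ⟨g * g', fun r => ?_⟩
    rw [map_mul, Module.End.mul_apply, hg', hg, mul_assoc]

/-- The free module with basis the coset of `λ`. -/
abbrev cosetModule (A : Type*) [CommRing A] (lam : t →ₗ[ℤ] ℤ) :
    Submodule A ((Fin n → ℤ) →₀ A) :=
  Finsupp.supported A A {c | ∀ χ : t, ∑ i, (χ : Fin n → ℤ) i * c i = lam χ}

theorem cosetModule_induction {motive : ((Fin n → ℤ) →₀ A) → Prop}
    (zero : motive 0) (add : ∀ v w, motive v → motive w → motive (v + w))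
    (single : ∀ (c : Wt t lam) r, motive (Finsupp.single c.1 r)) {v : (Fin n → ℤ) →₀ A}
    (hv : v ∈ cosetModule A lam) : motive v := by
  rw [← Finsupp.sum_single v]
  exact Finset.sum_induction _ motive add zero fun c hc => single ⟨c, hv hc⟩ _

theorem baseRep_mem_cosetModule (a : Wt t lam) {w : Weyl K n} (hw : w ∈ HEA K t)
    {v : (Fin n → ℤ) →₀ A} (hv : v ∈ cosetModule A lam) :
    baseRep θ a w v ∈ cosetModule A lam := by
  classical
  obtain ⟨x, rfl⟩ := monoSum_surjective w
  rw [eq_monoSum_filter (charT t) 0 x hw, monoSum_apply, Finsupp.sum, map_sum,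
    LinearMap.sum_apply]
  refine sum_mem fun b hb => ?_
  rw [Finsupp.support_filter, Finset.mem_filter] at hb
  refine cosetModule_induction (motive := fun v => baseRep θ a (mono K b *
    ((x.filter fun b => ∑ i, b i • charT t i = 0) b)) v ∈ cosetModule A lam) ?_ ?_ ?_ hv
  · rw [map_zero]
    exact zero_mem _
  · intro v w hv hw
    rw [map_add]
    exact add_mem hv hw
  · intro c r
    obtain ⟨g, hg⟩ := baseRep_cartan θ a
      ((x.filter fun b => ∑ i, b i • charT t i = 0) b).2 c.1
    rw [map_mul, Module.End.mul_apply, hg, baseRep, weightRep_mono]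
    refine Finsupp.single_mem_supported _ _ fun χ => ?_
    have h := LinearMap.congr_fun hb.2 χ
    simp only [LinearMap.coe_sum, Finset.sum_apply, LinearMap.smul_apply, charT,
      LinearMap.comp_apply, Submodule.subtype_apply, LinearMap.proj_apply, smul_eq_mul,
      LinearMap.zero_apply] at h
    simp only [Pi.add_apply, mul_add, Finset.sum_add_distrib, c.2 χ]
    simp only [mul_comm _ (b _), h, add_zero]

/-- The representation of `A^λ` with base point `a` on the free `A`-module with basis the coset of
`λ`: the restriction of `baseRep`, on which the moment map takes the value `λ`. -/
def cosetRep (a : Wt t lam) : HEAq K t lam →ₐ[K] Module.End A (cosetModule A lam) :=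
  RingQuot.liftAlgHom K
    ⟨{ toFun := fun w => (baseRep θ a (w : Weyl K n)).restrict
          fun _ hv => baseRep_mem_cosetModule θ a w.2 hv
       map_one' := by
         ext v : 2
         simp
       map_mul' := fun x y => by
         ext v : 2
         simp
       map_zero' := by
         ext v : 2
         simp
       map_add' := fun x y => by
         ext v : 2
         simp
       commutes' := fun r => by
         ext v : 2
         simp }, by
    rintro _ _ ⟨χ⟩
    refine LinearMap.ext fun v => Subtype.ext ?_
    change baseRep θ a (moment K t χ : Weyl K n) v.1 =
      baseRep θ a ((lam χ : HEA K t) : Weyl K n) v.1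
    refine cosetModule_induction (motive := fun v => baseRep θ a (moment K t χ : Weyl K n) v =
      baseRep θ a ((lam χ : HEA K t) : Weyl K n) v) ?_ ?_ ?_ v.2
    · rw [map_zero, map_zero]
    · intro v w hv hw
      rw [map_add, map_add, hv, hw]
    · intro c r
      have h1 : (moment K t χ : Weyl K n) = ∑ i, (χ : Fin n → ℤ) i • (z K i * d K i) := by
        rw [moment, AddSubmonoidClass.coe_finsetSum]
        rfl
      have h2 : ((lam χ : HEA K t) : Weyl K n) = ((lam χ : ℤ) : Weyl K n) := by simp
      have h3 : ((lam χ : ℤ) : Module.End A ((Fin n → ℤ) →₀ A)) (Finsupp.single c.1 r) =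
          Finsupp.single c.1 (((lam χ : ℤ) : A) * r) := by
        rw [Module.End.intCast_apply, Finsupp.smul_single, zsmul_eq_mul]
      rw [h1, h2, map_sum, LinearMap.sum_apply, map_intCast, h3]
      simp only [map_zsmul, LinearMap.smul_apply, baseRep_zd, Finsupp.smul_single]
      rw [← Finsupp.single_finsetSum]
      congr 1
      simp only [← smul_mul_assoc, ← Finset.sum_mul]
      congr 1
      simp only [smul_add, Finset.sum_add_distrib, ← map_zsmul, ← map_sum, sum_smul_sS, map_zero,
        zero_add, ← c.2 χ]
      simp⟩

theorem cosetRep_toHEAq (a : Wt t lam) (w : HEA K t) (v : cosetModule A lam) :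
    (cosetRep θ a (toHEAq K t lam w) v : (Fin n → ℤ) →₀ A) = baseRep θ a (w : Weyl K n) v := by
  unfold cosetRep toHEAq
  erw [RingQuot.liftAlgHom_mkAlgHom_apply]
  rfl

/-- The basis vector `e_c` of `cosetModule`. -/
def basisVec (A : Type*) [CommRing A] (c : Wt t lam) : cosetModule A lam :=
  ⟨Finsupp.single c.1 1, Finsupp.single_mem_supported _ _ c.2⟩

theorem cosetRep_h (a c : Wt t lam) (i : Fin n) :
    cosetRep θ a (h K t lam i) (basisVec A c) = (θ (sS K t i) + c.1 i) • basisVec A c := by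
  refine Subtype.ext ?_
  rw [h, cosetRep_toHEAq]
  change baseRep θ a (z K i * d K i) (Finsupp.single c.1 1) = (_ : A) • Finsupp.single c.1 1
  rw [baseRep_zd, Finsupp.smul_single, smul_eq_mul]

theorem cosetRep_phi (a c : Wt t lam) (f : S K t) :
    cosetRep θ a (phi K c f) (basisVec A c) = θ f • basisVec A c := by
  induction f using S_induction with
  | C r =>
    rw [AlgHom.commutes, AlgHom.commutes, AlgHom.commutes, Module.algebraMap_end_apply,
      algebraMap_smul]
  | X i =>
    have h1 := cosetRep_h θ a c i
    have h2 : h K t lam i = phi K c (sS K t i) + (c.1 i : HEAq K t lam) := by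
      rw [phi_sS, sub_add_cancel]
    have h3 : cosetRep θ a (c.1 i : HEAq K t lam) (basisVec A c) = (c.1 i : A) • basisVec A c := by
      rw [← map_intCast (algebraMap K (HEAq K t lam)), ← map_intCast (algebraMap K A),
        AlgHom.commutes, Module.algebraMap_end_apply, algebraMap_smul]
    rw [h2, map_add, LinearMap.add_apply, h3, add_smul] at h1
    exact add_right_cancel h1
  | add x y hx hy => rw [map_add, map_add, LinearMap.add_apply, hx, hy, map_add, add_smul]
  | mul x y hx hy =>
    rw [map_mul, map_mul, Module.End.mul_apply, hy, map_smul, hx, smul_smul, map_mul, mul_comm]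

/-- The factor by which `m(c' - c)` sends `e_c` to `e_{c'}` in the representation with base point
`a`: the product of the `θ(s_i) + j` over the edges that the monotone path from `c` to `c'`
traverses towards `a`. -/
def backtrack (a c c' : Wt t lam) : A :=
  ∏ i, ((∏ j ∈ Finset.Ioc (c.1 i) (c'.1 i), upFactor θ a i j) *
    ∏ j ∈ Finset.Ioc (c'.1 i) (c.1 i), downFactor θ a i j)

theorem backtrack_base (a c : Wt t lam) : backtrack θ a a c = 1 := by
  refine Finset.prod_eq_one fun i _ => ?_
  rw [Finset.prod_eq_one, Finset.prod_eq_one, one_mul]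
  · intro j hj
    rw [Finset.mem_Ioc] at hj
    rw [downFactor, if_pos hj.2]
  · intro j hj
    rw [Finset.mem_Ioc] at hj
    rw [upFactor, if_neg (by omega)]

theorem cosetRep_m (a c c' : Wt t lam) :
    cosetRep θ a (m K t lam c' c) (basisVec A c) = backtrack θ a c c' • basisVec A c' := by
  refine Subtype.ext ?_
  rw [m, cosetRep_toHEAq]
  change baseRep θ a (mono K (c'.1 - c.1)) (Finsupp.single c.1 1) =
    backtrack θ a c c' • Finsupp.single c'.1 1
  rw [baseRep, weightRep_mono, Finsupp.smul_single, smul_eq_mul, backtrack]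
  simp only [Pi.sub_apply, add_sub_cancel]

end CosetRep

section WeightSpaces

variable {n : ℕ} {K : Type*} [Field K] {t : Submodule ℤ (Fin n → ℤ)} {lam : t →ₗ[ℤ] ℤ}

theorem cartan_le_HEA : cartan K n ≤ HEA K t := fun _ hx => coact_cartan _ hx

theorem toHEAq_cartan_eq_phi (a : Wt t lam) {x : Weyl K n} (hx : x ∈ cartan K n) :
    ∃ f, toHEAq K t lam ⟨x, cartan_le_HEA hx⟩ = phi K a f := by
  induction hx using Algebra.adjoin_induction with
  | mem x hx =>
    obtain ⟨i, rfl⟩ := hx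
    refine ⟨sS K t i + a.1 i, ?_⟩
    rw [map_add, map_intCast, phi_sS, sub_add_cancel]
    rfl
  | algebraMap k =>
    refine ⟨algebraMap K _ k, ?_⟩
    rw [AlgHom.commutes]
    exact (toHEAq K t lam).commutes k
  | add x y hx hy h1 h2 =>
    obtain ⟨f, hf⟩ := h1
    obtain ⟨g, hg⟩ := h2
    refine ⟨f + g, ?_⟩
    rw [map_add, ← hf, ← hg, ← map_add]
    rfl
  | mul x y hx hy h1 h2 =>
    obtain ⟨f, hf⟩ := h1
    obtain ⟨g, hg⟩ := h2
    refine ⟨f * g, ?_⟩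
    rw [map_mul, ← hf, ← hg, ← map_mul]
    rfl

theorem phi_eq_toHEAq_cartan (a : Wt t lam) (f : S K t) :
    ∃ x, ∃ hx : x ∈ cartan K n, phi K a f = toHEAq K t lam ⟨x, cartan_le_HEA hx⟩ := by
  induction f using S_induction with
  | C r => exact ⟨_, Subalgebra.algebraMap_mem _ r,
      by rw [AlgHom.commutes]; exact ((toHEAq K t lam).commutes r).symm⟩
  | X i =>
    refine ⟨z K i * d K i - a.1 i, sub_mem (zd_mem_cartan i) (intCast_mem _ _), ?_⟩
    rw [phi_sS, h, ← map_intCast (toHEAq K t lam), ← map_sub]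
    congr 1
  | add f g hf hg =>
    obtain ⟨x, hx, h1⟩ := hf
    obtain ⟨y, hy, h2⟩ := hg
    refine ⟨x + y, add_mem hx hy, ?_⟩
    rw [map_add, h1, h2, ← map_add]
    rfl
  | mul f g hf hg =>
    obtain ⟨x, hx, h1⟩ := hf
    obtain ⟨y, hy, h2⟩ := hg
    refine ⟨x * y, mul_mem hx hy, ?_⟩
    rw [map_mul, h1, h2, ← map_mul]
    rfl

theorem mul_mem_wtA {c c' : Fin n → ℤ} {x y : HEAq K t lam} (hx : x ∈ wtA K t lam c)
    (hy : y ∈ wtA K t lam c') : x * y ∈ wtA K t lam (c + c') := by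
  obtain ⟨x, hx, rfl⟩ := hx
  obtain ⟨y, hy, rfl⟩ := hy
  refine ⟨x * y, ?_, map_mul _ _ _⟩
  rw [Set.mem_ofPred_eq] at hx hy ⊢
  rw [MulMemClass.coe_mul, map_mul, hx, hy, AddMonoidAlgebra.single_mul_single]

theorem phi_mem_wtA (a : Wt t lam) (f : S K t) : phi K a f ∈ wtA K t lam 0 := by
  obtain ⟨x, hx, h⟩ := phi_eq_toHEAq_cartan a f
  exact ⟨_, coact_cartan _ hx, h.symm⟩

theorem sum_smul_single (b : Fin n → ℤ) :
    ∑ i, b i • (Pi.single i 1 : Fin n → ℤ) = b := by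
  ext j
  simp [Finset.sum_apply, Pi.single_apply]

theorem m_mem_wtA (c a : Wt t lam) : m K t lam c a ∈ wtA K t lam (c.1 - a.1) := by
  refine ⟨_, ?_, rfl⟩
  rw [Set.mem_ofPred_eq, coact_mono, sum_smul_single]

/-- The weight space `A^λ[c - a]` is generated by `m(c - a)` over the image of `S`. -/
theorem mem_wtA_iff (c a : Wt t lam) {w : HEAq K t lam} :
    w ∈ wtA K t lam (c.1 - a.1) ↔ ∃ f, w = m K t lam c a * phi K a f := by
  classical
  constructor
  · rintro ⟨w, hw, rfl⟩
    obtain ⟨x, hx⟩ := monoSum_surjective (w : Weyl K n)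
    rw [Set.mem_ofPred_eq, ← hx] at hw
    have h1 := eq_monoSum_filter _ _ x hw
    rw [hx] at h1
    have h2 : monoSum (x.filter fun b => ∑ i, b i • (Pi.single i 1 : Fin n → ℤ) = c.1 - a.1) =
        mono K (c.1 - a.1) * x (c.1 - a.1) := by
      rw [← monoSum_single]
      congr 1
      ext1 b
      by_cases hb : b = c.1 - a.1
      · rw [Finsupp.filter_apply_pos _ _ (by rw [sum_smul_single, hb]), hb,
          Finsupp.single_eq_same]
      · rw [Finsupp.filter_apply_neg _ _ (by rwa [sum_smul_single]),
          Finsupp.single_eq_of_ne hb]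
    obtain ⟨f, hf⟩ := toHEAq_cartan_eq_phi a (x (c.1 - a.1)).2
    refine ⟨f, ?_⟩
    rw [← hf, m, ← map_mul]
    congr 1
    exact Subtype.ext (h1.trans h2)
  · rintro ⟨f, rfl⟩
    have := mul_mem_wtA (m_mem_wtA (K := K) c a) (phi_mem_wtA a f)
    rwa [add_zero] at this

theorem m_self (a : Wt t lam) : m K t lam a a = 1 := by
  rw [m, ← map_one (toHEAq K t lam)]
  congr 1
  ext
  change mono K (a.1 - a.1) = 1
  rw [sub_self, mono_zero]

variable {A : Type*} [CommRing A] [Algebra K A] (θ : S K t →ₐ[K] A)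

/-- The coefficient of `e_c` in `w e_a`, where `w ∈ A^λ` acts with base point `a`. -/
def coeffAt (a c : Wt t lam) : HEAq K t lam →ₗ[K] A where
  toFun w := (cosetRep θ a w (basisVec A a)).1 c.1
  map_add' x y := by simp
  map_smul' r x := by simp

theorem coeffAt_mul_phi (a c : Wt t lam) (w : HEAq K t lam) (f : S K t) :
    coeffAt θ a c (w * phi K a f) = θ f * coeffAt θ a c w := by
  change (cosetRep θ a (w * phi K a f) (basisVec A a)).1 c.1 = _
  rw [map_mul, Module.End.mul_apply, cosetRep_phi, map_smul]
  rfl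

theorem coeffAt_m (a c : Wt t lam) : coeffAt θ a c (m K t lam c a) = 1 := by
  change (cosetRep θ a (m K t lam c a) (basisVec A a)).1 c.1 = _
  rw [cosetRep_m, backtrack_base, one_smul]
  exact Finsupp.single_eq_same

theorem coeffAt_m_mul_phi (a c : Wt t lam) (f : S K t) :
    coeffAt θ a c (m K t lam c a * phi K a f) = θ f := by
  rw [coeffAt_mul_phi, coeffAt_m, mul_one]

theorem coeffAt_phi_mul_m (a c : Wt t lam) (f : S K t) :
    coeffAt θ a c (phi K c f * m K t lam c a) = θ f := by
  change (cosetRep θ a (phi K c f * m K t lam c a) (basisVec A a)).1 c.1 = _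
  rw [map_mul, Module.End.mul_apply, cosetRep_m, backtrack_base, one_smul, cosetRep_phi]
  change (θ f • Finsupp.single c.1 (1 : A)) c.1 = θ f
  simp

theorem coeffAt_m_mul_m (a c c' : Wt t lam) :
    coeffAt θ a c' (m K t lam c' c * m K t lam c a) = backtrack θ a c c' := by
  change (cosetRep θ a (m K t lam c' c * m K t lam c a) (basisVec A a)).1 c'.1 = _
  rw [map_mul, Module.End.mul_apply, cosetRep_m, backtrack_base, one_smul, cosetRep_m]
  change (backtrack θ a c c' • Finsupp.single c'.1 (1 : A)) c'.1 = _
  simp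

/-- If the `s_i ^ N` act by zero, then so does `J_N` on the basis vector of the base point. -/
theorem coeffAt_eq_zero_of_mem_J (a c : Wt t lam) {N : ℕ} (hθ : ∀ i, θ (sS K t i) ^ N = 0)
    {w : HEAq K t lam} (hw : w ∈ J K a N) : coeffAt θ a c w = 0 := by
  have key : cosetRep θ a w (basisVec A a) = 0 := by
    rw [J] at hw
    induction hw using Submodule.span_induction with
    | zero => rw [map_zero, LinearMap.zero_apply]
    | add x y _ _ hx hy => rw [map_add, LinearMap.add_apply, hx, hy, add_zero]
    | smul r x _ hx => rw [smul_eq_mul, map_mul, Module.End.mul_apply, hx, map_zero]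
    | mem x hx =>
      obtain ⟨i, rfl⟩ := hx
      dsimp only
      rw [← phi_sS, ← map_pow, cosetRep_phi, map_pow, hθ, zero_smul]
  change (cosetRep θ a w (basisVec A a)).1 c.1 = 0
  rw [key]
  rfl

/-- An element of a weight space is determined by the coefficient of the basis vector to which it
sends the base point, for generic `θ`. -/
theorem eq_m_mul_phi_coeffAt (a c : Wt t lam) {w : HEAq K t lam}
    (hw : w ∈ wtA K t lam (c.1 - a.1)) :
    w = m K t lam c a * phi K a (coeffAt (AlgHom.id K (S K t)) a c w) := by
  obtain ⟨f, rfl⟩ := (mem_wtA_iff c a).1 hw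
  rw [coeffAt_m_mul_phi]
  rfl

/-- Moving an element of `S` through `m(c - a)` shifts the weight: `s_i` becomes `h_i - c_i` on the
left and `h_i - a_i` on the right. -/
theorem phi_mul_m (a c : Wt t lam) (f : S K t) :
    phi K c f * m K t lam c a = m K t lam c a * phi K a f := by
  have h1 := mul_mem_wtA (phi_mem_wtA c f) (m_mem_wtA (K := K) c a)
  rw [zero_add] at h1
  have h2 := eq_m_mul_phi_coeffAt a c h1
  rwa [coeffAt_phi_mul_m] at h2

/-- The product of two minimal monomials, up to the edges that are traversed in both directions. -/
theorem m_mul_m (a c c' : Wt t lam) :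
    m K t lam c' c * m K t lam c a =
      m K t lam c' a * phi K a (backtrack (AlgHom.id K (S K t)) a c c') := by
  have h1 := mul_mem_wtA (m_mem_wtA (K := K) c' c) (m_mem_wtA (K := K) c a)
  rw [sub_add_sub_cancel] at h1
  have h2 := eq_m_mul_phi_coeffAt a c' h1
  rwa [coeffAt_m_mul_m] at h2

/-- The left ideal `J_N` meets `m(c - a) S` in `m(c - a) (s_1 ^ N, …, s_n ^ N)`. -/
theorem mem_span_of_m_mul_phi_mem_J (a c : Wt t lam) {N : ℕ} {f : S K t}
    (hf : m K t lam c a * phi K a f ∈ J K a N) :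
    f ∈ Ideal.span (Set.range fun i => sS K t i ^ N) := by
  have h1 := coeffAt_eq_zero_of_mem_J
    (Ideal.Quotient.mkₐ K (Ideal.span (Set.range fun i => sS K t i ^ N))) a c (fun i => by
      rw [← map_pow]
      exact Ideal.Quotient.eq_zero_iff_mem.2 (Ideal.subset_span ⟨i, rfl⟩)) hf
  rw [coeffAt_m_mul_phi] at h1
  exact Ideal.Quotient.eq_zero_iff_mem.1 h1

end WeightSpaces

/-! ### Completions -/

section Completion

variable {R : Type*} [CommRing R] {I : Ideal R}

/-- A sequence whose consecutive differences tend to zero `I`-adically has a limit. -/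
theorem exists_evalₐ_eq (f : ℕ → R) (hf : ∀ k, f (k + 1) - f k ∈ I ^ k) :
    ∃ x : AdicCompletion I R, ∀ k, AdicCompletion.evalₐ I k x = Ideal.Quotient.mk _ (f k) := by
  refine ⟨AdicCompletion.mk I R (AdicCompletion.AdicCauchySequence.mk I R f fun k => ?_),
    fun k => AdicCompletion.evalₐ_mk I k _⟩
  rw [SModEq.comm, SModEq.sub_mem, smul_eq_mul, Ideal.mul_top]
  exact hf k

theorem evalₐ_eq_mk_of_le {k l : ℕ} (hkl : k ≤ l) {x : AdicCompletion I R} {y : R}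
    (hy : AdicCompletion.evalₐ I l x = Ideal.Quotient.mk _ y) :
    AdicCompletion.evalₐ I k x = Ideal.Quotient.mk _ y := by
  induction x using AdicCompletion.induction_on with
  | _ x =>
    rw [AdicCompletion.evalₐ_mk, Ideal.Quotient.eq] at hy ⊢
    have h1 := x.2 hkl
    rw [SModEq.sub_mem, smul_eq_mul, Ideal.mul_top] at h1
    have h2 := add_mem h1 (Ideal.pow_le_pow_right hkl hy)
    rwa [sub_add_sub_cancel] at h2

theorem isUnit_algebraMap_one_sub {x : R} (hx : x ∈ I) :
    IsUnit (algebraMap R (AdicCompletion I R) (1 - x)) := by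
  -- The inverse is the geometric series.
  obtain ⟨y, hy⟩ := exists_evalₐ_eq (I := I) (fun k => ∑ j ∈ Finset.range k, x ^ j) fun k => by
    rw [Finset.sum_range_succ, add_sub_cancel_left]
    exact Ideal.pow_mem_pow hx k
  refine IsUnit.of_mul_eq_one y (AdicCompletion.ext_evalₐ fun k => ?_)
  rw [map_mul, map_one, hy, AlgHom.commutes]
  change Ideal.Quotient.mk _ (1 - x) * _ = Ideal.Quotient.mk _ 1
  rw [← map_mul, Ideal.Quotient.eq, mul_comm, geom_sum_mul_neg, sub_sub_cancel_left]
  exact neg_mem (Ideal.pow_mem_pow hx k)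

theorem isUnit_algebraMap_add {u x : R} (hu : IsUnit u) (hx : x ∈ I) :
    IsUnit (algebraMap R (AdicCompletion I R) (x + u)) := by
  obtain ⟨u, rfl⟩ := hu
  have h : x + u = u * (1 - -(↑u⁻¹ * x)) := by
    rw [sub_neg_eq_add, mul_add, mul_one, Units.mul_inv_cancel_left, add_comm]
  rw [h, map_mul]
  exact (u.isUnit.map _).mul (isUnit_algebraMap_one_sub (neg_mem (I.mul_mem_left _ hx)))

end Completion

section Units

variable {n : ℕ} (K : Type*) [Field K] (t : Submodule ℤ (Fin n → ℤ))

theorem isUnit_s_add (i : Fin n) {k : ℤ} (hk : (k : K) ≠ 0) : IsUnit (s K t i + k) := by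
  have hu : IsUnit (k : S K t) := by
    rw [← map_intCast (algebraMap K (S K t))]
    exact (IsUnit.mk0 _ hk).map _
  have := isUnit_algebraMap_add hu (Ideal.subset_span (s := Set.range (sS K t)) ⟨i, rfl⟩)
  rwa [map_add, map_intCast] at this

theorem isUnit_q (i : Fin n) (k : ℤ) : IsUnit (q K t i k) := by
  rw [q]
  split_ifs with hk
  · exact isUnit_one
  · exact (isUnit_s_add K t i hk).ringInverse

theorem q_mul_s_add_of_ne (i : Fin n) {k : ℤ} (hk : (k : K) ≠ 0) :
    q K t i k * (s K t i + k) = 1 := by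
  rw [q, if_neg hk, Ring.inverse_mul_cancel _ (isUnit_s_add K t i hk)]

theorem q_mul_s_add_of_eq (i : Fin n) {k : ℤ} (hk : (k : K) = 0) :
    q K t i k * (s K t i + k) = s K t i := by
  have h : (k : Shat K t) = 0 := by
    rw [← map_intCast (algebraMap K (Shat K t)), hk, map_zero]
  rw [q, if_pos hk, h, one_mul, add_zero]

theorem span_pow_le_S0_pow (N : ℕ) :
    Ideal.span (Set.range fun i => sS K t i ^ N) ≤ S0 K t ^ N := by
  rw [Ideal.span_le]
  rintro _ ⟨i, rfl⟩
  refine Ideal.pow_mem_pow (Ideal.subset_span ?_) N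
  exact ⟨i, rfl⟩

end Units

/-! ### Morphisms between the modules `Q_a` -/

section Morphisms

variable {n : ℕ} {K : Type*} [Field K] {t : Submodule ℤ (Fin n → ℤ)} {lam : t →ₗ[ℤ] ℤ}

theorem smul_val (a : Wt t lam) (x : Shat K t) (v : Q K a) (N : ℕ) :
    (x • v).1 N = actN K a N x (v.1 N) := rfl

theorem hsmul_val (a : Wt t lam) (r : HEAq K t lam) (v : Q K a) (N : ℕ) :
    (r • v).1 N = r • v.1 N := rfl

theorem one_val (a : Wt t lam) (N : ℕ) : (one K a).1 N = Submodule.Quotient.mk 1 := rfl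

theorem exists_evalₐ_rep (x : Shat K t) (M : ℕ) :
    ∃ y : S K t, AdicCompletion.evalₐ (S0 K t) M x = Ideal.Quotient.mk _ y := by
  obtain ⟨y, hy⟩ := Ideal.Quotient.mk_surjective (AdicCompletion.evalₐ (S0 K t) M x)
  exact ⟨y, hy.symm⟩

theorem actN_algebraMap (a : Wt t lam) (N : ℕ) (y : S K t) :
    actN K a N (algebraMap (S K t) (Shat K t) y) = actS K a N y :=
  actN_eq K a le_rfl _ y (AlgHom.commutes _ _)

theorem J_le_comap_m (c a : Wt t lam) (N : ℕ) :
    J K c N ≤ (J K a N).comap (LinearMap.toSpanSingleton _ _ (m K t lam c a)) := by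
  conv_lhs => rw [J]
  rw [Submodule.span_le]
  rintro _ ⟨i, rfl⟩
  change (h K t lam i - (c.1 i : HEAq K t lam)) ^ N * m K t lam c a ∈ J K a N
  rw [← phi_sS, ← map_pow, phi_mul_m, map_pow, phi_sS]
  exact Submodule.smul_mem _ _ (Submodule.subset_span ⟨i, rfl⟩)

/-- Right multiplication by `m(c - a)`, on the quotients modulo the ideals `J_N`. -/
def rmulN (c a : Wt t lam) (N : ℕ) :
    (HEAq K t lam ⧸ J K c N) →ₗ[HEAq K t lam] HEAq K t lam ⧸ J K a N :=
  (J K c N).mapQ (J K a N) (LinearMap.toSpanSingleton _ _ (m K t lam c a)) (J_le_comap_m c a N)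

theorem rmulN_mk (c a : Wt t lam) (N : ℕ) (w : HEAq K t lam) :
    rmulN c a N (Submodule.Quotient.mk w) = Submodule.Quotient.mk (w * m K t lam c a) := rfl

theorem factor_J_mk (a : Wt t lam) {N N' : ℕ} (hN : N ≤ N') (w : HEAq K t lam) :
    Submodule.factor (J_anti K a hN) (Submodule.Quotient.mk w) = Submodule.Quotient.mk w :=
  Submodule.factor_mk _ w

/-- Right multiplication by `m(c - a)`, as a map `Q_c → Q_a`. -/
def rmul (c a : Wt t lam) : Q K c →ₗ[HEAq K t lam] Q K a :=
  LinearMap.restrict (LinearMap.pi fun N => (rmulN c a N).comp (LinearMap.proj N)) (by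
    intro v hv N N' hN
    simp only [LinearMap.pi_apply, LinearMap.comp_apply, LinearMap.proj_apply]
    rw [← hv N N' hN]
    obtain ⟨w, hw⟩ := Submodule.Quotient.mk_surjective _ (v N')
    rw [← hw, rmulN_mk, factor_J_mk c hN, factor_J_mk a hN, rmulN_mk])

theorem rmul_val (c a : Wt t lam) (v : Q K c) (N : ℕ) {w : HEAq K t lam}
    (hw : v.1 N = Submodule.Quotient.mk w) :
    (rmul c a v).1 N = Submodule.Quotient.mk (w * m K t lam c a) := by
  rw [← rmulN_mk, ← hw]
  rfl

theorem rmul_one (c a : Wt t lam) : rmul c a (one K c) = m K t lam c a • one K a := by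
  refine Subtype.ext (funext fun N => ?_)
  rw [rmul_val c a _ N (one_val c N), hsmul_val, one_val, ← Submodule.Quotient.mk_smul,
    smul_eq_mul, mul_one, one_mul]

theorem rmul_smul (c a : Wt t lam) (x : Shat K t) (v : Q K c) :
    rmul c a (x • v) = x • rmul c a v := by
  refine Subtype.ext (funext fun N => ?_)
  obtain ⟨y, hy⟩ := exists_evalₐ_rep x (bd K t N)
  obtain ⟨w, hw⟩ := Submodule.Quotient.mk_surjective _ (v.1 N)
  have h1 : (x • v).1 N = Submodule.Quotient.mk (w * phi K c y) := by
    rw [smul_val, actN_eq K c le_rfl x y hy, ← hw, actS_mk]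
  rw [rmul_val c a _ N h1, smul_val, actN_eq K a le_rfl x y hy, rmul_val c a _ N hw.symm, actS_mk,
    mul_assoc, mul_assoc, phi_mul_m]

theorem rmul_comp_rmul (a c c' : Wt t lam) (v : Q K c') :
    rmul c a (rmul c' c v) =
      algebraMap (S K t) (Shat K t) (backtrack (AlgHom.id K (S K t)) a c c') • rmul c' a v := by
  refine Subtype.ext (funext fun N => ?_)
  obtain ⟨w, hw⟩ := Submodule.Quotient.mk_surjective _ (v.1 N)
  rw [rmul_val c a _ N (rmul_val c' c _ N hw.symm), smul_val, rmul_val c' a _ N hw.symm,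
    actN_algebraMap, actS_mk, mul_assoc, mul_assoc, m_mul_m]

theorem rmul_self (a : Wt t lam) (v : Q K a) : rmul a a v = v := by
  refine Subtype.ext (funext fun N => ?_)
  obtain ⟨w, hw⟩ := Submodule.Quotient.mk_surjective _ (v.1 N)
  rw [rmul_val a a _ N hw.symm, m_self, mul_one, hw]

/-- Two elements of `Q_a` are close if they agree in `A^λ / J_N` for a large `N`. -/
theorem nhds_Q_hasBasis (a : Wt t lam) (v : Q K a) :
    (nhds v).HasBasis (fun _ : ℕ => True) fun N => {u | u.1 N = v.1 N} := by
  have h : nhds v = ⨅ N : ℕ, Filter.principal {u : Q K a | u.1 N = v.1 N} := by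
    rw [nhds_iInf]
    refine iInf_congr fun N => ?_
    rw [@nhds_induced _ _ ⊥]
    let _ : TopologicalSpace (HEAq K t lam ⧸ J K a N) := ⊥
    have : DiscreteTopology (HEAq K t lam ⧸ J K a N) := ⟨rfl⟩
    rw [nhds_discrete, ← Filter.principal_singleton, Filter.comap_principal]
    rfl
  rw [h]
  refine Filter.hasBasis_iInf_principal (directed_of_isDirected_le fun N N' hN u hu => ?_)
  have hu' : u.1 N' = v.1 N' := hu
  change u.1 N = v.1 N
  rw [← u.2 N N' hN, ← v.2 N N' hN, hu']

theorem continuous_of_val_eq {a c : Wt t lam} (f : Q K c → Q K a)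
    (hf : ∀ N u v, u.1 N = v.1 N → (f u).1 N = (f v).1 N) : Continuous f := by
  rw [continuous_iff_continuousAt]
  intro v
  exact ((nhds_Q_hasBasis c v).tendsto_iff (nhds_Q_hasBasis a (f v))).2 fun N _ =>
    ⟨N, trivial, fun u hu => hf N u v hu⟩

/-- A morphism is determined by the image of the generator, since `A^λ 1_c` is dense in `Q_c`. -/
theorem IsHom.ext {a c : Wt t lam} {f g : Q K c →ₗ[HEAq K t lam] Q K a} (hf : IsHom f)
    (hg : IsHom g) (h : f (one K c) = g (one K c)) : f = g := by
  refine LinearMap.ext fun v => Subtype.ext (funext fun N => ?_)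
  obtain ⟨M, -, hM⟩ := ((nhds_Q_hasBasis c v).tendsto_iff (nhds_Q_hasBasis a (f v))).1
    hf.1.continuousAt N trivial
  obtain ⟨M', -, hM'⟩ := ((nhds_Q_hasBasis c v).tendsto_iff (nhds_Q_hasBasis a (g v))).1
    hg.1.continuousAt N trivial
  obtain ⟨w, hw⟩ := Submodule.Quotient.mk_surjective _ (v.1 (max M M'))
  have hu : ∀ k ≤ max M M', (w • one K c).1 k = v.1 k := by
    intro k hk
    rw [← v.2 k _ hk, ← hw, hsmul_val, one_val, ← Submodule.Quotient.mk_smul, smul_eq_mul, mul_one]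
    exact (Submodule.factor_mk _ w).symm
  have h1 : (f (w • one K c)).1 N = (f v).1 N := hM (w • one K c) (hu M (le_max_left _ _))
  have h2 : (g (w • one K c)).1 N = (g v).1 N := hM' (w • one K c) (hu M' (le_max_right _ _))
  rw [← h1, ← h2, map_smul, map_smul, h]

theorem isHom_smul_rmul (c a : Wt t lam) (x : Shat K t) : IsHom (x • rmul (K := K) c a) := by
  constructor
  · refine continuous_of_val_eq _ fun N u v huv => ?_
    obtain ⟨w, hw⟩ := Submodule.Quotient.mk_surjective _ (v.1 N)
    rw [LinearMap.smul_apply, LinearMap.smul_apply, smul_val, smul_val,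
      rmul_val c a u N (huv.trans hw.symm), rmul_val c a v N hw.symm]
  · intro e v hv N
    obtain ⟨w, hw, hw'⟩ := hv N
    obtain ⟨y, hy⟩ := exists_evalₐ_rep x (bd K t N)
    refine ⟨w * m K t lam c a * phi K a y, ?_, ?_⟩
    · have := mul_mem_wtA (mul_mem_wtA hw (m_mem_wtA c a)) (phi_mem_wtA a y)
      rwa [sub_add_sub_cancel, add_zero] at this
    · rw [LinearMap.smul_apply, smul_val, rmul_val c a v N hw'.symm, actN_eq K a le_rfl x y hy,
        actS_mk]

theorem one_mem_W (a : Wt t lam) : one K a ∈ W K a a.1 := fun N => by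
  refine ⟨1, ?_, rfl⟩
  rw [sub_self, ← map_one (phi K a)]
  exact phi_mem_wtA a 1

/-- The weight space of `Q_a` of weight `c` is generated by `m(c - a) 1_a` over `Ŝ`. -/
theorem exists_smul_m_one (c a : Wt t lam) {v : Q K a} (hv : v ∈ W K a c.1) :
    ∃ x : Shat K t, v = x • m K t lam c a • one K a := by
  have h1 : ∀ N, ∃ f, Submodule.Quotient.mk (m K t lam c a * phi K a f) = v.1 N := fun N => by
    obtain ⟨w, hw, hw'⟩ := hv N
    obtain ⟨f, rfl⟩ := (mem_wtA_iff c a).1 hw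
    exact ⟨f, hw'⟩
  choose f hf using h1
  have hval : ∀ {N M}, N ≤ M → v.1 N = Submodule.Quotient.mk (m K t lam c a * phi K a (f M)) := by
    intro N M hNM
    rw [← v.2 N M hNM, ← hf M]
    exact Submodule.factor_mk _ _
  obtain ⟨x, hx⟩ := exists_evalₐ_eq (I := S0 K t) f fun k => by
    refine span_pow_le_S0_pow K t k (mem_span_of_m_mul_phi_mem_J a c ?_)
    rw [map_sub, mul_sub, ← Submodule.Quotient.eq, ← hval (Nat.le_succ k), hf]
  refine ⟨x, Subtype.ext (funext fun N => ?_)⟩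
  rw [smul_val, actN_eq K a (le_max_left _ N) x _ (hx _), hsmul_val, one_val,
    ← Submodule.Quotient.mk_smul, smul_eq_mul, mul_one, actS_mk]
  exact hval (le_max_right _ _)

/-- The weight spaces of `Q_a` are torsion-free over `Ŝ`. -/
theorem eq_zero_of_smul_m_one (c a : Wt t lam) {x : Shat K t}
    (hx : x • m K t lam c a • one K a = 0) : x = 0 := by
  refine AdicCompletion.ext_evalₐ fun N => ?_
  obtain ⟨y, hy⟩ := exists_evalₐ_rep x (max (bd K t N) N)
  have h1 : (x • m K t lam c a • one K a).1 N =
      Submodule.Quotient.mk (m K t lam c a * phi K a y) := by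
    rw [smul_val, actN_eq K a (le_max_left _ _) x y hy, hsmul_val, one_val,
      ← Submodule.Quotient.mk_smul, smul_eq_mul, mul_one, actS_mk]
  rw [hx] at h1
  have h2 := mem_span_of_m_mul_phi_mem_J a c ((Submodule.Quotient.mk_eq_zero _).1 h1.symm)
  have h3 := span_pow_le_S0_pow K t N h2
  rw [evalₐ_eq_mk_of_le (le_max_right _ _) hy, map_zero, Ideal.Quotient.eq_zero_iff_mem]
  exact h3

end Morphisms

/-! ### Backtracking along a path of chambers -/

section Backtracking

theorem lt_mul_iff_of_mem_chamber {p a x : ℤ} (hp : 0 < p) (h1 : p * x ≤ a) (h2 : a < p * x + p)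
    (k : ℤ) : a < p * k ↔ x < k := by
  constructor
  · intro h
    exact lt_of_mul_lt_mul_left (h1.trans_lt h) hp.le
  · intro h
    have : p * (x + 1) ≤ p * k := mul_le_mul_of_nonneg_left h hp.le
    linarith

theorem prod_Icc_one_sub {M : Type*} [CommMonoid M] (a c : ℤ) (f : ℤ → M) :
    ∏ j ∈ Finset.Icc 1 (c - a), f (a + j) = ∏ j ∈ Finset.Ioc a c, f j := by
  refine Finset.prod_bij' (fun j _ => a + j) (fun j _ => j - a) ?_ ?_ ?_ ?_ ?_
  · intro j hj
    rw [Finset.mem_Icc] at hj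
    rw [Finset.mem_Ioc]
    omega
  · intro j hj
    rw [Finset.mem_Ioc] at hj
    rw [Finset.mem_Icc]
    omega
  · intro j _
    omega
  · intro j _
    omega
  · intro j _
    rfl

/-- The number of walls `j = p k` in the part of a path `a → c → c'` that is traversed in both
directions. -/
theorem card_backtracked_walls {p a c c' x y u : ℤ} (hp : 0 < p)
    (ha : p * x ≤ a ∧ a < p * x + p) (hc : p * y ≤ c ∧ c < p * y + p)
    (hc' : p * u ≤ c' ∧ c' < p * u + p) (I : Finset ℤ) (hI : ∀ j, (c < j ∧ j ≤ c' ∧ j ≤ a ∨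
      c' < j ∧ j ≤ c ∧ a < j) → j ∈ I) :
    (I.filter fun j => (c < j ∧ j ≤ c' ∧ j ≤ a ∨ c' < j ∧ j ≤ c ∧ a < j) ∧ p ∣ j).card =
      ((x - y).natAbs + (y - u).natAbs - (x - u).natAbs) / 2 := by
  have h : (I.filter fun j => (c < j ∧ j ≤ c' ∧ j ≤ a ∨ c' < j ∧ j ≤ c ∧ a < j) ∧ p ∣ j) =
      (Finset.Ioc y (min u x) ∪ Finset.Ioc (max u x) y).image (p * ·) := by
    have key : ∀ k, (c < p * k ∧ p * k ≤ c' ∧ p * k ≤ a ∨ c' < p * k ∧ p * k ≤ c ∧ a < p * k) ↔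
        (y < k ∧ k ≤ min u x ∨ max u x < k ∧ k ≤ y) := by
      intro k
      rw [← not_lt (a := c'), ← not_lt (a := c), ← not_lt (a := a),
        lt_mul_iff_of_mem_chamber hp ha.1 ha.2, lt_mul_iff_of_mem_chamber hp hc.1 hc.2,
        lt_mul_iff_of_mem_chamber hp hc'.1 hc'.2]
      omega
    ext j
    simp only [Finset.mem_filter, Finset.mem_image, Finset.mem_union, Finset.mem_Ioc]
    constructor
    · rintro ⟨-, hj, k, rfl⟩
      exact ⟨k, (key k).1 hj, rfl⟩
    · rintro ⟨k, hk, rfl⟩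
      exact ⟨hI _ ((key k).2 hk), (key k).2 hk, k, rfl⟩
  rw [h, Finset.card_image_of_injective _ (mul_right_injective₀ hp.ne'),
    Finset.card_union_of_disjoint, Int.card_Ioc, Int.card_Ioc]
  · omega
  · rw [Finset.disjoint_left]
    intro j hj hj'
    rw [Finset.mem_Ioc] at hj hj'
    omega

/-- The edges that the path `a → c → c'` traverses in both directions contribute `q j * f j`, where
`f j` comes from the direction towards `a` and `q j` from the upward direction. -/
theorem prod_q_mul_backtrack {M : Type*} [CommMonoid M] {p a c c' x y u : ℤ} (hp : 0 < p)
    (ha : p * x ≤ a ∧ a < p * x + p) (hc : p * y ≤ c ∧ c < p * y + p)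
    (hc' : p * u ≤ c' ∧ c' < p * u + p) {q f : ℤ → M} {s : M}
    (h0 : ∀ j, p ∣ j → q j * f j = s) (h1 : ∀ j, ¬ p ∣ j → q j * f j = 1) :
    ((∏ j ∈ Finset.Ioc a c, q j) * ∏ j ∈ Finset.Ioc c c', q j) *
      ((∏ j ∈ Finset.Ioc c c', if j ≤ a then f j else 1) *
        ∏ j ∈ Finset.Ioc c' c, if j ≤ a then 1 else f j) =
      s ^ (((x - y).natAbs + (y - u).natAbs - (x - u).natAbs) / 2) *
        ∏ j ∈ Finset.Ioc a c', q j := by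
  classical
  -- All products are extended to the interval spanned by `a`, `c` and `c'`, and compared termwise.
  set I := Finset.Ioc (min a (min c c')) (max a (max c c')) with hI
  have ext : ∀ v w (g : ℤ → M), min a (min c c') ≤ v → w ≤ max a (max c c') →
      ∏ j ∈ Finset.Ioc v w, g j = ∏ j ∈ I, if v < j ∧ j ≤ w then g j else 1 := by
    intro v w g hv hw
    rw [← Finset.prod_filter]
    congr 1
    ext j
    simp only [hI, Finset.mem_filter, Finset.mem_Ioc]
    omega
  rw [← card_backtracked_walls hp ha hc hc' I, Finset.card_eq_sum_ones,
    ← Finset.prod_pow_eq_pow_sum]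
  · simp only [pow_one]
    rw [Finset.prod_filter, ext a c, ext c c', ext c c', ext c' c, ext a c',
      ← Finset.prod_mul_distrib, ← Finset.prod_mul_distrib, ← Finset.prod_mul_distrib,
      ← Finset.prod_mul_distrib]
    · refine Finset.prod_congr rfl fun j _ => ?_
      have h : q j * f j = if p ∣ j then s else 1 := by
        split_ifs with hj
        exacts [h0 j hj, h1 j hj]
      simp only [← not_le (a := j)] at h ⊢
      by_cases ha : j ≤ a <;> by_cases hc : j ≤ c <;> by_cases hc' : j ≤ c' <;>
        simp [ha, hc, hc', h, mul_comm]
    all_goals omega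
  · intro j hj
    rw [hI, Finset.mem_Ioc]
    omega

end Backtracking

section Composition

variable {n : ℕ} {K : Type*} [Field K] {t : Submodule ℤ (Fin n → ℤ)} {lam : t →ₗ[ℤ] ℤ}

/-- The invertible factor of `cvec`. -/
def qprod (K : Type*) [Field K] (a c : Wt t lam) : Shat K t :=
  ∏ i, ∏ j ∈ Finset.Icc 1 (c.1 i - a.1 i), q K t i (a.1 i + j)

theorem isUnit_qprod (a c : Wt t lam) : IsUnit (qprod K a c) := by
  rw [qprod, IsUnit.prod_univ_iff]
  intro i
  rw [IsUnit.prod_iff]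
  exact fun j _ => isUnit_q K t i _

theorem qprod_eq (a c : Wt t lam) :
    qprod K a c = ∏ i, ∏ j ∈ Finset.Ioc (a.1 i) (c.1 i), q K t i j :=
  Finset.prod_congr rfl fun _ _ => prod_Icc_one_sub _ _ _

theorem qprod_self (a : Wt t lam) : qprod K a a = 1 := by
  simp [qprod]

/-- The morphism `Q_c → Q_a` that sends `1_c` to `cvec a c`. -/
def cHom (K : Type*) [Field K] (a c : Wt t lam) : Q K c →ₗ[HEAq K t lam] Q K a :=
  qprod K a c • rmul c a

theorem cHom_apply (a c : Wt t lam) (v : Q K c) : cHom K a c v = qprod K a c • rmul c a v := rfl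

theorem cHom_one (a c : Wt t lam) : cHom K a c (one K c) = cvec K a c := by
  rw [cHom_apply, rmul_one]
  rfl

theorem cHom_smul (a c : Wt t lam) (x : Shat K t) (v : Q K c) :
    cHom K a c (x • v) = x • cHom K a c v := by
  rw [cHom_apply, cHom_apply, rmul_smul, smul_comm]

theorem cHom_self (a : Wt t lam) (v : Q K a) : cHom K a a v = v := by
  rw [cHom_apply, qprod_self, one_smul, rmul_self]

variable {p : ℕ} [CharP K p]

/-- The factors `q` cancel the factors of the edges that are traversed in both directions, except
for one factor `s_i` for each wall. -/
theorem qprod_mul_backtrack (hp : p.Prime) {x y u : Fin n → ℤ} {a c c' : Wt t lam}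
    (ha : a ∈ Δ p lam x) (hc : c ∈ Δ p lam y) (hc' : c' ∈ Δ p lam u) :
    qprod K a c * qprod K c c' *
      algebraMap (S K t) (Shat K t) (backtrack (AlgHom.id K (S K t)) a c c') =
      (∏ i, s K t i ^ η x y u i) * qprod K a c' := by
  rw [qprod_eq, qprod_eq, qprod_eq, backtrack, map_prod, ← Finset.prod_mul_distrib,
    ← Finset.prod_mul_distrib, ← Finset.prod_mul_distrib]
  refine Finset.prod_congr rfl fun i _ => ?_
  rw [η, ← prod_q_mul_backtrack (Int.natCast_pos.2 hp.pos) (ha i) (hc i) (hc' i)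
    (q := q K t i) (f := fun j => s K t i + j) (s := s K t i)]
  · rw [map_mul, map_prod, map_prod]
    congr 2 <;>
    · refine Finset.prod_congr rfl fun j _ => ?_
      simp only [upFactor, downFactor]
      split_ifs
      · simp [s]
      · simp [s]
  · intro j hj
    exact q_mul_s_add_of_eq K t i ((CharP.intCast_eq_zero_iff K p j).2 hj)
  · intro j hj
    exact q_mul_s_add_of_ne K t i fun h => hj ((CharP.intCast_eq_zero_iff K p j).1 h)

theorem cHom_cHom (hp : p.Prime) {x y u : Fin n → ℤ} {a c c' : Wt t lam}
    (ha : a ∈ Δ p lam x) (hc : c ∈ Δ p lam y) (hc' : c' ∈ Δ p lam u) (v : Q K c') :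
    cHom K a c (cHom K c c' v) = (∏ i, s K t i ^ η x y u i) • cHom K a c' v := by
  rw [cHom_apply, cHom_apply, cHom_apply, rmul_smul, rmul_comp_rmul, smul_smul, smul_smul,
    smul_smul, qprod_mul_backtrack hp ha hc hc']

end Composition

/-! ### The basis of the endomorphism algebra -/

section EndBasis

variable {n : ℕ} {K : Type*} [Field K] {t : Submodule ℤ (Fin n → ℤ)} {lam : t →ₗ[ℤ] ℤ}
  {V : Type*} (b : V → Wt t lam)

theorem P_smul_apply (r : Shat K t) (v : P K b) (x : V) : (r • v) x = r • v x := rfl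

variable [DecidableEq V]

theorem inc_smul (y : V) (r : Shat K t) (v : Q K (b y)) :
    inc K b y (r • v) = r • inc K b y v :=
  DFinsupp.single_smul (β := fun x => Q K (b x)) r v

theorem inc_apply_same (y : V) (v : Q K (b y)) : (inc K b y v) y = v :=
  DirectSum.of_eq_same _ _

theorem inc_apply_of_ne {x y : V} (h : x ≠ y) (v : Q K (b y)) : (inc K b y v) x = 0 :=
  DirectSum.of_eq_of_ne _ _ _ h

/-- The morphism `c_{x,y}`, extended by zero to the other summands. -/
def cE (K : Type*) [Field K] (x y : V) : Module.End (HEAq K t lam) (P K b) :=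
  (inc K b x).comp ((cHom K (b x) (b y)).comp
    (DirectSum.component (HEAq K t lam) V (fun x => Q K (b x)) y))

theorem cE_apply (x y : V) (v : P K b) : cE b K x y v = inc K b x (cHom K (b x) (b y) (v y)) := rfl

theorem cE_smul (x y : V) (r : Shat K t) (v : P K b) : cE b K x y (r • v) = r • cE b K x y v := by
  rw [cE_apply, cE_apply, P_smul_apply, cHom_smul, inc_smul]

theorem cE_self (x : V) : cE b K x x = proj K b x := by
  refine LinearMap.ext fun v => ?_
  rw [cE_apply, cHom_self]
  rfl

theorem isC_cE (x y : V) : IsC K b x y (cE b K x y) := by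
  intro u
  rw [cE_apply]
  split_ifs with h
  · subst h
    rw [inc_apply_same, cHom_one]
  · rw [inc_apply_of_ne b (Ne.symm h), map_zero, map_zero]

theorem cE_mul_of_ne (x u : V) {y y' : V} (h : y ≠ y') : cE b K x y * cE b K y' u = 0 := by
  refine LinearMap.ext fun v => ?_
  rw [Module.End.mul_apply, cE_apply, cE_apply, inc_apply_of_ne b h, map_zero, map_zero]
  rfl

/-- The `Ŝ`-linear combinations of the `c_{x,y}`. -/
def linComb (K : Type*) [Field K] :
    ((V × V) →₀ Shat K t) →ₗ[Shat K t] Module.End (HEAq K t lam) (P K b) :=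
  Finsupp.linearCombination (Shat K t) fun xy : V × V => cE b K xy.1 xy.2

theorem entry_linComb (r : (V × V) →₀ Shat K t) (x y : V) :
    entry (linComb b K r) x y = r (x, y) • cHom K (b x) (b y) := by
  induction r using Finsupp.induction_linear with
  | zero =>
    rw [map_zero, Finsupp.zero_apply, zero_smul]
    rfl
  | add r r' hr hr' =>
    rw [map_add, Finsupp.add_apply, add_smul, ← hr, ← hr']
    rfl
  | single xy r =>
    obtain ⟨x', y'⟩ := xy
    refine LinearMap.ext fun v => ?_
    rw [linComb, Finsupp.linearCombination_single]
    change (r • cE b K x' y' (inc K b y v)) x = Finsupp.single (x', y') r (x, y) • cHom _ _ _ v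
    rw [P_smul_apply, cE_apply]
    by_cases hx : x = x'
    · subst hx
      by_cases hy : y' = y
      · subst hy
        rw [inc_apply_same, inc_apply_same, Finsupp.single_eq_same]
      · rw [inc_apply_of_ne b hy, map_zero, map_zero, Finsupp.single_eq_of_ne (by
          rintro h
          exact hy (congrArg Prod.snd h).symm), zero_smul]
        exact smul_zero r
    · rw [inc_apply_of_ne b hx, Finsupp.single_eq_of_ne (by
          rintro h
          exact hx (congrArg Prod.fst h)), zero_smul, smul_zero]

theorem eq_zero_of_smul_cHom (a c : Wt t lam) {r : Shat K t} (h : r • cHom K a c = 0) :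
    r = 0 := by
  have h1 := LinearMap.congr_fun h (one K c)
  rw [LinearMap.smul_apply, cHom_apply, rmul_one, smul_smul, LinearMap.zero_apply] at h1
  exact (isUnit_qprod a c).mul_left_eq_zero.1 (eq_zero_of_smul_m_one c a h1)

theorem linComb_injective : Function.Injective (linComb b K) := by
  rw [injective_iff_map_eq_zero]
  intro r hr
  ext1 ⟨x, y⟩
  refine eq_zero_of_smul_cHom (b x) (b y) ?_
  rw [← entry_linComb, hr]
  rfl

/-- Every morphism `Q_c → Q_a` is a multiple of `cHom`: the image of `1_c` has weight `c`. -/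
theorem exists_smul_cHom {a c : Wt t lam} {f : Q K c →ₗ[HEAq K t lam] Q K a} (hf : IsHom f) :
    ∃ r : Shat K t, f = r • cHom K a c := by
  obtain ⟨r, hr⟩ := exists_smul_m_one c a (hf.2 _ _ (one_mem_W c))
  obtain ⟨u, hu⟩ := isUnit_qprod (K := K) a c
  have h : (r * ↑u⁻¹) • cHom K a c = r • rmul c a := by
    rw [cHom, smul_smul, ← hu, Units.inv_mul_cancel_right]
  refine ⟨r * ↑u⁻¹, ?_⟩
  rw [h]
  refine hf.ext (isHom_smul_rmul c a r) ?_
  rw [hr, LinearMap.smul_apply, rmul_one]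

theorem end_ext {f g : Module.End (HEAq K t lam) (P K b)} (h : ∀ x y, entry f x y = entry g x y) :
    f = g := by
  refine DirectSum.linearMap_ext _ fun y => LinearMap.ext fun v => DFinsupp.ext fun x => ?_
  exact LinearMap.congr_fun (h x y) v

/-- The endomorphisms with finitely many nonzero entries are the linear combinations of the
`c_{x,y}`. -/
theorem range_linComb : Set.range (linComb b K) = EndP K b := by
  ext f
  constructor
  · rintro ⟨r, rfl⟩
    refine ⟨fun x y => ?_, r.support.finite_toSet.subset fun xy hxy => ?_⟩
    · rw [entry_linComb, cHom, smul_smul]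
      exact isHom_smul_rmul _ _ _
    · rw [Finset.mem_coe, Finsupp.mem_support_iff]
      intro h
      refine hxy ?_
      rw [entry_linComb, h, zero_smul]
  · rintro ⟨hf, hfin⟩
    choose r hr using fun xy : V × V => exists_smul_cHom (hf xy.1 xy.2)
    refine ⟨Finsupp.onFinset hfin.toFinset r fun xy hxy => ?_, end_ext b fun x y => ?_⟩
    · rw [Set.Finite.mem_toFinset]
      intro h
      refine hxy (eq_zero_of_smul_cHom _ _ ((hr xy).symm.trans h))
    · rw [entry_linComb, Finsupp.onFinset_apply]
      exact (hr (x, y)).symm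

end EndBasis

/-! ### Presentations of the endomorphism algebra -/

section Presentation

variable {n : ℕ} {K : Type*} [Field K] {t : Submodule ℤ (Fin n → ℤ)} {lam : t →ₗ[ℤ] ℤ}
  {V : Type*} (b : V → Wt t lam)

set_option synthInstance.maxHeartbeats 400000 in
/-- A shortcut: the general search for this instance is slow. -/
instance : Algebra (Shat K t) (Module.End (Shat K t) (P K b)) := inferInstance

/-- The `Ŝ`-algebra of the additive endomorphisms of `⨁ P_x` that are linear over both `A^λ` and
`Ŝ`. Composition of maps is not bilinear over `Ŝ` on the ring of all `A^λ`-linear endomorphisms. -/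
def biEnd (K : Type*) [Field K] {lam : t →ₗ[ℤ] ℤ} (b : V → Wt t lam) :
    Subalgebra (Shat K t) (Module.End (Shat K t) (P K b)) where
  carrier := {f | ∀ (r : HEAq K t lam) (v : P K b), f (r • v) = r • f v}
  mul_mem' := by
    intro f g hf hg r v
    rw [Module.End.mul_apply, Module.End.mul_apply, hg, hf]
  add_mem' := by
    intro f g hf hg r v
    rw [LinearMap.add_apply, LinearMap.add_apply, hf, hg, smul_add]
  algebraMap_mem' := by
    intro x r v
    exact (smul_comm r x v).symm

/-- Forget the `Ŝ`-linearity. -/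
def biEndToEnd (K : Type*) [Field K] {lam : t →ₗ[ℤ] ℤ} (b : V → Wt t lam) :
    biEnd K b →ₙₐ[Shat K t] Module.End (HEAq K t lam) (P K b) where
  toFun f :=
    { toFun := f.1
      map_add' := f.1.map_add
      map_smul' := f.2 }
  map_smul' _ _ := rfl
  map_zero' := rfl
  map_add' _ _ := rfl
  map_mul' _ _ := rfl

theorem biEndToEnd_apply (f : biEnd K b) (v : P K b) : biEndToEnd K b f v = f.1 v := rfl

theorem biEndToEnd_injective : Function.Injective (biEndToEnd K b) := by
  intro f g h
  refine Subtype.ext (LinearMap.ext fun v => ?_)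
  rw [← biEndToEnd_apply, h, biEndToEnd_apply]

/-- The morphism `c_{x,y}` as an element of `biEnd`. -/
def cB [DecidableEq V] (K : Type*) [Field K] {lam : t →ₗ[ℤ] ℤ} (b : V → Wt t lam) (x y : V) :
    biEnd K b :=
  ⟨{ toFun := cE b K x y
     map_add' := map_add _
     map_smul' := cE_smul b x y }, map_smul (cE b K x y)⟩

theorem biEndToEnd_cB [DecidableEq V] (x y : V) : biEndToEnd K b (cB K b x y) = cE b K x y := rfl

variable {X : Type*} {r : FreeAlgebra (Shat K t) X → FreeAlgebra (Shat K t) X → Prop}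

/-- A homomorphism from an algebra given by generators and relations to `biEnd`, restricted to the
subalgebra without unit generated by the generators. -/
def presentedHom (L : RingQuot r →ₐ[Shat K t] biEnd K b) :
    Presented (Shat K t) r →ₙₐ[Shat K t] Module.End (HEAq K t lam) (P K b) :=
  (biEndToEnd K b).comp
    ((L : RingQuot r →ₙₐ[Shat K t] biEnd K b).comp (NonUnitalSubalgebraClass.subtype _))

theorem presentedHom_apply (L : RingQuot r →ₐ[Shat K t] biEnd K b) (w : Presented (Shat K t) r) :
    presentedHom b L w = biEndToEnd K b (L w.1) := rfl

/-- A span that contains the generators and is stable under left multiplication by the generators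
contains the algebra that they generate. -/
theorem presented_le_of_gen_mul_mem {R : Type*} [CommRing R]
    {r : FreeAlgebra R X → FreeAlgebra R X → Prop} (N : Submodule R (RingQuot r))
    (h1 : ∀ x, gen R r x ∈ N) (h2 : ∀ x, ∀ w ∈ N, gen R r x * w ∈ N) {w : RingQuot r}
    (hw : w ∈ Presented R r) : w ∈ N := by
  suffices h : w ∈ N ∧ ∀ v ∈ N, w * v ∈ N from h.1
  induction hw using NonUnitalAlgebra.adjoin_induction with
  | mem x hx =>
    obtain ⟨x, rfl⟩ := hx
    exact ⟨h1 x, h2 x⟩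
  | zero =>
    refine ⟨zero_mem _, fun v _ => ?_⟩
    rw [zero_mul]
    exact zero_mem _
  | add x y _ _ hx hy =>
    refine ⟨add_mem hx.1 hy.1, fun v hv => ?_⟩
    rw [add_mul]
    exact add_mem (hx.2 v hv) (hy.2 v hv)
  | mul x y _ _ hx hy =>
    refine ⟨hx.2 y hy.1, fun v hv => ?_⟩
    rw [mul_assoc]
    exact hx.2 _ (hy.2 v hv)
  | smul a x _ hx =>
    refine ⟨Submodule.smul_mem _ _ hx.1, fun v hv => ?_⟩
    rw [smul_mul_assoc]
    exact Submodule.smul_mem _ _ (hx.2 v hv)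

/-- A presented algebra is isomorphic to `EndP` if it is spanned by a family of elements that is
sent to the basis `c_{x,y}`. -/
theorem presentedHom_bijective [DecidableEq V] (L : RingQuot r →ₐ[Shat K t] biEnd K b)
    (c : V × V → RingQuot r)
    (hc : ∀ xy, c xy ∈ Presented (Shat K t) r) (hL : ∀ xy, L (c xy) = cB K b xy.1 xy.2)
    (hspan : ∀ w ∈ Presented (Shat K t) r, w ∈ Submodule.span (Shat K t) (Set.range c)) :
    Function.Injective (presentedHom b L) ∧ Set.range (presentedHom b L) = EndP K b := by
  have key : ∀ a : (V × V) →₀ Shat K t,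
      biEndToEnd K b (L (Finsupp.linearCombination (Shat K t) c a)) = linComb b K a := by
    intro a
    induction a using Finsupp.induction_linear with
    | zero => simp only [map_zero]
    | add a a' h h' => simp only [map_add, h, h']
    | single xy a =>
      rw [Finsupp.linearCombination_single, map_smul, map_smul, hL, biEndToEnd_cB, linComb,
        Finsupp.linearCombination_single]
  have h1 : ∀ w : Presented (Shat K t) r,
      ∃ a, Finsupp.linearCombination (Shat K t) c a = w.1 := fun w =>
    (Finsupp.mem_span_range_iff_exists_finsupp.1 (hspan w.1 w.2))
  constructor
  · rw [injective_iff_map_eq_zero]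
    intro w hw
    obtain ⟨a, ha⟩ := h1 w
    rw [presentedHom_apply, ← ha, key] at hw
    rw [linComb_injective b (hw.trans (map_zero _).symm), map_zero] at ha
    exact Subtype.ext ha.symm
  · rw [← range_linComb]
    ext f
    constructor
    · rintro ⟨w, rfl⟩
      obtain ⟨a, ha⟩ := h1 w
      exact ⟨a, by rw [presentedHom_apply, ← ha, key]⟩
    · rintro ⟨a, rfl⟩
      refine ⟨⟨Finsupp.linearCombination (Shat K t) c a, ?_⟩, key a⟩
      rw [Finsupp.linearCombination_apply]
      exact sum_mem fun xy _ => SMulMemClass.smul_mem _ (hc xy)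

end Presentation

/-! ### The relations between the morphisms `c_{x,y}` -/

section Relations

variable {n : ℕ} {K : Type*} [Field K] {t : Submodule ℤ (Fin n → ℤ)} {lam : t →ₗ[ℤ] ℤ}

theorem η_self_left (x u : Fin n → ℤ) (i : Fin n) : η x x u i = 0 := by
  simp [η]

theorem η_self_right (x y : Fin n → ℤ) (i : Fin n) : η x y y i = 0 := by
  simp [η]

theorem cB_mul_of_ne {V : Type*} [DecidableEq V] (b : V → Wt t lam) (x u : V) {y y' : V}
    (h : y ≠ y') : cB K b x y * cB K b y' u = 0 := by
  apply biEndToEnd_injective b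
  rw [map_mul, biEndToEnd_cB, biEndToEnd_cB, cE_mul_of_ne b x u h, map_zero]

variable {p : ℕ} [CharP K p] (hp : p.Prime) {b : Λ p lam → Wt t lam}
  (hb : ∀ x : Λ p lam, b x ∈ Δ p lam x)

include hp hb in
theorem cB_mul (x y u : Λ p lam) :
    cB K b x y * cB K b y u = (∏ i, s K t i ^ η x.1 y.1 u.1 i) • cB K b x u := by
  apply biEndToEnd_injective b
  rw [map_mul, map_smul, biEndToEnd_cB, biEndToEnd_cB, biEndToEnd_cB]
  refine LinearMap.ext fun v => ?_
  rw [Module.End.mul_apply, LinearMap.smul_apply, cE_apply, cE_apply, cE_apply, inc_apply_same,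
    cHom_cHom hp (hb x) (hb y) (hb u), inc_smul]

include hp hb in
theorem cB_self_mul (x y : Λ p lam) : cB K b x x * cB K b x y = cB K b x y := by
  rw [cB_mul hp hb, Finset.prod_eq_one, one_smul]
  intro i _
  rw [η_self_left, pow_zero]

include hp hb in
theorem cB_mul_self (x y : Λ p lam) : cB K b x y * cB K b y y = cB K b x y := by
  rw [cB_mul hp hb, Finset.prod_eq_one, one_smul]
  intro i _
  rw [η_self_right, pow_zero]

include hp hb in
theorem cB_idem (x y : Λ p lam) [Decidable (x = y)] :
    cB K b x x * cB K b y y = if x = y then cB K b x x else 0 := by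
  split_ifs with h
  · subst h
    exact cB_self_mul hp hb x x
  · exact cB_mul_of_ne b x y h

/-- The value of a generator of `AlgH`. -/
def genHVal (K : Type*) [Field K] (b : Λ p lam → Wt t lam) : GenH (Λ p lam) → biEnd K b
  | .e x => cB K b x x
  | .c x y => cB K b x y

/-- The homomorphism from the algebra with the relations of `AlgH` to the endomorphisms. -/
def homH : RingQuot (RelH (Shat K t) (s K t) (Λ p lam)) →ₐ[Shat K t] biEnd K b :=
  RingQuot.liftAlgHom (Shat K t) ⟨FreeAlgebra.lift (Shat K t) (genHVal K b), by
    intro f g h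
    cases h with
    | idem x y =>
      rw [map_mul, FreeAlgebra.lift_ι_apply, FreeAlgebra.lift_ι_apply,
        apply_ite (FreeAlgebra.lift (Shat K t) (genHVal K b)), map_zero, FreeAlgebra.lift_ι_apply]
      exact cB_idem hp hb x y
    | left x y =>
      simp only [map_mul, FreeAlgebra.lift_ι_apply]
      exact cB_self_mul hp hb x y
    | right x y =>
      simp only [map_mul, FreeAlgebra.lift_ι_apply]
      exact cB_mul_self hp hb x y
    | diag x => simp only [FreeAlgebra.lift_ι_apply, genHVal]
    | mul x y u =>
      simp only [map_mul, map_smul, FreeAlgebra.lift_ι_apply]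
      exact cB_mul hp hb x y u⟩

theorem homH_gen (g : GenH (Λ p lam)) : homH hp hb (gen _ _ g) = genHVal K b g := by
  unfold homH gen
  rw [RingQuot.liftAlgHom_mkAlgHom_apply, FreeAlgebra.lift_ι_apply]

theorem gen_rel {R : Type*} [CommRing R] {X : Type*}
    {r : FreeAlgebra R X → FreeAlgebra R X → Prop} {f g : FreeAlgebra R X} (h : r f g) :
    RingQuot.mkAlgHom R r f = RingQuot.mkAlgHom R r g := RingQuot.mkAlgHom_rel R h

/-- The algebra `AlgH` is spanned by the generators `c_{x,y}`. -/
theorem mem_span_of_mem_AlgH {R : Type*} [CommRing R] (σ : Fin n → R) (V : Set (Fin n → ℤ))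
    {w : RingQuot (RelH R σ V)} (hw : w ∈ AlgH R σ V) :
    w ∈ Submodule.span R (Set.range fun xy : V × V => gen R (RelH R σ V) (.c xy.1 xy.2)) := by
  classical
  set N := Submodule.span R (Set.range fun xy : V × V => gen R (RelH R σ V) (.c xy.1 xy.2))
  have hc : ∀ x y, gen R (RelH R σ V) (.c x y) ∈ N := fun x y => Submodule.subset_span ⟨(x, y), rfl⟩
  have he : ∀ x, gen R (RelH R σ V) (.e x) = gen R (RelH R σ V) (.c x x) := fun x =>
    (gen_rel (RelH.diag x)).symm
  have idem : ∀ x y : V, x ≠ y → gen R (RelH R σ V) (.e x) * gen R (RelH R σ V) (.e y) = 0 := by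
    intro x y hxy
    have h := gen_rel (RelH.idem (R := R) (s := σ) x y)
    rw [if_neg hxy, map_mul, map_zero] at h
    exact h
  have hmul : ∀ x y u v : V, gen R (RelH R σ V) (.c x y) * gen R (RelH R σ V) (.c u v) ∈ N := by
    intro x y u v
    by_cases h : y = u
    · subst h
      have h := gen_rel (RelH.mul (R := R) (s := σ) x y v)
      rw [map_mul, map_smul] at h
      exact h ▸ Submodule.smul_mem _ _ (hc x v)
    · have h1 := gen_rel (RelH.right (R := R) (s := σ) x y)
      have h2 := gen_rel (RelH.left (R := R) (s := σ) u v)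
      rw [map_mul] at h1 h2
      change gen R (RelH R σ V) (.c x y) * gen R (RelH R σ V) (.e y) = _ at h1
      change gen R (RelH R σ V) (.e u) * gen R (RelH R σ V) (.c u v) = _ at h2
      have h3 : gen R (RelH R σ V) (.c x y) * gen R (RelH R σ V) (.c u v) = 0 := by
        calc _ = gen R (RelH R σ V) (.c x y) * gen R (RelH R σ V) (.e y) *
            (gen R (RelH R σ V) (.e u) * gen R (RelH R σ V) (.c u v)) := by rw [h1, h2]; rfl
          _ = 0 := by
            rw [mul_assoc, ← mul_assoc (gen R (RelH R σ V) (.e y)), idem y u h, zero_mul, mul_zero]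
      rw [h3]
      exact zero_mem _
  have hgen : ∀ g u v, gen R (RelH R σ V) g * gen R (RelH R σ V) (.c u v) ∈ N := by
    rintro (x | ⟨x, y⟩) u v
    · rw [he]
      exact hmul x x u v
    · exact hmul x y u v
  refine presented_le_of_gen_mul_mem N ?_ (fun g w hw => ?_) hw
  · rintro (x | ⟨x, y⟩)
    · rw [he]
      exact hc x x
    · exact hc x y
  · induction hw using Submodule.span_induction with
    | mem w hw =>
      obtain ⟨⟨u, v⟩, rfl⟩ := hw
      exact hgen g u v
    | zero =>
      rw [mul_zero]
      exact zero_mem _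
    | add w w' _ _ h h' =>
      rw [mul_add]
      exact add_mem h h'
    | smul a w _ h =>
      rw [mul_smul_comm]
      exact Submodule.smul_mem _ _ h

/-- A path that crosses a wall of type `i` and returns has `η_j = δ_{ij}`. -/
theorem prod_pow_η_return {R : Type*} [CommRing R] (σ : Fin n → R) (x y : Fin n → ℤ) (i : Fin n)
    (h : y = x + Pi.single i 1 ∨ x = y + Pi.single i 1) : ∏ j, σ j ^ η x y x j = σ i := by
  rw [Finset.prod_eq_single i]
  · have : η x y x i = 1 := by
      rcases h with rfl | rfl <;> simp [η]
    rw [this, pow_one]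
  · intro j _ hj
    have : η x y x j = 0 := by
      rcases h with rfl | rfl <;> simp [η, Pi.single_eq_of_ne hj]
    rw [this, pow_zero]
  · intro h
    exact absurd (Finset.mem_univ i) h

/-- Two steps in different directions do not backtrack. -/
theorem prod_pow_η_square {R : Type*} [CommRing R] (σ : Fin n → R) (x y u : Fin n → ℤ)
    {i j : Fin n} (hij : i ≠ j) {k l : ℤ} (h1 : x = y + Pi.single i k)
    (h2 : u = y + Pi.single j l) :
    ∏ m, σ m ^ η x y u m = 1 := by
  refine Finset.prod_eq_one fun m _ => ?_
  have : η x y u m = 0 := by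
    subst h1 h2
    by_cases hm : m = i
    · subst hm
      simp [η, Pi.single_eq_of_ne hij]
    · simp [η, Pi.single_eq_of_ne hm]
  rw [this, pow_zero]

/-- The value of a generator of `AlgA`. -/
def genAVal (K : Type*) [Field K] (b : Λ p lam → Wt t lam) : GenA (Λ p lam) → biEnd K b
  | .e x => cB K b x x
  | .up _ x y _ => cB K b y x
  | .down _ x y _ => cB K b x y

include hp hb in
/-- The products along the two ways from `u` to `x` around a square are equal. -/
theorem cB_square (x y u v : Λ p lam) {i j : Fin n} (hij : i ≠ j) {k l : ℤ}
    (h1 : x.1 = y.1 + Pi.single i k) (h2 : u.1 = y.1 + Pi.single j l)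
    (h3 : x.1 = v.1 + Pi.single j (-l)) (h4 : u.1 = v.1 + Pi.single i (-k)) :
    cB K b x y * cB K b y u = cB K b x v * cB K b v u := by
  rw [cB_mul hp hb, cB_mul hp hb, prod_pow_η_square _ _ _ _ hij h1 h2,
    prod_pow_η_square _ _ _ _ hij.symm h3 h4]

/-- The homomorphism from the algebra with the relations of `AlgA` to the endomorphisms. -/
def homA : RingQuot (RelA (Shat K t) (s K t) (Λ p lam)) →ₐ[Shat K t] biEnd K b :=
  RingQuot.liftAlgHom (Shat K t) ⟨FreeAlgebra.lift (Shat K t) (genAVal K b), by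
    intro f g h
    cases h with
    | idem x y =>
      rw [map_mul, FreeAlgebra.lift_ι_apply, FreeAlgebra.lift_ι_apply,
        apply_ite (FreeAlgebra.lift (Shat K t) (genAVal K b)), map_zero, FreeAlgebra.lift_ι_apply]
      exact cB_idem hp hb x y
    | up_left i x y h =>
      simp only [map_mul, FreeAlgebra.lift_ι_apply]
      exact cB_self_mul hp hb y x
    | up_right i x y h =>
      simp only [map_mul, FreeAlgebra.lift_ι_apply]
      exact cB_mul_self hp hb y x
    | down_left i x y h =>
      simp only [map_mul, FreeAlgebra.lift_ι_apply]
      exact cB_self_mul hp hb x y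
    | down_right i x y h =>
      simp only [map_mul, FreeAlgebra.lift_ι_apply]
      exact cB_mul_self hp hb x y
    | down_up i x y h =>
      simp only [map_mul, map_smul, FreeAlgebra.lift_ι_apply]
      refine (cB_mul hp hb x y x).trans ?_
      rw [prod_pow_η_return _ _ _ i (Or.inl h)]
      rfl
    | up_down i x y h =>
      simp only [map_mul, map_smul, FreeAlgebra.lift_ι_apply]
      refine (cB_mul hp hb y x y).trans ?_
      rw [prod_pow_η_return _ _ _ i (Or.inr h)]
      rfl
    | up_up i j hij x xi xj xij h₁ h₂ h₃ h₄ =>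
      simp only [map_mul, FreeAlgebra.lift_ι_apply]
      refine cB_square hp hb xij xi x xj hij.symm (k := 1) (l := -1) h₁ ?_ ?_ ?_
      · rw [h₂, Pi.single_neg, add_neg_cancel_right]
      · rw [neg_neg, h₃]
      · rw [h₄, Pi.single_neg, add_neg_cancel_right]
    | down_down i j hij x xi xj xij h₁ h₂ h₃ h₄ =>
      simp only [map_mul, FreeAlgebra.lift_ι_apply]
      refine cB_square hp hb x xj xij xi hij.symm (k := -1) (l := 1) ?_ h₂ ?_ ?_
      · rw [h₁, Pi.single_neg, add_neg_cancel_right]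
      · rw [h₃, Pi.single_neg, add_neg_cancel_right]
      · rw [neg_neg, h₄]
    | down_up_swap i j hij x xi xj xij h₁ h₂ h₃ h₄ =>
      simp only [map_mul, FreeAlgebra.lift_ι_apply]
      refine cB_square hp hb xi xij xj x hij.symm (k := -1) (l := -1) ?_ ?_ ?_ ?_
      · rw [h₁, Pi.single_neg, add_neg_cancel_right]
      · rw [h₂, Pi.single_neg, add_neg_cancel_right]
      · rw [neg_neg, h₃]
      · rw [neg_neg, h₄]⟩

theorem homA_gen (g : GenA (Λ p lam)) : homA hp hb (gen _ _ g) = genAVal K b g := by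
  unfold homA gen
  rw [RingQuot.liftAlgHom_mkAlgHom_apply, FreeAlgebra.lift_ι_apply]

theorem presentedHom_pgen {V X : Type*}
    {r : FreeAlgebra (Shat K t) X → FreeAlgebra (Shat K t) X → Prop} (b : V → Wt t lam)
    (L : RingQuot r →ₐ[Shat K t] biEnd K b) (x : X) :
    presentedHom b L (pgen _ r x) = biEndToEnd K b (L (gen _ r x)) := rfl

end Relations

/-! ### Chambers of a smooth periodic arrangement -/

section Geometry

variable {n : ℕ} {t : Submodule ℤ (Fin n → ℤ)} {lam : t →ₗ[ℤ] ℤ} {p : ℕ}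

/-- The restriction to `t` of the real point `a` of the character space of `D`. -/
def restr (t : Submodule ℤ (Fin n → ℤ)) (a : Fin n → ℝ) : t →ₗ[ℤ] ℝ where
  toFun χ := ∑ i, ((χ : Fin n → ℤ) i : ℝ) * a i
  map_add' χ χ' := by simp [add_mul, Finset.sum_add_distrib]
  map_smul' k χ := by simp [Finset.mul_sum, mul_assoc]

theorem continuous_restr : Continuous fun a : Fin n → ℝ => (⇑(restr t a) : t → ℝ) := by
  refine continuous_pi fun χ => ?_
  change Continuous fun a : Fin n → ℝ => ∑ i, ((χ : Fin n → ℤ) i : ℝ) * a i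
  fun_prop

theorem restr_add_smul (a v : Fin n → ℝ) (τ : ℝ) (χ : t) :
    restr t (fun i => a i + τ * v i) χ = restr t a χ + τ * restr t v χ := by
  change ∑ i : Fin n, _ = ∑ i : Fin n, _ + τ * ∑ i : Fin n, _
  rw [Finset.mul_sum, ← Finset.sum_add_distrib]
  exact Finset.sum_congr rfl fun i _ => by ring

/-- The real points of the coset of `λ`. -/
def OnCoset (lam : t →ₗ[ℤ] ℤ) (a : Fin n → ℝ) : Prop := ∀ χ, restr t a χ = lam χ

theorem OnCoset.segment {a a' : Fin n → ℝ} (ha : OnCoset lam a) (ha' : OnCoset lam a') (τ : ℝ) :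
    OnCoset lam fun i => a i + τ * (a' i - a i) := by
  intro χ
  have h : restr t (fun i => a' i - a i) χ = 0 := by
    have := restr_add_smul a' a (-1) χ
    rw [ha, ha'] at this
    simp only [neg_mul, one_mul, ← sub_eq_add_neg, sub_self] at this
    exact this
  rw [restr_add_smul a (fun i => a' i - a i), h, mul_zero, add_zero, ha]

theorem onCoset_of_Wt (a : Wt t lam) : OnCoset lam fun i => (a.1 i : ℝ) := by
  intro χ
  change ∑ i : Fin n, _ = _
  rw [← a.2 χ]
  push_cast
  rfl

/-- Moving the coset of a smooth `λ` slightly in a given direction does not change the set of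
chambers. -/
theorem Smooth.exists_pos (hs : Smooth p lam) {a : Fin n → ℝ} (ha : OnCoset lam a)
    (v : Fin n → ℝ) :
    ∃ ε : ℝ, 0 < ε ∧ ε < 1 ∧ Λ p lam = ΛR p (restr t fun i => a i + ε * v i) := by
  obtain ⟨U, hU, h⟩ := hs
  have h0 : Filter.Tendsto (fun ε : ℝ => (⇑(restr t fun i => a i + ε * v i) : t → ℝ)) (nhds 0)
      (nhds fun χ : t => (lam χ : ℝ)) := by
    have hc : Continuous fun ε : ℝ => (⇑(restr t fun i => a i + ε * v i) : t → ℝ) :=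
      continuous_restr.comp (by fun_prop)
    have := hc.tendsto 0
    have e : (⇑(restr t fun i => a i + 0 * v i) : t → ℝ) = fun χ : t => (lam χ : ℝ) := by
      funext χ
      rw [restr_add_smul, zero_mul, add_zero, ha]
    rwa [e] at this
  have h1 : ∀ᶠ ε : ℝ in nhdsWithin 0 (Set.Ioi 0),
      (⇑(restr t fun i => a i + ε * v i) : t → ℝ) ∈ U :=
    (h0.eventually hU).filter_mono nhdsWithin_le_nhds
  obtain ⟨ε, h2, h3⟩ := (h1.and (Ioo_mem_nhdsGT (zero_lt_one' ℝ))).exists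
  exact ⟨ε, h3.1, h3.2, h _ h2⟩

/-- A cube whose closure meets the coset is a chamber: the coset can be moved towards the centre of
the cube. -/
theorem Smooth.mem_Λ_of_closed (hs : Smooth p lam) (hp : 0 < p) {x : Fin n → ℤ} {a : Fin n → ℝ}
    (ha : OnCoset lam a) (hx : ∀ i, p * x i ≤ a i ∧ a i ≤ p * x i + p) : x ∈ Λ p lam := by
  obtain ⟨ε, h0, h1, h⟩ := hs.exists_pos ha fun i => p * x i + p / 2 - a i
  have hp' : (0 : ℝ) < p := Nat.cast_pos.2 hp
  rw [h]
  refine ⟨_, fun χ => rfl, fun i => ?_⟩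
  obtain ⟨h2, h3⟩ := hx i
  constructor <;> nlinarith

/-- The open cube of a chamber meets the coset. An integral point stays away from the upper walls,
and moving the coset gives a point that stays away from the lower walls. -/
theorem Smooth.exists_interior (hs : Smooth p lam) {x : Fin n → ℤ} (hx : x ∈ Λ p lam) :
    ∃ a, OnCoset lam a ∧ ∀ i, p * x i < a i ∧ a i < p * x i + p := by
  obtain ⟨b, hb⟩ := hx
  obtain ⟨ε, h0, h1, h⟩ := hs.exists_pos (onCoset_of_Wt b) fun _ => -1
  have hx : x ∈ Λ p lam := ⟨b, hb⟩
  rw [h] at hx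
  obtain ⟨a, ha, hxa⟩ := hx
  have ha' : OnCoset lam fun i => a i + ε * 1 := by
    intro χ
    have h2 := restr_add_smul (fun i => (b.1 i : ℝ)) (fun _ => -1) ε χ
    have h3 : restr t (fun _ => (-1 : ℝ)) χ = - restr t (fun _ => (1 : ℝ)) χ := by
      change ∑ i : Fin n, _ = -∑ i : Fin n, _
      simp
    rw [restr_add_smul a (fun _ => 1), ← onCoset_of_Wt b χ]
    have h4 : restr t a χ = _ := ha χ
    rw [h4, h2, h3]
    ring
  refine ⟨_, (onCoset_of_Wt b).segment ha' (1 / 2), fun i => ?_⟩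
  obtain ⟨h5, h6⟩ := hb i
  have h5' : (p * x i : ℝ) ≤ b.1 i := by exact_mod_cast h5
  have h6' : (b.1 i : ℝ) + 1 ≤ p * x i + p := by
    have : b.1 i + 1 ≤ p * x i + p := h6
    exact_mod_cast this
  obtain ⟨h7, h8⟩ := hxa i
  constructor <;> linarith

/-- The `i`-th coordinate of the wall of the cube `x` that separates it from `y` in the `i`-th
direction, for `x_i ≠ y_i`. -/
def wall (p : ℕ) (x y : Fin n → ℤ) (i : Fin n) : ℝ := if x i < y i then p * x i + p else p * x i

/-- The distance of `r` from the wall of `x` towards `y`. -/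
def wallDist (p : ℕ) (x y : Fin n → ℤ) (r : Fin n → ℝ) (i : Fin n) : ℝ :=
  (y i - x i).sign * (wall p x y i - r i)

/-- The distance of `r` from `q` in the direction from `x` to `y`. -/
def dirDist (x y : Fin n → ℤ) (r q : Fin n → ℝ) (i : Fin n) : ℝ := (y i - x i).sign * (q i - r i)

theorem sign_cases {x y : ℤ} (h : x ≠ y) :
    (x < y ∧ (y - x).sign = 1) ∨ (y < x ∧ (y - x).sign = -1) := by
  rcases lt_or_gt_of_ne h with h | h
  · exact Or.inl ⟨h, Int.sign_eq_one_of_pos (by omega)⟩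
  · exact Or.inr ⟨h, Int.sign_eq_neg_one_of_neg (by omega)⟩

theorem wallDist_nonneg {x y : Fin n → ℤ} {r : Fin n → ℝ} {i : Fin n}
    (hr : p * x i ≤ r i ∧ r i ≤ p * x i + p) (hi : x i ≠ y i) : 0 ≤ wallDist p x y r i := by
  unfold wallDist wall
  rcases sign_cases hi with ⟨h, h'⟩ | ⟨h, h'⟩
  · rw [if_pos h, h']
    push_cast
    linarith
  · rw [if_neg (by omega), h']
    push_cast
    linarith

theorem wallDist_lt_dirDist {x y : Fin n → ℤ} {r q : Fin n → ℝ} {i : Fin n}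
    (hq : p * y i < q i ∧ q i < p * y i + p) (hi : x i ≠ y i) :
    wallDist p x y r i < dirDist x y r q i := by
  unfold wallDist dirDist wall
  have hp : (0 : ℝ) ≤ p := Nat.cast_nonneg p
  rcases sign_cases hi with ⟨h, h'⟩ | ⟨h, h'⟩
  · have h1 : (x i : ℝ) + 1 ≤ y i := by exact_mod_cast h
    rw [if_pos h, h']
    push_cast
    nlinarith
  · have h1 : (y i : ℝ) + 1 ≤ x i := by exact_mod_cast h
    rw [if_neg (by omega), h']
    push_cast
    nlinarith

/-- Suppose that the segment from a point `r` of the closed cube `x` to a point `q` of the closed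
cube `y` does not leave the closed cube `x` before time `τ`. Then all cubes obtained from `x` by
crossing some of the walls on which the segment is at time `τ` are chambers. -/
theorem Smooth.mem_Λ_of_exit (hs : Smooth p lam) (hp : 0 < p) {x y : Fin n → ℤ} {r q : Fin n → ℝ}
    (hr : OnCoset lam r) (hq : OnCoset lam q)
    (hrx : ∀ i, p * x i ≤ r i ∧ r i ≤ p * x i + p)
    (hqy : ∀ i, p * y i ≤ q i ∧ q i ≤ p * y i + p) {τ : ℝ} (h0 : 0 ≤ τ) (h1 : τ ≤ 1)
    (hτ : ∀ i, x i ≠ y i → τ * dirDist x y r q i ≤ wallDist p x y r i)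
    {x' : Fin n → ℤ}
    (hx' : ∀ i, x' i = x i ∨ (x i ≠ y i ∧ x' i = x i + (y i - x i).sign ∧
      τ * dirDist x y r q i = wallDist p x y r i)) : x' ∈ Λ p lam := by
  refine hs.mem_Λ_of_closed hp (hr.segment hq τ) fun i => ?_
  obtain ⟨hr1, hr2⟩ := hrx i
  obtain ⟨hq1, hq2⟩ := hqy i
  have hp' : (0 : ℝ) < p := Nat.cast_pos.2 hp
  by_cases hi : x i = y i
  · have hxi : x' i = x i := (hx' i).resolve_right fun h => h.1 hi
    rw [hxi]
    rw [← hi] at hq1 hq2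
    constructor <;> nlinarith
  · have hτi := hτ i hi
    unfold dirDist wallDist wall at hτi hx'
    rcases sign_cases hi with ⟨h, h'⟩ | ⟨h, h'⟩
    · have hxy : (x i : ℝ) + 1 ≤ y i := by exact_mod_cast h
      have hpxy : (p : ℝ) * (x i + 1) ≤ p * y i := mul_le_mul_of_nonneg_left hxy hp'.le
      rw [if_pos h, h'] at hτi
      have hqr : 0 ≤ q i - r i := by linarith
      have := mul_nonneg h0 hqr
      rcases hx' i with hxi | ⟨-, hxi, he⟩
      · rw [hxi]
        push_cast at hτi
        constructor <;> linarith
      · rw [if_pos h, h'] at he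
        rw [hxi, h']
        push_cast at he ⊢
        constructor <;> linarith
    · have hxy : (y i : ℝ) + 1 ≤ x i := by exact_mod_cast h
      have hpxy : (p : ℝ) * (y i + 1) ≤ p * x i := mul_le_mul_of_nonneg_left hxy hp'.le
      rw [if_neg (by omega), h'] at hτi
      have hqr : 0 ≤ r i - q i := by linarith
      have := mul_nonneg h0 hqr
      rcases hx' i with hxi | ⟨-, hxi, he⟩
      · rw [hxi]
        push_cast at hτi
        constructor <;> linarith
      · rw [if_neg (by omega), h'] at he
        rw [hxi, h']
        push_cast at he ⊢
        constructor <;> linarith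

/-- The chamber obtained from `x` by crossing the wall towards `y` in the `i`-th direction. -/
def step (x y : Fin n → ℤ) (i : Fin n) : Fin n → ℤ := x + Pi.single i (y i - x i).sign

/-- The segment from `r` to `q` leaves the cube `x` through the wall in the `i`-th direction: the
quotient of `wallDist` by `dirDist`, which is the time at which the segment reaches the wall, is
minimal for `i`. The inequality of the quotients is multiplied out. -/
def IsExit (p : ℕ) (x y : Fin n → ℤ) (r q : Fin n → ℝ) (i : Fin n) : Prop :=
  x i ≠ y i ∧ ∀ l, x l ≠ y l →
    wallDist p x y r i * dirDist x y r q l ≤ wallDist p x y r l * dirDist x y r q i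

theorem exists_isExit {x y : Fin n → ℤ} (hxy : x ≠ y) {r q : Fin n → ℝ}
    (hrx : ∀ i, p * x i ≤ r i ∧ r i ≤ p * x i + p)
    (hqy : ∀ i, p * y i < q i ∧ q i < p * y i + p) : ∃ i, IsExit p x y r q i := by
  classical
  have hne : (Finset.univ.filter fun i => x i ≠ y i).Nonempty := by
    obtain ⟨i, hi⟩ := Function.ne_iff.1 hxy
    exact ⟨i, by simpa using hi⟩
  obtain ⟨i, hi, hmin⟩ := Finset.exists_min_image _
    (fun i => wallDist p x y r i / dirDist x y r q i) hne
  rw [Finset.mem_filter] at hi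
  refine ⟨i, hi.2, fun l hl => ?_⟩
  have hpos : ∀ k, x k ≠ y k → 0 < dirDist x y r q k := fun k hk =>
    (wallDist_nonneg (hrx k) hk).trans_lt (wallDist_lt_dirDist (hqy k) hk)
  have := hmin l (by simpa using hl)
  rwa [div_le_div_iff₀ (hpos i hi.2) (hpos l hl)] at this

/-- All the cubes obtained by crossing walls through which a segment leaves the cube `x` are
chambers. -/
theorem Smooth.mem_Λ_of_isExit (hs : Smooth p lam) (hp : 0 < p) {x y : Fin n → ℤ}
    {r q : Fin n → ℝ} (hr : OnCoset lam r) (hq : OnCoset lam q)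
    (hrx : ∀ i, p * x i ≤ r i ∧ r i ≤ p * x i + p)
    (hqy : ∀ i, p * y i < q i ∧ q i < p * y i + p) {k : Fin n} (hk : IsExit p x y r q k)
    {x' : Fin n → ℤ}
    (hx' : ∀ i, x' i = x i ∨ (IsExit p x y r q i ∧ x' i = x i + (y i - x i).sign)) :
    x' ∈ Λ p lam := by
  have hnn := fun i => wallDist_nonneg (y := y) (hrx i)
  have hlt := fun i (hi : x i ≠ y i) => wallDist_lt_dirDist (r := r) (hqy i) hi
  have hpos : 0 < dirDist x y r q k := (hnn k hk.1).trans_lt (hlt k hk.1)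
  refine hs.mem_Λ_of_exit hp hr hq hrx (fun i => ⟨(hqy i).1.le, (hqy i).2.le⟩)
    (τ := wallDist p x y r k / dirDist x y r q k) (div_nonneg (hnn k hk.1) hpos.le)
    ((div_le_one hpos).2 (hlt k hk.1).le) (fun i hi => ?_) (fun i => ?_)
  · rw [div_mul_eq_mul_div, div_le_iff₀ hpos]
    exact hk.2 i hi
  · refine (hx' i).imp id fun h => ⟨h.1.1, h.2, ?_⟩
    rw [div_mul_eq_mul_div, div_eq_iff hpos.ne']
    exact le_antisymm (hk.2 i h.1.1) (h.1.2 k hk.1)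

theorem step_apply_same (x y : Fin n → ℤ) (i : Fin n) : step x y i i = x i + (y i - x i).sign := by
  simp [step]

theorem step_apply_of_ne (x y : Fin n → ℤ) {i j : Fin n} (h : j ≠ i) : step x y i j = x j := by
  simp [step, Pi.single_eq_of_ne h]

theorem Smooth.step_mem_of_isExit (hs : Smooth p lam) (hp : 0 < p) {x y : Fin n → ℤ}
    {r q : Fin n → ℝ} (hr : OnCoset lam r) (hq : OnCoset lam q)
    (hrx : ∀ i, p * x i ≤ r i ∧ r i ≤ p * x i + p)
    (hqy : ∀ i, p * y i < q i ∧ q i < p * y i + p) {k : Fin n} (hk : IsExit p x y r q k) :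
    step x y k ∈ Λ p lam := by
  refine hs.mem_Λ_of_isExit hp hr hq hrx hqy hk fun i => ?_
  by_cases hi : i = k
  · subst hi
    exact Or.inr ⟨hk, step_apply_same x y i⟩
  · exact Or.inl (step_apply_of_ne x y hi)

/-- Any two chambers are connected by a path that crosses each wall at most once. -/
theorem Smooth.exists_step (hs : Smooth p lam) (hp : 0 < p) {x y : Fin n → ℤ} (hx : x ∈ Λ p lam)
    (hy : y ∈ Λ p lam) (hxy : x ≠ y) : ∃ i, x i ≠ y i ∧ step x y i ∈ Λ p lam := by
  obtain ⟨r, hr, hrx⟩ := hs.exists_interior hx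
  obtain ⟨q, hq, hqy⟩ := hs.exists_interior hy
  have hrx' : ∀ i, p * x i ≤ r i ∧ r i ≤ p * x i + p := fun i => ⟨(hrx i).1.le, (hrx i).2.le⟩
  obtain ⟨i, hi⟩ := exists_isExit hxy hrx' hqy
  exact ⟨i, hi.1, hs.step_mem_of_isExit hp hr hq hrx' hqy hi⟩

/-- A point in the relative interior of the wall between two adjacent chambers. -/
theorem Smooth.exists_mem_wall (hs : Smooth p lam) {x y : Fin n → ℤ} (hx : x ∈ Λ p lam)
    {i : Fin n} (hi : x i ≠ y i) (hxi : step x y i ∈ Λ p lam) :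
    ∃ r, OnCoset lam r ∧ r i = wall p x y i ∧ ∀ j ≠ i, p * x j < r j ∧ r j < p * x j + p := by
  obtain ⟨a, ha, hax⟩ := hs.exists_interior hx
  obtain ⟨a', ha', hax'⟩ := hs.exists_interior hxi
  have key : ∃ τ : ℝ, 0 ≤ τ ∧ τ ≤ 1 ∧ a i + τ * (a' i - a i) = wall p x y i := by
    have h1 := hax i
    have h2 := hax' i
    rw [step_apply_same] at h2
    have hmem : wall p x y i ∈ Set.uIcc (a i) (a' i) := by
      unfold wall
      rcases sign_cases hi with ⟨h, h'⟩ | ⟨h, h'⟩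
      · rw [if_pos h]
        rw [h'] at h2
        push_cast at h2
        exact Set.mem_uIcc_of_le h1.2.le (by linarith)
      · rw [if_neg (by omega)]
        rw [h'] at h2
        push_cast at h2
        exact Set.mem_uIcc_of_ge (by linarith) h1.1.le
    rw [← segment_eq_uIcc, segment_eq_image'] at hmem
    obtain ⟨τ, hτ, h⟩ := hmem
    exact ⟨τ, hτ.1, hτ.2, h⟩
  obtain ⟨τ, h0, h1, h⟩ := key
  refine ⟨_, ha.segment ha' τ, h, fun j hj => ?_⟩
  obtain ⟨h2, h3⟩ := hax j
  obtain ⟨h4, h5⟩ := hax' j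
  rw [step_apply_of_ne x y hj] at h4 h5
  rcases eq_or_lt_of_le h0 with rfl | h0
  · constructor <;> linarith
  · constructor <;> nlinarith

theorem wall_mem_closed (p : ℕ) (x y : Fin n → ℤ) (i : Fin n) :
    p * x i ≤ wall p x y i ∧ wall p x y i ≤ p * x i + p := by
  have : (0 : ℝ) ≤ p := Nat.cast_nonneg p
  unfold wall
  split_ifs <;> constructor <;> linarith

/-- If the point `r` is in the relative interior of a wall, then a segment starting at `r` leaves
through this wall only. -/
theorem isExit_iff_of_mem_wall {x y : Fin n → ℤ} {r q : Fin n → ℝ} {i : Fin n} (hi : x i ≠ y i)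
    (hri : r i = wall p x y i) (hr : ∀ j ≠ i, p * x j < r j ∧ r j < p * x j + p)
    (hqy : ∀ i, p * y i < q i ∧ q i < p * y i + p) {k : Fin n} :
    IsExit p x y r q k ↔ k = i := by
  have hrx : ∀ j, p * x j ≤ r j ∧ r j ≤ p * x j + p := by
    intro j
    by_cases hj : j = i
    · subst hj
      rw [hri]
      exact wall_mem_closed p x y j
    · exact ⟨(hr j hj).1.le, (hr j hj).2.le⟩
  have hz : wallDist p x y r i = 0 := by rw [wallDist, hri, sub_self, mul_zero]
  have hpos : ∀ k, x k ≠ y k → 0 < dirDist x y r q k := fun k hk =>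
    (wallDist_nonneg (hrx k) hk).trans_lt (wallDist_lt_dirDist (hqy k) hk)
  constructor
  · rintro ⟨hk, h⟩
    by_contra hki
    have h1 := h i hi
    rw [hz, zero_mul] at h1
    have h2 : 0 < wallDist p x y r k := by
      obtain ⟨h3, h4⟩ := hr k hki
      unfold wallDist wall
      rcases sign_cases hk with ⟨h, h'⟩ | ⟨h, h'⟩
      · rw [if_pos h, h']
        push_cast
        linarith
      · rw [if_neg (by omega), h']
        push_cast
        linarith
    exact absurd h1 (not_le.2 (mul_pos h2 (hpos i hi)))
  · rintro rfl
    refine ⟨hi, fun l hl => ?_⟩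
    rw [hz, zero_mul]
    exact mul_nonneg (wallDist_nonneg (hrx l) hl) (hpos k hi).le

/-- Two first steps on shortest paths from `x` to `y` are connected by a sequence of first steps in
which consecutive ones are adjacent to a common chamber at distance two from `x`. The steps in the
sequence are those through which the segments to a fixed point leave the cube `x`, when the starting
point moves from one wall to the other; by connectedness of `[0, 1]` there is no gap. -/
theorem Smooth.steps_connected (hs : Smooth p lam) (hp : 0 < p) {x y : Fin n → ℤ}
    (hx : x ∈ Λ p lam) (hy : y ∈ Λ p lam) {i j : Fin n} (hi : x i ≠ y i) (hj : x j ≠ y j)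
    (hxi : step x y i ∈ Λ p lam) (hxj : step x y j ∈ Λ p lam) (T : Set (Fin n))
    (hT : ∀ k l, k ≠ l → x k ≠ y k → x l ≠ y l → step x y k ∈ Λ p lam → step x y l ∈ Λ p lam →
      step x y k + Pi.single l (y l - x l).sign ∈ Λ p lam → k ∈ T → l ∈ T) (hiT : i ∈ T) :
    j ∈ T := by
  obtain ⟨ri, hri, hrii, hrix⟩ := hs.exists_mem_wall hx hi hxi
  obtain ⟨rj, hrj, hrjj, hrjx⟩ := hs.exists_mem_wall hx hj hxj
  obtain ⟨q, hq, hqy⟩ := hs.exists_interior hy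
  set r : ℝ → Fin n → ℝ := fun τ m => ri m + τ * (rj m - ri m) with hrdef
  have hcl : ∀ {i : Fin n} {r : Fin n → ℝ}, r i = wall p x y i →
      (∀ j ≠ i, p * x j < r j ∧ r j < p * x j + p) → ∀ j, p * x j ≤ r j ∧ r j ≤ p * x j + p := by
    intro i r h1 h2 j
    by_cases hj : j = i
    · subst hj
      rw [h1]
      exact wall_mem_closed p x y j
    · exact ⟨(h2 j hj).1.le, (h2 j hj).2.le⟩
  have hr : ∀ τ ∈ Set.Icc (0 : ℝ) 1, ∀ m, p * x m ≤ r τ m ∧ r τ m ≤ p * x m + p := by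
    intro τ hτ m
    obtain ⟨h1, h2⟩ := hcl hrii hrix m
    obtain ⟨h3, h4⟩ := hcl hrjj hrjx m
    obtain ⟨h5, h6⟩ := hτ
    constructor <;> simp only [hrdef] <;> nlinarith
  have hclosed : ∀ A : Set (Fin n), IsClosed {τ | ∃ k ∈ A, IsExit p x y (r τ) q k} := by
    intro A
    have h1 : {τ | ∃ k ∈ A, IsExit p x y (r τ) q k} =
        ⋃ k ∈ A, {τ | IsExit p x y (r τ) q k} := by
      ext τ
      simp
    rw [h1]
    refine Set.Finite.isClosed_biUnion (Set.toFinite A) fun k _ => ?_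
    have h2 : {τ | IsExit p x y (r τ) q k} = {_τ | x k ≠ y k} ∩ ⋂ l, ⋂ (_ : x l ≠ y l),
        {τ | wallDist p x y (r τ) k * dirDist x y (r τ) q l ≤
          wallDist p x y (r τ) l * dirDist x y (r τ) q k} := by
      ext τ
      simp [IsExit]
    rw [h2]
    refine isClosed_const.inter (isClosed_iInter fun l => isClosed_iInter fun _ =>
      isClosed_le ?_ ?_)
    · simp only [wallDist, dirDist, hrdef]
      fun_prop
    · simp only [wallDist, dirDist, hrdef]
      fun_prop
  -- Otherwise the closed sets of times at which the segment leaves through a wall in `T`,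
  -- respectively not in `T`, cover the interval, and they meet in some `τ`.
  by_contra hjT
  have hxy : x ≠ y := fun h => hi (congrFun h i)
  have hr0 : r 0 = ri := by
    funext m
    simp [hrdef]
  have hr1 : r 1 = rj := by
    funext m
    simp [hrdef]
  obtain ⟨τ, hτ, ⟨k, hk, hkE⟩, ⟨l, hl, hlE⟩⟩ := isPreconnected_closed_iff.1
    (isPreconnected_Icc (a := (0 : ℝ)) (b := 1)) _ _ (hclosed T) (hclosed Tᶜ)
    (fun τ hτ => by
      obtain ⟨k, hk⟩ := exists_isExit hxy (hr τ hτ) hqy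
      by_cases hkT : k ∈ T
      · exact Or.inl ⟨k, hkT, hk⟩
      · exact Or.inr ⟨k, hkT, hk⟩)
    ⟨0, Set.left_mem_Icc.2 zero_le_one, i, hiT, by
      rw [hr0]
      exact (isExit_iff_of_mem_wall hi hrii hrix hqy).2 rfl⟩
    ⟨1, Set.right_mem_Icc.2 zero_le_one, j, hjT, by
      rw [hr1]
      exact (isExit_iff_of_mem_wall hj hrjj hrjx hqy).2 rfl⟩
  have hon : OnCoset lam (r τ) := hri.segment hrj τ
  have hkl : k ≠ l := fun h => hl (h ▸ hk)
  refine hl (hT k l hkl hkE.1 hlE.1 (hs.step_mem_of_isExit hp hon hq (hr τ hτ) hqy hkE)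
    (hs.step_mem_of_isExit hp hon hq (hr τ hτ) hqy hlE) ?_ hk)
  refine hs.mem_Λ_of_isExit hp hon hq (hr τ hτ) hqy hkE fun m => ?_
  by_cases hmk : m = k
  · subst hmk
    refine Or.inr ⟨hkE, ?_⟩
    rw [Pi.add_apply, step_apply_same, Pi.single_eq_of_ne hkl, add_zero]
  · rw [Pi.add_apply, step_apply_of_ne x y hmk]
    by_cases hml : m = l
    · subst hml
      exact Or.inr ⟨hlE, by rw [Pi.single_eq_same]⟩
    · exact Or.inl (by rw [Pi.single_eq_of_ne hml, add_zero])

end Geometry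

/-! ### Shortest paths in the `A`-algebra -/

section Taut

variable {n : ℕ}

/-- The set of chambers `V` has enough shortest paths: any two chambers are connected by a path that
crosses each wall at most once, and the first steps of two such paths are connected by squares. -/
structure TautConnected (V : Set (Fin n → ℤ)) : Prop where
  exists_step : ∀ x ∈ V, ∀ y ∈ V, x ≠ y → ∃ i, x i ≠ y i ∧ step x y i ∈ V
  connected : ∀ x ∈ V, ∀ y ∈ V, ∀ i j, x i ≠ y i → x j ≠ y j → step x y i ∈ V → step x y j ∈ V →
    ∀ T : Set (Fin n), (∀ k l, k ≠ l → x k ≠ y k → x l ≠ y l → step x y k ∈ V → step x y l ∈ V →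
      step x y k + Pi.single l (y l - x l).sign ∈ V → k ∈ T → l ∈ T) → i ∈ T → j ∈ T

theorem Smooth.tautConnected {t : Submodule ℤ (Fin n → ℤ)} {lam : t →ₗ[ℤ] ℤ} {p : ℕ}
    (hs : Smooth p lam) (hp : 0 < p) : TautConnected (Λ p lam) where
  exists_step _ hx _ hy hxy := hs.exists_step hp hx hy hxy
  connected _ hx _ hy _ _ hi hj hxi hxj T hT hiT :=
    hs.steps_connected hp hx hy hi hj hxi hxj T hT hiT

/-- The number of walls between two chambers. -/
def numWalls (x y : Fin n → ℤ) : ℕ := ∑ i, (x i - y i).natAbs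

theorem numWalls_step_lt {x y : Fin n → ℤ} {i : Fin n} (hi : x i ≠ y i) :
    numWalls (step x y i) y < numWalls x y := by
  refine Finset.sum_lt_sum (fun j _ => ?_) ⟨i, Finset.mem_univ i, ?_⟩
  · by_cases hj : j = i
    · subst hj
      rw [step_apply_same]
      rcases sign_cases hi with ⟨h, h'⟩ | ⟨h, h'⟩ <;> omega
    · rw [step_apply_of_ne x y hj]
  · rw [step_apply_same]
    rcases sign_cases hi with ⟨h, h'⟩ | ⟨h, h'⟩ <;> omega

variable {R : Type*} [CommRing R] {σ : Fin n → R} {V : Set (Fin n → ℤ)}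

open Classical in
/-- The arrow from `x` to `y`, if these chambers are separated by a single wall of type `i`, and
zero otherwise. -/
def arr (σ : Fin n → R) (i : Fin n) (y x : V) : RingQuot (RelA R σ V) :=
  if h : y.1 = x.1 + Pi.single i 1 then gen R _ (.up i x y h)
  else if h : x.1 = y.1 + Pi.single i 1 then gen R _ (.down i y x h) else 0

/-- The chambers `x` and `y` are separated by a single wall, of type `i`. -/
def Adjacent (i : Fin n) (y x : V) : Prop :=
  y.1 = x.1 + Pi.single i 1 ∨ x.1 = y.1 + Pi.single i 1

theorem Adjacent.symm {i : Fin n} {x y : V} (h : Adjacent i y x) : Adjacent i x y := Or.symm h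

theorem arr_up {i : Fin n} {x y : V} (h : y.1 = x.1 + Pi.single i 1) :
    arr σ i y x = gen R _ (.up i x y h) := dif_pos h

theorem arr_down {i : Fin n} {x y : V} (h : x.1 = y.1 + Pi.single i 1) :
    arr σ i y x = gen R _ (.down i y x h) := by
  have h' : ¬ y.1 = x.1 + Pi.single i 1 := by
    intro h'
    have h1 := congrFun h i
    have h2 := congrFun h' i
    simp only [Pi.add_apply, Pi.single_eq_same] at h1 h2
    omega
  rw [arr, dif_neg h', dif_pos h]

/-- The idempotent of the chamber `x`. -/
abbrev idem (σ : Fin n → R) (x : V) : RingQuot (RelA R σ V) := gen R (RelA R σ V) (.e x)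

theorem idem_mul_idem (x : V) : idem σ x * idem σ x = idem σ x := by
  have h := gen_rel (RelA.idem (R := R) (s := σ) x x)
  rwa [if_pos rfl, map_mul] at h

theorem idem_mul_idem_of_ne {x y : V} (hxy : x ≠ y) : idem σ x * idem σ y = 0 := by
  have h := gen_rel (RelA.idem (R := R) (s := σ) x y)
  rwa [if_neg hxy, map_mul, map_zero] at h

theorem idem_mul_arr {i : Fin n} {x y : V} (h : Adjacent i y x) :
    idem σ y * arr σ i y x = arr σ i y x := by
  rcases h with h | h
  · have h' := gen_rel (RelA.up_left (R := R) (s := σ) i x y h)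
    rw [map_mul] at h'
    rw [arr_up h]
    exact h'
  · have h' := gen_rel (RelA.down_left (R := R) (s := σ) i y x h)
    rw [map_mul] at h'
    rw [arr_down h]
    exact h'

theorem arr_mul_idem {i : Fin n} {x y : V} (h : Adjacent i y x) :
    arr σ i y x * idem σ x = arr σ i y x := by
  rcases h with h | h
  · have h' := gen_rel (RelA.up_right (R := R) (s := σ) i x y h)
    rw [map_mul] at h'
    rw [arr_up h]
    exact h'
  · have h' := gen_rel (RelA.down_right (R := R) (s := σ) i y x h)
    rw [map_mul] at h'
    rw [arr_down h]
    exact h'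

theorem arr_mul_arr {i : Fin n} {x y : V} (h : Adjacent i y x) :
    arr σ i x y * arr σ i y x = σ i • idem σ x := by
  rcases h with h | h
  · have h' := gen_rel (RelA.down_up (R := R) (s := σ) i x y h)
    rw [map_mul, map_smul] at h'
    rw [arr_up h, arr_down h]
    exact h'
  · have h' := gen_rel (RelA.up_down (R := R) (s := σ) i y x h)
    rw [map_mul, map_smul] at h'
    rw [arr_up h, arr_down h]
    exact h'

/-- The relations around a codimension two stratum, in a form that does not distinguish the
directions. -/
theorem arr_square {i j : Fin n} (hij : i ≠ j) {x xi xj z : V} {k l : ℤ} (hk : k = 1 ∨ k = -1)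
    (hl : l = 1 ∨ l = -1) (h1 : xi.1 = x.1 + Pi.single i k) (h2 : xj.1 = x.1 + Pi.single j l)
    (h3 : z.1 = xi.1 + Pi.single j l) :
    arr σ j z xi * arr σ i xi x = arr σ i z xj * arr σ j xj x := by
  have h4 : z.1 = xj.1 + Pi.single i k := by
    rw [h3, h1, h2, add_right_comm]
  have flip : ∀ {u v : V} {m : Fin n}, u.1 = v.1 + Pi.single m (-1) →
      v.1 = u.1 + Pi.single m 1 := by
    intro u v m h
    rw [h, Pi.single_neg, neg_add_cancel_right]
  rcases hk with rfl | rfl <;> rcases hl with rfl | rfl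
  · have h := gen_rel (RelA.up_up (R := R) (s := σ) i j hij x xi xj z h3 h1 h4 h2)
    rw [map_mul, map_mul] at h
    rw [arr_up h3, arr_up h1, arr_up h4, arr_up h2]
    exact h
  · have h := gen_rel (RelA.down_up_swap (R := R) (s := σ) i j hij xj z x xi (flip h3) h1 h4
      (flip h2))
    rw [map_mul, map_mul] at h
    rw [arr_down (flip h3), arr_up h1, arr_up h4, arr_down (flip h2)]
    exact h
  · have h := gen_rel (RelA.down_up_swap (R := R) (s := σ) j i hij.symm xi z x xj (flip h4) h2 h3
      (flip h1))
    rw [map_mul, map_mul] at h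
    rw [arr_down (flip h4), arr_up h2, arr_up h3, arr_down (flip h1)]
    exact h.symm
  · have h := gen_rel (RelA.down_down (R := R) (s := σ) i j hij z xj xi x (flip h3) (flip h1)
      (flip h4) (flip h2))
    rw [map_mul, map_mul] at h
    rw [arr_down (flip h3), arr_down (flip h1), arr_down (flip h4), arr_down (flip h2)]
    exact h

/-- `IsTaut σ x y w` says that `w` is the class of a path from `y` to `x` that crosses each wall at
most once. -/
inductive IsTaut (σ : Fin n → R) : V → V → RingQuot (RelA R σ V) → Prop
  | refl (x : V) : IsTaut σ x x (idem σ x)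
  | cons {x y x' : V} {i : Fin n} {w : RingQuot (RelA R σ V)} (hi : x.1 i ≠ y.1 i)
      (hx' : x'.1 = step x.1 y.1 i) (hw : IsTaut σ x' y w) : IsTaut σ x y (arr σ i x x' * w)

theorem sign_eq {a b : ℤ} (h : a ≠ b) : (b - a).sign = 1 ∨ (b - a).sign = -1 := by
  rcases sign_cases h with h | h
  · exact Or.inl h.2
  · exact Or.inr h.2

theorem adjacent_of_step {x y x' : V} {i : Fin n} (hi : x.1 i ≠ y.1 i)
    (hx' : x'.1 = step x.1 y.1 i) : Adjacent i x x' := by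
  rcases sign_eq hi with h | h
  · exact Or.inr (by rw [hx', step, h])
  · exact Or.inl (by rw [hx', step, h, Pi.single_neg, neg_add_cancel_right])

/-- For two adjacent chambers and a third one, one of the former is a step away from the other
towards the third. -/
theorem Adjacent.step_or_step {x y : V} {i : Fin n} (h : Adjacent i y x) (u : V) :
    (x.1 i ≠ u.1 i ∧ y.1 = step x.1 u.1 i) ∨ (y.1 i ≠ u.1 i ∧ x.1 = step y.1 u.1 i) := by
  have key : ∀ {x y : Fin n → ℤ}, y = x + Pi.single i 1 →
      (x i ≠ u.1 i ∧ y = step x u.1 i) ∨ (y i ≠ u.1 i ∧ x = step y u.1 i) := by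
    rintro x y rfl
    rcases lt_or_ge (x i) (u.1 i) with h | h
    · refine Or.inl ⟨h.ne, ?_⟩
      rw [step, Int.sign_eq_one_of_pos (by omega)]
    · have hy : (x + Pi.single i 1 : Fin n → ℤ) i = x i + 1 := by simp
      refine Or.inr ⟨by omega, ?_⟩
      rw [step, hy, Int.sign_eq_neg_one_of_neg (by omega), Pi.single_neg, add_neg_cancel_right]
  rcases h with h | h
  · exact key h
  · exact (key h).symm

theorem IsTaut.idem_mul {x y : V} {w : RingQuot (RelA R σ V)} (hw : IsTaut σ x y w) :
    idem σ x * w = w := by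
  cases hw with
  | refl => exact idem_mul_idem x
  | cons hi hx' hw => rw [← mul_assoc, idem_mul_arr (adjacent_of_step hi hx')]

theorem IsTaut.mem_presented {x y : V} {w : RingQuot (RelA R σ V)} (hw : IsTaut σ x y w) :
    w ∈ AlgA R σ V := by
  induction hw with
  | refl x => exact NonUnitalAlgebra.subset_adjoin R ⟨_, rfl⟩
  | cons hi hx' hw ih =>
    refine mul_mem ?_ ih
    rcases adjacent_of_step hi hx' with h | h
    · rw [arr_up h]
      exact NonUnitalAlgebra.subset_adjoin R ⟨_, rfl⟩
    · rw [arr_down h]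
      exact NonUnitalAlgebra.subset_adjoin R ⟨_, rfl⟩

theorem TautConnected.exists_isTaut (hV : TautConnected V) (σ : Fin n → R) (x y : V) :
    ∃ w, IsTaut σ x y w := by
  induction hd : numWalls x.1 y.1 using Nat.strong_induction_on generalizing x with
  | _ d ih =>
    by_cases hxy : x = y
    · subst hxy
      exact ⟨_, .refl x⟩
    · obtain ⟨i, hi, hx'⟩ := hV.exists_step x.1 x.2 y.1 y.2 fun h => hxy (Subtype.ext h)
      obtain ⟨w, hw⟩ := ih _ (hd ▸ numWalls_step_lt hi) ⟨_, hx'⟩ rfl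
      exact ⟨_, .cons hi rfl hw⟩

/-- All shortest paths between two chambers are equal in the `A`-algebra. -/
theorem TautConnected.isTaut_unique (hV : TautConnected V) {x y : V} {w w' : RingQuot (RelA R σ V)}
    (hw : IsTaut σ x y w) (hw' : IsTaut σ x y w') : w = w' := by
  induction hd : numWalls x.1 y.1 using Nat.strong_induction_on generalizing x w w' with
  | _ d ih =>
    subst hd
    cases hw with
    | refl =>
      cases hw' with
      | refl => rfl
      | cons hj => exact absurd rfl hj
    | @cons _ _ xi i w hi hxi hw =>
      cases hw' with
      | refl => exact absurd rfl hi
      | @cons _ _ xj j w' hj hxj hw' =>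
        refine hV.connected x.1 x.2 y.1 y.2 i j hi hj (hxi ▸ xi.2) (hxj ▸ xj.2)
          {k | ∀ (x' : V) (v : RingQuot (RelA R σ V)), x'.1 = step x.1 y.1 k → IsTaut σ x' y v →
            arr σ i x xi * w = arr σ k x x' * v} ?_ ?_ xj w' hxj hw'
        -- Both paths can be continued through the chamber opposite to `x` in the square.
        · intro k l hkl hk hl hxk hxl hz hkT xl v hxl' hv
          obtain ⟨u, hu⟩ := hV.exists_isTaut σ ⟨_, hz⟩ y
          have hk' : step x.1 y.1 l k = x.1 k := step_apply_of_ne _ _ hkl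
          have hl' : step x.1 y.1 k l = x.1 l := step_apply_of_ne _ _ hkl.symm
          have h1 : IsTaut σ ⟨_, hxk⟩ y (arr σ l ⟨_, hxk⟩ ⟨_, hz⟩ * u) := by
            refine .cons (fun h => hl (hl'.symm.trans h)) ?_ hu
            change step x.1 y.1 k + _ = step x.1 y.1 k + Pi.single l (y.1 l - step x.1 y.1 k l).sign
            rw [hl']
          have h2 : IsTaut σ xl y (arr σ k xl ⟨_, hz⟩ * u) := by
            refine .cons (by rw [hxl', hk']; exact hk) ?_ hu
            rw [hxl']
            change step x.1 y.1 k + _ = step x.1 y.1 l + Pi.single k (y.1 k - step x.1 y.1 l k).sign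
            rw [hk', step, step, add_right_comm]
          have hlt : numWalls xl.1 y.1 < numWalls x.1 y.1 := by
            rw [hxl']
            exact numWalls_step_lt hl
          rw [hkT _ _ rfl h1, ih _ hlt hv h2 rfl, ← mul_assoc, ← mul_assoc]
          congr 1
          have neg : ∀ {m : Fin n}, x.1 m ≠ y.1 m →
              -(y.1 m - x.1 m).sign = 1 ∨ -(y.1 m - x.1 m).sign = -1 := by
            intro m hm
            rcases sign_eq hm with h | h <;> rw [h] <;> simp
          refine arr_square hkl.symm (neg hl) (neg hk) ?_ ?_ ?_
          · change step x.1 y.1 k = step x.1 y.1 k + _ + _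
            rw [Pi.single_neg, add_neg_cancel_right]
          · rw [hxl']
            change step x.1 y.1 l = step x.1 y.1 k + _ + _
            rw [step, Pi.single_neg, step, add_right_comm, add_neg_cancel_right]
          · change x.1 = step x.1 y.1 k + _
            rw [step, Pi.single_neg, add_neg_cancel_right]
        · intro x' v hx' hv
          obtain rfl : x' = xi := Subtype.ext (hx'.trans hxi.symm)
          have hlt : numWalls x'.1 y.1 < numWalls x.1 y.1 := by
            rw [hxi]
            exact numWalls_step_lt hi
          rw [ih _ hlt hw hv rfl]

/-- The class of the shortest paths from `y` to `x`. -/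
def taut (hV : TautConnected V) (σ : Fin n → R) (x y : V) : RingQuot (RelA R σ V) :=
  (hV.exists_isTaut σ x y).choose

theorem isTaut_taut (hV : TautConnected V) (σ : Fin n → R) (x y : V) :
    IsTaut σ x y (taut hV σ x y) := (hV.exists_isTaut σ x y).choose_spec

theorem IsTaut.eq_taut {x y : V} {w : RingQuot (RelA R σ V)} (hw : IsTaut σ x y w)
    (hV : TautConnected V) : w = taut hV σ x y := hV.isTaut_unique hw (isTaut_taut hV σ x y)

/-- An arrow and a shortest path compose to a shortest path or, if the arrow crosses a wall that was
crossed by the path, to `s_i` times a shortest path. -/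
theorem arr_mul_taut (hV : TautConnected V) {i : Fin n} {x' x : V} (h : Adjacent i x' x) (y : V) :
    arr σ i x' x * taut hV σ x y = taut hV σ x' y ∨
      arr σ i x' x * taut hV σ x y = σ i • taut hV σ x' y := by
  rcases h.step_or_step y with ⟨hi, hx'⟩ | ⟨hi, hx⟩
  · right
    rw [← (IsTaut.cons hi hx' (isTaut_taut hV σ x' y)).eq_taut hV, ← mul_assoc,
      arr_mul_arr h.symm, smul_mul_assoc, (isTaut_taut hV σ x' y).idem_mul]
  · left
    exact (IsTaut.cons hi hx (isTaut_taut hV σ x y)).eq_taut hV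

/-- The `A`-algebra is spanned by the classes of the shortest paths. -/
theorem mem_span_of_mem_AlgA (hV : TautConnected V) {w : RingQuot (RelA R σ V)}
    (hw : w ∈ AlgA R σ V) :
    w ∈ Submodule.span R (Set.range fun xy : V × V => taut hV σ xy.1 xy.2) := by
  classical
  set N := Submodule.span R (Set.range fun xy : V × V => taut hV σ xy.1 xy.2)
  have hc : ∀ x y, taut hV σ x y ∈ N := fun x y => Submodule.subset_span ⟨(x, y), rfl⟩
  have he : ∀ x, idem σ x ∈ N := fun x => by
    rw [(IsTaut.refl x).eq_taut hV]
    exact hc x x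
  have he_mul : ∀ x u v, idem σ x * taut hV σ u v ∈ N := by
    intro x u v
    by_cases h : x = u
    · subst h
      rw [(isTaut_taut hV σ x v).idem_mul]
      exact hc x v
    · rw [← (isTaut_taut hV σ u v).idem_mul, ← mul_assoc, idem_mul_idem_of_ne h, zero_mul]
      exact zero_mem _
  have harr_mul : ∀ {i : Fin n} {x' x : V}, Adjacent i x' x → ∀ u v,
      arr σ i x' x * taut hV σ u v ∈ N := by
    intro i x' x h u v
    by_cases hu : x = u
    · subst hu
      rcases arr_mul_taut (σ := σ) hV h v with h' | h' <;> rw [h']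
      · exact hc x' v
      · exact Submodule.smul_mem _ _ (hc x' v)
    · rw [← arr_mul_idem h, mul_assoc, ← (isTaut_taut hV σ u v).idem_mul, ← mul_assoc (idem σ x),
        idem_mul_idem_of_ne hu, zero_mul, mul_zero]
      exact zero_mem _
  have harr : ∀ {i : Fin n} {x' x : V}, Adjacent i x' x → arr σ i x' x ∈ N := by
    intro i x' x h
    rw [← arr_mul_idem h, (IsTaut.refl x).eq_taut hV]
    exact harr_mul h x x
  have hgen : ∀ g u v, gen R (RelA R σ V) g * taut hV σ u v ∈ N := by
    rintro (x | ⟨i, x, y, h⟩ | ⟨i, x, y, h⟩) u v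
    · exact he_mul x u v
    · rw [← arr_up h]
      exact harr_mul (Or.inl h) u v
    · rw [← arr_down h]
      exact harr_mul (Or.inr h) u v
  refine presented_le_of_gen_mul_mem N ?_ (fun g w hw => ?_) hw
  · rintro (x | ⟨i, x, y, h⟩ | ⟨i, x, y, h⟩)
    · exact he x
    · rw [← arr_up h]
      exact harr (Or.inl h)
    · rw [← arr_down h]
      exact harr (Or.inr h)
  · induction hw using Submodule.span_induction with
    | mem w hw =>
      obtain ⟨⟨u, v⟩, rfl⟩ := hw
      exact hgen g u v
    | zero =>
      rw [mul_zero]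
      exact zero_mem _
    | add w w' _ _ h h' =>
      rw [mul_add]
      exact add_mem h h'
    | smul a w _ h =>
      rw [mul_smul_comm]
      exact Submodule.smul_mem _ _ h

end Taut

section Image

variable {n : ℕ} {K : Type*} [Field K] {t : Submodule ℤ (Fin n → ℤ)} {lam : t →ₗ[ℤ] ℤ}
  {p : ℕ} [CharP K p]

theorem prod_pow_η_step {R : Type*} [CommRing R] (σ : Fin n → R) {x y : Fin n → ℤ} {i : Fin n}
    (hi : x i ≠ y i) : ∏ m, σ m ^ η x (step x y i) y m = 1 := by
  refine Finset.prod_eq_one fun m _ => ?_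
  have : η x (step x y i) y m = 0 := by
    unfold η
    by_cases hm : m = i
    · subst hm
      rw [step_apply_same]
      rcases sign_cases hi with ⟨h, h'⟩ | ⟨h, h'⟩ <;> rw [h'] <;> omega
    · rw [step_apply_of_ne x y hm]
      omega
  rw [this, pow_zero]

/-- The shortest paths from `y` to `x` are sent to `c_{x,y}`. -/
theorem IsTaut.homA_eq (hp : p.Prime) {b : Λ p lam → Wt t lam}
    (hb : ∀ x : Λ p lam, b x ∈ Δ p lam x) {x y : Λ p lam}
    {w : RingQuot (RelA (Shat K t) (s K t) (Λ p lam))} (hw : IsTaut (s K t) x y w) :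
    homA hp hb w = cB K b x y := by
  induction hw with
  | refl x => exact homA_gen hp hb _
  | @cons x y x' i w hi hx' hw ih =>
    have h1 : homA hp hb (arr (s K t) i x x') = cB K b x x' := by
      rcases adjacent_of_step hi hx' with h | h
      · rw [arr_up h]
        exact homA_gen hp hb _
      · rw [arr_down h]
        exact homA_gen hp hb _
    rw [map_mul, ih, h1, cB_mul hp hb, hx', prod_pow_η_step _ hi, one_smul]

end Image

end Hypertoric

theorem mainTheorem9 {p : ℕ} (hp : p.Prime) (K : Type*) [Field K] [CharP K p] {n : ℕ}
    (t : Submodule ℤ (Fin n → ℤ))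
    (ht : ∀ (k : ℤ) (χ : Fin n → ℤ), k ≠ 0 → k • χ ∈ t → χ ∈ t)
    (lam : t →ₗ[ℤ] ℤ)
    (b : Hypertoric.Λ p lam → Hypertoric.Wt t lam)
    (hb : ∀ x : Hypertoric.Λ p lam, b x ∈ Hypertoric.Δ p lam x) :
    (∃ Φ : Hypertoric.AlgH (Hypertoric.Shat K t) (Hypertoric.s K t) (Hypertoric.Λ p lam)
          →ₙₐ[Hypertoric.Shat K t] Module.End (Hypertoric.HEAq K t lam) (Hypertoric.P K b),
      Function.Injective Φ ∧ Set.range Φ = Hypertoric.EndP K b ∧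
      (∀ x, Φ (Hypertoric.pgen (Hypertoric.Shat K t) _ (.e x)) = Hypertoric.proj K b x) ∧
      (∀ x y, Hypertoric.IsC K b x y
        (Φ (Hypertoric.pgen (Hypertoric.Shat K t) _ (.c x y))))) ∧
    (Hypertoric.Smooth p lam →
      ∃ Ψ : Hypertoric.AlgA (Hypertoric.Shat K t) (Hypertoric.s K t) (Hypertoric.Λ p lam)
          →ₙₐ[Hypertoric.Shat K t] Module.End (Hypertoric.HEAq K t lam) (Hypertoric.P K b),
        Function.Injective Ψ ∧ Set.range Ψ = Hypertoric.EndP K b ∧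
        (∀ x, Ψ (Hypertoric.pgen (Hypertoric.Shat K t) _ (.e x)) = Hypertoric.proj K b x) ∧
        (∀ i x y h, Hypertoric.IsC K b y x
          (Ψ (Hypertoric.pgen (Hypertoric.Shat K t) _ (.up i x y h)))) ∧
        (∀ i x y h, Hypertoric.IsC K b x y
          (Ψ (Hypertoric.pgen (Hypertoric.Shat K t) _ (.down i x y h))))) := by
  open Hypertoric in
  constructor
  · obtain ⟨h1, h2⟩ := presentedHom_bijective b (homH hp hb)
      (fun xy => gen _ (RelH (Shat K t) (s K t) (Λ p lam)) (.c xy.1 xy.2))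
      (fun xy => NonUnitalAlgebra.subset_adjoin _ ⟨_, rfl⟩) (fun xy => homH_gen hp hb _)
      (fun w hw => mem_span_of_mem_AlgH _ _ hw)
    refine ⟨presentedHom b (homH hp hb), h1, h2, fun x => ?_, fun x y => ?_⟩
    · rw [presentedHom_pgen, homH_gen, genHVal, biEndToEnd_cB, cE_self]
    · rw [presentedHom_pgen, homH_gen, genHVal, biEndToEnd_cB]
      exact isC_cE b x y
  · intro hs
    have hV := hs.tautConnected hp.pos
    obtain ⟨h1, h2⟩ := presentedHom_bijective b (homA hp hb)
      (fun xy => taut hV (s K t) xy.1 xy.2)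
      (fun xy => (isTaut_taut hV _ _ _).mem_presented)
      (fun xy => (isTaut_taut hV _ _ _).homA_eq hp hb)
      (fun w hw => mem_span_of_mem_AlgA hV hw)
    refine ⟨presentedHom b (homA hp hb), h1, h2, fun x => ?_, fun i x y h => ?_,
      fun i x y h => ?_⟩
    · rw [presentedHom_pgen, homA_gen, genAVal, biEndToEnd_cB, cE_self]
    · rw [presentedHom_pgen, homA_gen, genAVal, biEndToEnd_cB]
      exact isC_cE b y x
    · rw [presentedHom_pgen, homA_gen, genAVal, biEndToEnd_cB]
      exact isC_cE b x y
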